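/- Consider the fourth Painlevé equation $$y''=\frac{(y')^2}{2y}+\frac32y^3+4xy^2+2(x^2-a)y-\frac{b}{2y},\qquad a=2\alpha-\frac{\beta}{2},\quad b=\beta^2 ,$$ on the complex plane. Its classical solutions are the meromorphic functions obtained by finitely many Bäcklund transformations $$R_0^{+}[y]=y+\frac{2(1+2\alpha)y}{y'-y^2-2xy-\beta},\qquad R_0^{-}[y]=y+\frac{2(1-2\alpha)y}{y'+y^2+2xy+\beta},\qquad R_\infty^\pm[y]=\pm\frac{y'}{2y}-\frac y2-x+\frac{\beta}{2y}$$ (which change $(\alpha,\beta)$ to $(-\alpha-1,-2\alpha+\beta-1)$, $(-\alpha+1,-2\alpha+\beta+1)$ and $(-\alpha,-2\alpha+\beta\mp1)$ respectively, and are applied only when the denominator is not identically zero) from solutions of the Riccati equations $y'=\sigma(y^2+2xy)+q$, $\sigma^2=1$, $a=-\sigma(\frac q2+1)$, $b=q^2$, together with the trivial solution $y\equiv0$ for $\beta=0$. Put $\Theta(t)=0,\frac12,1$ for $t<0$, $t=0$, $t>0$. All asymptotics are for $|x|\to\infty$, uniformly in closed subsectors. In a formula $y=A(x)\bigl(1+O(x^{-2})\bigr)+\mu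 x^{k}e^{\pm x^2}\bigl(1+O(x^{-2})\bigr)$ the algebraic part $A(x)(1+O(x^{-2}))$ denotes the following background: for $\arg x$ in an open quadrant $\bigl(\frac\pi2(j-1),\frac\pi2j\bigr)$ it is the solution of the same equation which behaves like $A(x)(1+O(x^{-2}))$ in that whole quadrant, and on a ray $\arg x=\frac\pi2j$ it is the mean of the two adjacent backgrounds. On such a ray, $\mu(1+O(x^{-2}))$ is read as $\mu+O(x^{-2})$ when $\mu=0$. Put $\frac1{(m-1)!}=0$ for $m=0$. **Theorem.** Let $\alpha=\frac12+n$, $\beta=-2m$ with integers $n,m\ge0$. Backgrounds with $A(x)=-2x$, $-\frac{\beta}{2x}$, $\frac{\beta}{2x}$ exist in all quadrants, and there exist two families of classical solutions, each parametrized by $c\in\mathbb C\cup\{\infty\}$ (with the natural limits of the formulas below at $c=\infty$). 1. The first family: i) $\arg x\in(-\frac\pi4,\frac\pi4)$: $y=-\frac{\beta}{2x}(1+O(x^{-2}))+\mu_1x^{2n-2m}e^{-x^2}(1+O(x^{-2}))$, $\mu_1=-c(-1)^m2^{n-m+1}\frac{m!}{n!}$ for $c\in\mathbb C$; and $y=-2x(1+O(x^{-2}))$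 for $c=\infty$. ii) $\arg x\in(\frac\pi4,\frac{3\pi}4)$: if $c\ne0$, $y=-2x(1+O(x^{-2}))+\mu_2x^{4n+2m+2}e^{x^2}(1+O(x^{-2}))$, $\mu_2=\bigl(\frac1c+2\sqrt\pi\,\Theta(\arg x-\frac\pi2)\bigr)(-1)^m\frac{2^{2n+m+1}}{n!\,(n+m)!}$; if $c=0$, $y=-\frac{\beta}{2x}(1+O(x^{-2}))$. iii) $\arg x\in(\frac{3\pi}4,\frac{5\pi}4)$: if $1+2\sqrt\pi c\ne0$, $y=-\frac{\beta}{2x}(1+O(x^{-2}))+\mu_3x^{2n-2m}e^{-x^2}(1+O(x^{-2}))$, $\mu_3=-\frac{c}{1+2\sqrt\pi c}(-1)^m2^{n-m+1}\frac{m!}{n!}$; if $1+2\sqrt\pi c=0$, $y=-2x(1+O(x^{-2}))$. iv) $\arg x\in(\frac{5\pi}4,\frac{7\pi}4)$: if $c\ne0$, $y=-2x(1+O(x^{-2}))+\mu_4x^{4n+2m+2}e^{x^2}(1+O(x^{-2}))$, $\mu_4=\bigl(\frac1c+2\sqrt\pi\,\Theta(\frac{3\pi}2-\arg x)\bigr)(-1)^m\frac{2^{2n+m+1}}{n!\,(n+m)!}$;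 if $c=0$, $y=-\frac{\beta}{2x}(1+O(x^{-2}))$. 2. The second family: i) $\arg x\in(-\frac\pi4,\frac\pi4)$: $y=\frac{\beta}{2x}(1+O(x^{-2}))+\mu_1x^{2n+4m}e^{-x^2}(1+O(x^{-2}))$, $\mu_1=-\bigl(c+i\sqrt\pi\,\Theta(\arg x)\bigr)\frac{2^{n+2m+1}}{(n+m)!\,(m-1)!}$ for $c\in\mathbb C$; and $y=-\frac{\beta}{2x}(1+O(x^{-2}))$ for $c=\infty$. ii) $\arg x\in(\frac\pi4,\frac{3\pi}4)$: if $c+i\sqrt\pi\ne0$, $y=-\frac{\beta}{2x}(1+O(x^{-2}))+\mu_2x^{2m-2n-2}e^{x^2}(1+O(x^{-2}))$, $\mu_2=\frac{1}{c+i\sqrt\pi}(-1)^m2^{m-n-1}\frac{n!}{(m-1)!}$; if $c+i\sqrt\pi=0$, $y=\frac{\beta}{2x}(1+O(x^{-2}))$. iii) $\arg x\in(\frac{3\pi}4,\frac{5\pi}4)$: if $c\ne\infty$, $y=\frac{\beta}{2x}(1+O(x^{-2}))+\mu_3x^{2n+4m}e^{-x^2}(1+O(x^{-2}))$, $\mu_3=-\bigl(c+i\sqrt\pi\,\Theta(\pi-\arg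 x)\bigr)\frac{2^{n+2m+1}}{(n+m)!\,(m-1)!}$; if $c=\infty$, $y=-\frac{\beta}{2x}(1+O(x^{-2}))$. iv) $\arg x\in(\frac{5\pi}4,\frac{7\pi}4)$: if $c\ne0$, $y=-\frac{\beta}{2x}(1+O(x^{-2}))+\mu_4x^{2m-2n-2}e^{x^2}(1+O(x^{-2}))$, $\mu_4=\frac1c(-1)^m2^{m-n-1}\frac{n!}{(m-1)!}$; if $c=0$, $y=\frac{\beta}{2x}(1+O(x^{-2}))$. For $m=0$ the second family consists of the trivial solution $y\equiv0$ only. Different values of $c$ give different solutions (in the second family, for $m\ge1$). The families are distinct: they have exactly one solution in common, namely the one with $c=0$ in the first and $c=\infty$ in the second family. This solution is rational, and it is the only rational solution in either family. -/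

import Mathlib

noncomputable section

namespace PainleveIV

open Filter

/-! ### The equation -/

/-- `y` is a (single-valued, meromorphic) solution on `ℂ` of
`y'' = y'^2/(2y) + (3/2) y^3 + 4 x y^2 + 2 (x^2 - a) y - b/(2y)`.
The equation is multiplied by `2 y`, so that it also makes sense at the zeros of `y`, and so that
the trivial function `y = 0` is a solution exactly when `b = 0`. Meromorphic functions are kept
in normal form (removable singularities removed, value `0` at poles); hence two of them are equal
as functions iff they are the same meromorphic function, and the points of analyticity are
exactly the points that are not poles. -/
structure IsSolution (a b : ℂ) (y : ℂ → ℂ) : Prop where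
  meromorphic : MeromorphicNFOn y Set.univ
  equation : ∀ x : ℂ, AnalyticAt ℂ y x →
    2 * y x * deriv (deriv y) x =
      (deriv y x) ^ 2 + 3 * (y x) ^ 4 + 8 * x * (y x) ^ 3 + 4 * (x ^ 2 - a) * (y x) ^ 2 - b

/-! ### Classical solutions -/

/-- The Bäcklund transformation `R_∞^+`. -/
def backlundInfPlus (β : ℂ) (y : ℂ → ℂ) (x : ℂ) : ℂ :=
  deriv y x / (2 * y x) - y x / 2 - x + β / (2 * y x)

/-- The Bäcklund transformation `R_∞^-`. -/
def backlundInfMinus (β : ℂ) (y : ℂ → ℂ) (x : ℂ) : ℂ :=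
  -(deriv y x) / (2 * y x) - y x / 2 - x + β / (2 * y x)

/-- The denominator in `R_0^+`. -/
def denomZeroPlus (β : ℂ) (y : ℂ → ℂ) (x : ℂ) : ℂ :=
  deriv y x - (y x) ^ 2 - 2 * x * y x - β

/-- The denominator in `R_0^-`. -/
def denomZeroMinus (β : ℂ) (y : ℂ → ℂ) (x : ℂ) : ℂ :=
  deriv y x + (y x) ^ 2 + 2 * x * y x + β

/-- The Bäcklund transformation `R_0^+`. -/
def backlundZeroPlus (α β : ℂ) (y : ℂ → ℂ) (x : ℂ) : ℂ :=
  y x + 2 * (1 + 2 * α) * y x / denomZeroPlus β y x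

/-- The Bäcklund transformation `R_0^-`. -/
def backlundZeroMinus (α β : ℂ) (y : ℂ → ℂ) (x : ℂ) : ℂ :=
  y x + 2 * (1 - 2 * α) * y x / denomZeroMinus β y x

/-- `IsClassical α β y`: `y` is a classical solution of the fourth Painlevé equation with
`a = 2 α - β / 2`, `b = β ^ 2`. Classical solutions are generated by the four Bäcklund
transformations from the (meromorphic) solutions of the Riccati equations
`y' = σ (y ^ 2 + 2 x y) + q`, `σ ^ 2 = 1`, for which `a = -σ (q / 2 + 1)` and `b = q ^ 2`, and from
the trivial solution `y = 0` for `β = 0`. A transformation may be applied only when its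
denominator is not identically zero; identities between meromorphic functions are understood off
a discrete closed set. -/
inductive IsClassical : ℂ → ℂ → (ℂ → ℂ) → Prop
  | trivial (α : ℂ) : IsClassical α 0 (fun _ => 0)
  | riccati (α β σ q : ℂ) (y : ℂ → ℂ) (hσ : σ ^ 2 = 1)
      (ha : 2 * α - β / 2 = -σ * (q / 2 + 1)) (hb : β ^ 2 = q ^ 2)
      (hy : MeromorphicNFOn y Set.univ)
      (heq : ∀ x : ℂ, AnalyticAt ℂ y x → deriv y x = σ * ((y x) ^ 2 + 2 * x * y x) + q) :
      IsClassical α β y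
  | infPlus (α β : ℂ) (y w : ℂ → ℂ) (h : IsClassical α β y)
      (hd : ¬ y =ᶠ[codiscrete ℂ] 0) (hw : MeromorphicNFOn w Set.univ)
      (heq : w =ᶠ[codiscrete ℂ] backlundInfPlus β y) :
      IsClassical (-α) (-2 * α + β - 1) w
  | infMinus (α β : ℂ) (y w : ℂ → ℂ) (h : IsClassical α β y)
      (hd : ¬ y =ᶠ[codiscrete ℂ] 0) (hw : MeromorphicNFOn w Set.univ)
      (heq : w =ᶠ[codiscrete ℂ] backlundInfMinus β y) :
      IsClassical (-α) (-2 * α + β + 1) w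
  | zeroPlus (α β : ℂ) (y w : ℂ → ℂ) (h : IsClassical α β y)
      (hd : ¬ denomZeroPlus β y =ᶠ[codiscrete ℂ] 0) (hw : MeromorphicNFOn w Set.univ)
      (heq : w =ᶠ[codiscrete ℂ] backlundZeroPlus α β y) :
      IsClassical (-α - 1) (-2 * α + β - 1) w
  | zeroMinus (α β : ℂ) (y w : ℂ → ℂ) (h : IsClassical α β y)
      (hd : ¬ denomZeroMinus β y =ᶠ[codiscrete ℂ] 0) (hw : MeromorphicNFOn w Set.univ)
      (heq : w =ᶠ[codiscrete ℂ] backlundZeroMinus α β y) :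
      IsClassical (-α + 1) (-2 * α + β + 1) w

/-- `y` is a rational function. -/
def IsRational (y : ℂ → ℂ) : Prop :=
  ∃ P Q : Polynomial ℂ, Q ≠ 0 ∧ ∀ x : ℂ, Q.eval x ≠ 0 → y x = P.eval x / Q.eval x

/-! ### Sectorial asymptotics -/

/-- The point `x` with `|x| = r` and `arg x = φ` (for `r > 0`). -/
def polar (r φ : ℝ) : ℂ := (r : ℂ) * Complex.exp ((φ : ℂ) * Complex.I)

/-- The step function `Θ`, with value `1/2` at the jump. -/
def stepTheta (t : ℝ) : ℂ := if t < 0 then 0 else if t = 0 then 1 / 2 else 1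

/-- `y = lead(x) (1 + O(x ^ (-2)))` as `|x| → ∞`, `arg x ∈ (lo, hi)`, uniformly in closed
subsectors. -/
def PowerAsymp (y lead : ℂ → ℂ) (lo hi : ℝ) : Prop :=
  ∀ δ : ℝ, 0 < δ → ∃ R K : ℝ, 0 < R ∧ ∀ r φ : ℝ, R ≤ r → lo + δ ≤ φ → φ ≤ hi - δ →
    ∃ ε : ℂ, ‖ε‖ ≤ K / r ^ 2 ∧ y (polar r φ) = lead (polar r φ) * (1 + ε)

/-- `B` is the background solution with leading term `lead` in the open quadrant
`π/2 (j - 1) < arg x < π/2 j`: the solution which has the algebraic asymptotics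
`lead(x) (1 + O(x ^ (-2)))`, without exponential term, in the whole quadrant.
(In one half of the quadrant `exp(-x ^ 2)` is decreasing, in the other half `exp(x ^ 2)` is, so no
admixture of either exponential is possible.) -/
def IsBackground (a b : ℂ) (lead : ℂ → ℂ) (j : ℤ) (B : ℂ → ℂ) : Prop :=
  IsSolution a b B ∧ PowerAsymp B lead (Real.pi / 2 * ((j : ℝ) - 1)) (Real.pi / 2 * (j : ℝ))

/-- `y = lead(x) (1 + O(x ^ (-2))) + μ(arg x) amp(x) (1 + O(x ^ (-2)))` as `|x| → ∞` in the sector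
`|arg x - θ| < π/4`, where `θ = π/2 j`, uniformly in closed subsectors. Here `B j` and `B (j + 1)`
are the backgrounds in the two quadrants separated by the Stokes ray `arg x = θ`, and the algebraic
part `lead(x) (1 + O(x ^ (-2)))` is not an arbitrary function of that size, which could hide the
exponentially small term, but the background of the quadrant to which `x` belongs, and on the
Stokes ray the mean of the two backgrounds. On the Stokes ray the
exponential term is written as `amp(x) (μ + O(x ^ (-2)))`, which is the same as
`μ amp(x) (1 + O(x ^ (-2)))` if `μ ≠ 0`, and says that the term vanishes to leading order
if `μ = 0`. -/
def ExpAsymp (y lead : ℂ → ℂ) (B : ℤ → ℂ → ℂ) (j : ℤ) (amp : ℂ → ℂ) (μ : ℝ → ℂ) : Prop :=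
  ∀ δ : ℝ, 0 < δ → ∃ R K : ℝ, 0 < R ∧ ∀ r φ : ℝ, R ≤ r →
    Real.pi / 2 * (j : ℝ) - Real.pi / 4 + δ ≤ φ → φ ≤ Real.pi / 2 * (j : ℝ) + Real.pi / 4 - δ →
    ∃ ε₁ ε₂ : ℂ, ‖ε₁‖ ≤ K / r ^ 2 ∧ ‖ε₂‖ ≤ K / r ^ 2 ∧
      lead (polar r φ) * (1 + ε₁) =
        (1 - stepTheta (φ - Real.pi / 2 * (j : ℝ))) * B j (polar r φ)
          + stepTheta (φ - Real.pi / 2 * (j : ℝ)) * B (j + 1) (polar r φ) ∧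
      (φ ≠ Real.pi / 2 * (j : ℝ) →
        y (polar r φ) = lead (polar r φ) * (1 + ε₁) + μ φ * amp (polar r φ) * (1 + ε₂)) ∧
      (φ = Real.pi / 2 * (j : ℝ) →
        y (polar r φ) = lead (polar r φ) * (1 + ε₁) + amp (polar r φ) * (μ φ + ε₂))

/-! ### The two families -/

/-- `√π` as a complex number. -/
def sqrtPi : ℂ := ((Real.sqrt Real.pi : ℝ) : ℂ)

/-- The leading term `-2 x`. -/
def leadLin (x : ℂ) : ℂ := -2 * x

/-- The leading term `-β / (2 x)`. -/
def leadMinus (β x : ℂ) : ℂ := -β / (2 * x)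

/-- The leading term `β / (2 x)`. -/
def leadPlus (β x : ℂ) : ℂ := β / (2 * x)

/-- `x ^ k exp(-x ^ 2)`. -/
def ampMinus (k : ℤ) (x : ℂ) : ℂ := x ^ k * Complex.exp (-x ^ 2)

/-- `x ^ k exp(x ^ 2)`. -/
def ampPlus (k : ℤ) (x : ℂ) : ℂ := x ^ k * Complex.exp (x ^ 2)

/-- `1 / (m - 1)!`, which is `1 / Γ(m) = 0` for `m = 0`. -/
def invFactPred (m : ℕ) : ℂ := (m : ℂ) / (m.factorial : ℂ)

/-- `(-1)^m 2^(n-m+1) m! / n!` -/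
def const₁ (n m : ℕ) : ℂ :=
  (-1) ^ m * 2 ^ ((n : ℤ) - m + 1) * ((m.factorial : ℂ) / (n.factorial : ℂ))

/-- `(-1)^m 2^(2n+m+1) / (n! (n+m)!)` -/
def const₂ (n m : ℕ) : ℂ :=
  (-1) ^ m * (2 ^ (2 * n + m + 1) / ((n.factorial : ℂ) * ((n + m).factorial : ℂ)))

/-- `2^(n+2m+1) / ((n+m)! (m-1)!)` -/
def const₃ (n m : ℕ) : ℂ :=
  2 ^ (n + 2 * m + 1) / ((n + m).factorial : ℂ) * invFactPred m

/-- `(-1)^m 2^(m-n-1) n! / (m-1)!` -/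
def const₄ (n m : ℕ) : ℂ :=
  (-1) ^ m * 2 ^ ((m : ℤ) - n - 1) * ((n.factorial : ℂ) * invFactPred m)

/-- The asymptotics, in the sectors i)-iv), of the first family `Y c`, `c ∈ ℂ ∪ {∞}`.
`BL` and `BM` are the backgrounds with the leading terms `-2 x` and `-β / (2 x)`. -/
structure FirstFamily (β : ℂ) (n m : ℕ) (BL BM : ℤ → ℂ → ℂ) (Y : OnePoint ℂ → ℂ → ℂ) :
    Prop where
  /-- i) `arg x ∈ (-π/4, π/4)` -/
  sector_i : ∀ c : ℂ,
    ExpAsymp (Y c) (leadMinus β) BM 0 (ampMinus (2 * (n : ℤ) - 2 * m)) (fun _ => -c * const₁ n m)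
  sector_i_infty : PowerAsymp (Y OnePoint.infty) leadLin (-Real.pi / 4) (Real.pi / 4)
  /-- ii) `arg x ∈ (π/4, 3π/4)` -/
  sector_ii : ∀ c : ℂ, c ≠ 0 →
    ExpAsymp (Y c) leadLin BL 1 (ampPlus (4 * (n : ℤ) + 2 * m + 2))
      (fun φ => (1 / c + 2 * sqrtPi * stepTheta (φ - Real.pi / 2)) * const₂ n m)
  sector_ii_infty :
    ExpAsymp (Y OnePoint.infty) leadLin BL 1 (ampPlus (4 * (n : ℤ) + 2 * m + 2))
      (fun φ => 2 * sqrtPi * stepTheta (φ - Real.pi / 2) * const₂ n m)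
  sector_ii_zero : PowerAsymp (Y (0 : ℂ)) (leadMinus β) (Real.pi / 4) (3 * Real.pi / 4)
  /-- iii) `arg x ∈ (3π/4, 5π/4)` -/
  sector_iii : ∀ c : ℂ, 1 + 2 * sqrtPi * c ≠ 0 →
    ExpAsymp (Y c) (leadMinus β) BM 2 (ampMinus (2 * (n : ℤ) - 2 * m))
      (fun _ => -(c / (1 + 2 * sqrtPi * c)) * const₁ n m)
  sector_iii_infty :
    ExpAsymp (Y OnePoint.infty) (leadMinus β) BM 2 (ampMinus (2 * (n : ℤ) - 2 * m))
      (fun _ => -(1 / (2 * sqrtPi)) * const₁ n m)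
  sector_iii_except : ∀ c : ℂ, 1 + 2 * sqrtPi * c = 0 →
    PowerAsymp (Y c) leadLin (3 * Real.pi / 4) (5 * Real.pi / 4)
  /-- iv) `arg x ∈ (5π/4, 7π/4)` -/
  sector_iv : ∀ c : ℂ, c ≠ 0 →
    ExpAsymp (Y c) leadLin BL 3 (ampPlus (4 * (n : ℤ) + 2 * m + 2))
      (fun φ => (1 / c + 2 * sqrtPi * stepTheta (3 * Real.pi / 2 - φ)) * const₂ n m)
  sector_iv_infty :
    ExpAsymp (Y OnePoint.infty) leadLin BL 3 (ampPlus (4 * (n : ℤ) + 2 * m + 2))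
      (fun φ => 2 * sqrtPi * stepTheta (3 * Real.pi / 2 - φ) * const₂ n m)
  sector_iv_zero : PowerAsymp (Y (0 : ℂ)) (leadMinus β) (5 * Real.pi / 4) (7 * Real.pi / 4)

/-- The asymptotics, in the sectors i)-iv), of the second family `Y c`, `c ∈ ℂ ∪ {∞}`.
`BM` and `BP` are the backgrounds with the leading terms `-β / (2 x)` and `β / (2 x)`. -/
structure SecondFamily (β : ℂ) (n m : ℕ) (BM BP : ℤ → ℂ → ℂ) (Y : OnePoint ℂ → ℂ → ℂ) :
    Prop where
  /-- i) `arg x ∈ (-π/4, π/4)` -/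
  sector_i : ∀ c : ℂ,
    ExpAsymp (Y c) (leadPlus β) BP 0 (ampMinus (2 * (n : ℤ) + 4 * m))
      (fun φ => -(c + Complex.I * sqrtPi * stepTheta φ) * const₃ n m)
  sector_i_infty : PowerAsymp (Y OnePoint.infty) (leadMinus β) (-Real.pi / 4) (Real.pi / 4)
  /-- ii) `arg x ∈ (π/4, 3π/4)` -/
  sector_ii : ∀ c : ℂ, c + Complex.I * sqrtPi ≠ 0 →
    ExpAsymp (Y c) (leadMinus β) BM 1 (ampPlus (2 * (m : ℤ) - 2 * n - 2))
      (fun _ => 1 / (c + Complex.I * sqrtPi) * const₄ n m)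
  sector_ii_infty :
    ExpAsymp (Y OnePoint.infty) (leadMinus β) BM 1 (ampPlus (2 * (m : ℤ) - 2 * n - 2))
      (fun _ => 0)
  sector_ii_except : ∀ c : ℂ, c + Complex.I * sqrtPi = 0 →
    PowerAsymp (Y c) (leadPlus β) (Real.pi / 4) (3 * Real.pi / 4)
  /-- iii) `arg x ∈ (3π/4, 5π/4)` -/
  sector_iii : ∀ c : ℂ,
    ExpAsymp (Y c) (leadPlus β) BP 2 (ampMinus (2 * (n : ℤ) + 4 * m))
      (fun φ => -(c + Complex.I * sqrtPi * stepTheta (Real.pi - φ)) * const₃ n m)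
  sector_iii_infty :
    PowerAsymp (Y OnePoint.infty) (leadMinus β) (3 * Real.pi / 4) (5 * Real.pi / 4)
  /-- iv) `arg x ∈ (5π/4, 7π/4)` -/
  sector_iv : ∀ c : ℂ, c ≠ 0 →
    ExpAsymp (Y c) (leadMinus β) BM 3 (ampPlus (2 * (m : ℤ) - 2 * n - 2))
      (fun _ => 1 / c * const₄ n m)
  sector_iv_infty :
    ExpAsymp (Y OnePoint.infty) (leadMinus β) BM 3 (ampPlus (2 * (m : ℤ) - 2 * n - 2))
      (fun _ => 0)
  sector_iv_zero : PowerAsymp (Y (0 : ℂ)) (leadPlus β) (5 * Real.pi / 4) (7 * Real.pi / 4)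

end PainleveIV

end

/-!
The equation is the first component of a symmetric system for three meromorphic functions:
`u + v + w = -2 x` and `u' = u (v - w) + a`, together with the two cyclic images of this equation
(`SymSystem`). In this form the Bäcklund transformations are the reflections
`(u, v, w) ↦ (u - b / v, v, w + b / v)` of an affine Weyl group of type `A₂`, which act on the
parameters `(a, b, c)`, and the parameters of the theorem, `(2 m, -2 - 2 m - 2 n, 2 n)`, arise from
`(0, -2, 0)` by translations, each of which is a product of two reflections and a cyclic renaming
(`Triple.shiftLeft`, `Triple.shiftRight`, `Triple.orbit`). No denominator vanishes identically,
as the functions in the denominators have nonzero parameters (`SymSystem.ne_zero₂`).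

For the parameters `(0, -2, 0)` there are the solutions with `w = 0` and those with `u = 0`. In both
cases the other two functions come from a Riccati equation, whose solution is, up to the sign, the
logarithmic derivative of `D = A + B F(κ x)`, where `F(x) = ∫ₓ^∞ exp(-s ^ 2) ds` and `κ = 1` or
`κ = -i` (`seedOne`, `seedTwo`). The ratio of `A` and `B` is the parameter of the two families. All
asymptotics of the seeds follow from `F(x) ~ exp(-x ^ 2) / (2 x)` for `|arg x| < 3π/4` and from the
connection formula `F(x) + F(-x) = √π`, which is the only source of Stokes phenomena
(`errIntegral_sectorLim`, `errIntegral_add_neg`).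

The asymptotics are then transported along the translations. In each of the sectors of the theorem
one of the three functions is `-2 x + O(1 / x)` and the other two are `O(1 / x)` (`MiddleLarge`),
and by the differential equations and Cauchy's estimate this already determines their leading terms.
Two solutions for which the same function is large differ by an exponentially small quantity. The
structure `ExpPair` records its leading term, and the three reflections map such a pair to another
one and replace the leading coefficient `μ` by `-4 ε μ / a`, `μ` and `ε c μ / 4`, respectively
(`ExpPair.reflect₁`, `ExpPair.reflect₂`, `ExpPair.reflect₃`). Iteration gives the factorials of the
theorem (`Triple.PairVPos.orbit` and the three similar theorems).

The backgrounds are themselves members of the families, namely those for which `A` or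
`A + B √π` or `B` vanishes, whose algebraic asymptotics hold in a larger sector. So the exponential
terms are the differences of two members, which `ExpPair` describes; on a Stokes ray the
backgrounds on both sides differ, and the mean of the two comparisons is taken
(`expAsymp_of_lims`). Finally, members are told apart by their asymptotics, and a rational function
has the same asymptotics in all directions (`PainleveIV.IsRational.sectorLim_unique`), which leaves
only the member with `B = 0`.
-/

open Filter Topology Asymptotics PainleveIV

/-! ### Meromorphic functions up to discrete sets -/

theorem eventually_codiscrete_iff {P : ℂ → Prop} :
    (∀ᶠ x in codiscrete ℂ, P x) ↔ ∀ x, ∀ᶠ z in 𝓝[≠] x, P z := by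
  change {x | P x} ∈ codiscreteWithin Set.univ ↔ _
  rw [mem_codiscreteWithin_iff_forall_mem_nhdsNE]
  simp [Filter.Eventually]

theorem eventually_codiscrete_eventually_nhds {P : ℂ → Prop}
    (h : ∀ᶠ x in codiscrete ℂ, P x) : ∀ᶠ x in codiscrete ℂ, ∀ᶠ z in 𝓝 x, P z := by
  rw [eventually_codiscrete_iff] at h ⊢
  intro x
  filter_upwards [eventually_eventually_nhdsWithin.2 (h x), self_mem_nhdsWithin] with y hy hyx
  rwa [IsOpen.nhdsWithin_eq isOpen_compl_singleton hyx] at hy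

theorem deriv_congr_codiscrete {f g : ℂ → ℂ} (h : f =ᶠ[codiscrete ℂ] g) :
    deriv f =ᶠ[codiscrete ℂ] deriv g := by
  filter_upwards [eventually_codiscrete_eventually_nhds h] with x hx
  exact Filter.EventuallyEq.deriv_eq hx

theorem exists_of_eventually_codiscrete {P : ℂ → Prop} (h : ∀ᶠ x in codiscrete ℂ, P x) :
    ∃ x, P x :=
  (eventually_codiscrete_iff.1 h 0).exists

theorem eq_of_codiscrete_eq {f g : ℂ → ℂ} {x : ℂ} (h : f =ᶠ[codiscrete ℂ] g)
    (hf : ContinuousAt f x) (hg : ContinuousAt g x) : f x = g x :=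
  ((hf.eventuallyEq_nhds_iff_eventuallyEq_nhdsNE hg).1
    (eventually_codiscrete_iff.1 h x)).eq_of_nhds

theorem eventually_eq_zero_or_ne_zero {f : ℂ → ℂ} (hf : Meromorphic f) :
    (∀ᶠ x in codiscrete ℂ, f x = 0) ∨ ∀ᶠ x in codiscrete ℂ, f x ≠ 0 := by
  by_cases h : ∃ x, meromorphicOrderAt f x ≠ ⊤
  · right
    have h' := (hf.exists_meromorphicOrderAt_ne_top_iff_forall).1 h
    exact eventually_codiscrete_iff.2 fun x =>
      (meromorphicOrderAt_ne_top_iff_eventually_ne_zero (hf x)).1 (h' x)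
  · left
    push Not at h
    exact eventually_codiscrete_iff.2 fun x => meromorphicOrderAt_eq_top_iff.1 (h x)

/-- The normal form of a function that is meromorphic on the plane. -/
noncomputable def normalForm (f : ℂ → ℂ) : ℂ → ℂ := toMeromorphicNFOn f Set.univ

theorem normalForm_meromorphicNFOn (f : ℂ → ℂ) : MeromorphicNFOn (normalForm f) Set.univ :=
  meromorphicNFOn_toMeromorphicNFOn f Set.univ

theorem normalForm_eq_codiscrete {f : ℂ → ℂ} (hf : Meromorphic f) :
    normalForm f =ᶠ[codiscrete ℂ] f :=
  (toMeromorphicNFOn_eqOn_codiscrete hf.meromorphicOn).symm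

theorem normalForm_eq_of_analyticAt {f : ℂ → ℂ} (hf : Meromorphic f) {x : ℂ}
    (h : AnalyticAt ℂ f x) : normalForm f x = f x := by
  rw [normalForm, toMeromorphicNFOn_eq_toMeromorphicNFAt hf.meromorphicOn (Set.mem_univ x),
    toMeromorphicNFAt_eq_self.2 h.meromorphicNFAt]

theorem eq_of_normalForms {f g : ℂ → ℂ} (hf : MeromorphicNFOn f Set.univ)
    (hg : MeromorphicNFOn g Set.univ) (h : f =ᶠ[codiscrete ℂ] g) : f = g := by
  ext x
  exact (((hf (Set.mem_univ x)).eventuallyEq_nhdsNE_iff_eventuallyEq_nhds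
    (hg (Set.mem_univ x))).1 (eventually_codiscrete_iff.1 h x)).eq_of_nhds

theorem normalForm_eq_zero {f : ℂ → ℂ} (hf : Meromorphic f)
    (h : ∀ᶠ x in codiscrete ℂ, f x = 0) : normalForm f = fun _ => 0 :=
  eq_of_normalForms (normalForm_meromorphicNFOn f)
    (fun _ _ => analyticAt_const.meromorphicNFAt)
    ((normalForm_eq_codiscrete hf).trans h)

/-! ### The symmetric form of the equation -/

/-- The symmetric form of the fourth Painlevé equation: `p, q, r` are meromorphic on the plane,
`p + q + r = -2 x`, and `p' = ε p (q - r) + a` together with its two cyclic images holds off a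
discrete closed set. The sign `ε` is the orientation of the triple; transposing two
of the functions reverses it. -/
structure SymSystem (ε a b c : ℂ) (p q r : ℂ → ℂ) : Prop where
  sign : ε ^ 2 = 1
  mero₁ : Meromorphic p
  mero₂ : Meromorphic q
  mero₃ : Meromorphic r
  equations : ∀ᶠ x in codiscrete ℂ,
    HasDerivAt p (ε * p x * (q x - r x) + a) x ∧
    HasDerivAt q (ε * q x * (r x - p x) + b) x ∧
    HasDerivAt r (ε * r x * (p x - q x) + c) x ∧
    p x + q x + r x = -2 * x

namespace SymSystem

variable {ε a b c : ℂ} {p q r : ℂ → ℂ}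

theorem rotate (h : SymSystem ε a b c p q r) : SymSystem ε b c a q r p where
  sign := h.sign
  mero₁ := h.mero₂
  mero₂ := h.mero₃
  mero₃ := h.mero₁
  equations := by
    filter_upwards [h.equations] with x ⟨h1, h2, h3, h4⟩
    exact ⟨h2, h3, h1, by rw [← h4]; ring⟩

theorem swap (h : SymSystem ε a b c p q r) : SymSystem (-ε) a c b p r q where
  sign := by rw [neg_sq, h.sign]
  mero₁ := h.mero₁
  mero₂ := h.mero₃
  mero₃ := h.mero₂
  equations := by
    filter_upwards [h.equations] with x ⟨h1, h2, h3, h4⟩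
    refine ⟨?_, ?_, ?_, by rw [← h4]; ring⟩
    · convert h1 using 1; ring
    · convert h3 using 1; ring
    · convert h2 using 1; ring

/-- A function with a nonzero parameter does not vanish identically, so that it may serve as a
denominator. -/
theorem ne_zero₂ (h : SymSystem ε a b c p q r) (hb : b ≠ 0) :
    ∀ᶠ x in codiscrete ℂ, q x ≠ 0 := by
  refine (eventually_eq_zero_or_ne_zero h.mero₂).resolve_left fun h0 => hb ?_
  obtain ⟨x, ⟨-, h2, -⟩, hx⟩ :=
    exists_of_eventually_codiscrete
      (h.equations.and (eventually_codiscrete_eventually_nhds h0))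
  have h3 : HasDerivAt q 0 x := (hasDerivAt_const x (0 : ℂ)).congr_of_eventuallyEq hx
  have := h2.unique h3
  rwa [hx.self_of_nhds, mul_zero, zero_mul, zero_add] at this

/-- The Bäcklund transformation of the symmetric form: the simple reflection attached to the
middle function. -/
theorem reflect (h : SymSystem ε a b c p q r) (hb : b ≠ 0) :
    SymSystem ε (a + b) (-b) (c + b) (fun x => p x - ε * b / q x) q
      (fun x => r x + ε * b / q x) where
  sign := h.sign
  mero₁ := h.mero₁.sub ((Meromorphic.const _).div h.mero₂)
  mero₂ := h.mero₂
  mero₃ := h.mero₃.add ((Meromorphic.const _).div h.mero₂)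
  equations := by
    have hε := h.sign
    filter_upwards [h.equations, h.ne_zero₂ hb] with x ⟨h1, h2, h3, h4⟩ hq
    have hd := (hasDerivAt_const x (ε * b)).fun_div h2 hq
    refine ⟨(h1.fun_sub hd).congr_deriv ?_, h2.congr_deriv ?_, (h3.fun_add hd).congr_deriv ?_,
      by rw [← h4]; ring⟩
    · field_simp
      linear_combination (b * q x ^ 2 - ε * b ^ 2) * hε
    · field_simp
      linear_combination (-2 * b) * hε
    · field_simp
      linear_combination (b * q x ^ 2 + ε * b ^ 2) * hε

end SymSystem

namespace SymSystem

variable {a b c : ℂ} {u v w : ℂ → ℂ}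

theorem deriv_normalForm {ε : ℂ} (h : SymSystem ε a b c u v w) :
    ∀ᶠ x in codiscrete ℂ, normalForm u x = u x ∧
      deriv (normalForm u) x = ε * u x * (v x - w x) + a := by
  filter_upwards [h.equations, normalForm_eq_codiscrete h.mero₁,
    deriv_congr_codiscrete (normalForm_eq_codiscrete h.mero₁)] with x hx h1 h2
  exact ⟨h1, by rw [h2, hx.1.deriv]⟩

/-- Elimination of `v` and `w` from the symmetric form gives the fourth Painlevé equation
for `u`. -/
theorem isSolution_normalForm (h : SymSystem 1 a b c u v w) :
    IsSolution ((c - b) / 2) (a ^ 2) (normalForm u) where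
  meromorphic := normalForm_meromorphicNFOn u
  equation := by
    intro x hx
    have hc := hx.continuousAt
    have hc1 := hx.deriv.continuousAt
    have hc2 := hx.deriv.deriv.continuousAt
    refine eq_of_codiscrete_eq (f := fun x => 2 * normalForm u x * deriv (deriv (normalForm u)) x)
      (g := fun x => (deriv (normalForm u) x) ^ 2 + 3 * (normalForm u x) ^ 4 +
        8 * x * (normalForm u x) ^ 3 + 4 * (x ^ 2 - (c - b) / 2) * (normalForm u x) ^ 2 - a ^ 2)
      ?_ (by fun_prop) (by fun_prop)
    have h2 : deriv (deriv (normalForm u)) =ᶠ[codiscrete ℂ]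
        deriv (fun x => 1 * u x * (v x - w x) + a) :=
      deriv_congr_codiscrete (h.deriv_normalForm.mono fun x hx => hx.2)
    filter_upwards [h2, h.deriv_normalForm, h.equations] with z hz ⟨e1, e2⟩ ⟨d1, d2, d3, e3⟩
    have d4 := (((d1.const_mul (1 : ℂ)).fun_mul (d2.fun_sub d3)).add_const a).deriv
    rw [hz, e1, e2, d4]
    have : w z = -2 * z - u z - v z := by linear_combination e3
    rw [this]
    ring

/-! ### Classical solutions -/

theorem deriv_eq_riccati (h : SymSystem 1 a b c u v w)
    (hu : ∀ᶠ x in codiscrete ℂ, u x = 0) {x : ℂ} (hx : AnalyticAt ℂ (normalForm v) x) :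
    deriv (normalForm v) x = -1 * ((normalForm v x) ^ 2 + 2 * x * normalForm v x) + b := by
  have hc := hx.continuousAt
  have hc1 := hx.deriv.continuousAt
  refine eq_of_codiscrete_eq (f := deriv (normalForm v))
    (g := fun x => -1 * ((normalForm v x) ^ 2 + 2 * x * normalForm v x) + b)
    ?_ (by fun_prop) (by fun_prop)
  filter_upwards [hu, h.rotate.deriv_normalForm, h.equations] with z h0 ⟨e1, e2⟩ ⟨_, _, _, e3⟩
  rw [e2, e1]
  have : w z = -2 * z - v z := by linear_combination e3 - h0
  rw [this, h0]
  ring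

/-- If `u` belongs to a symmetric system and is classical, so is `v`: it is the image of `u` under
`R_∞^+`, unless `u` vanishes identically, when `v` solves a Riccati equation. -/
theorem isClassical_rotate {α β : ℂ} (h : SymSystem 1 (-β) (-1 + β - 2 * α) (2 * α - 1) u v w)
    (hu : IsClassical α β (normalForm u)) :
    IsClassical (-α) (-2 * α + β - 1) (normalForm v) := by
  rcases eventually_eq_zero_or_ne_zero h.mero₁ with h0 | h0
  · have hβ : β = 0 := by
      by_contra hne
      obtain ⟨x, h1, h2⟩ := exists_of_eventually_codiscrete
        (h0.and (h.rotate.rotate.ne_zero₂ (neg_ne_zero.2 hne)))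
      exact h2 h1
    subst hβ
    refine IsClassical.riccati _ _ (-1) (-1 + 0 - 2 * α) _ (by norm_num) (by ring) (by ring)
      (normalForm_meromorphicNFOn v) fun x hx => h.deriv_eq_riccati h0 hx
  · refine IsClassical.infPlus α β _ _ hu ?_ (normalForm_meromorphicNFOn v) ?_
    · intro h1
      obtain ⟨x, h2, h3, h4⟩ := exists_of_eventually_codiscrete
        (h0.and (h1.and (normalForm_eq_codiscrete h.mero₁)))
      exact h2 (by rw [← h4, h3]; rfl)
    · filter_upwards [h0, h.deriv_normalForm, h.equations, normalForm_eq_codiscrete h.mero₂]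
        with z h0 ⟨e1, e2⟩ ⟨_, _, _, e3⟩ e4
      rw [backlundInfPlus, e2, e1, e4]
      have : w z = -2 * z - u z - v z := by linear_combination e3
      rw [this]
      field_simp
      ring

end SymSystem

theorem SymSystem.cast {ε a b c a' b' c' : ℂ} {p q r p' q' r' : ℂ → ℂ}
    (h : SymSystem ε a b c p q r) (ha : a' = a) (hb : b' = b) (hc : c' = c)
    (hp : ∀ x, p' x = p x) (hq : ∀ x, q' x = q x) (hr : ∀ x, r' x = r x) :
    SymSystem ε a' b' c' p' q' r' := by
  obtain rfl := funext hp
  obtain rfl := funext hq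
  obtain rfl := funext hr
  subst ha hb hc
  exact h

/-! ### The two translations of the parameter lattice -/

/-- Three functions on the plane, the unknowns of the symmetric form. -/
structure Triple where
  /-- the first function, which solves the fourth Painlevé equation in question -/
  u : ℂ → ℂ
  /-- the second function -/
  v : ℂ → ℂ
  /-- the third function -/
  w : ℂ → ℂ

namespace Triple

/-- The translation `(0, -2 - 2 n, 2 n) ↦ (0, -4 - 2 n, 2 + 2 n)` of the parameters:
the reflection in `v`, then the reflection in `u`, and a cyclic renaming. -/
noncomputable def shiftLeft (n : ℕ) (t : Triple) : Triple where
  u x := t.v x - (2 + 2 * n) / (t.u x + (2 + 2 * n) / t.v x)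
  v x := t.w x - (2 + 2 * n) / t.v x + (2 + 2 * n) / (t.u x + (2 + 2 * n) / t.v x)
  w x := t.u x + (2 + 2 * n) / t.v x

/-- The translation `(2 m, -2 - 2 m - 2 n, 2 n) ↦ (2 + 2 m, -4 - 2 m - 2 n, 2 n)` of the
parameters: the reflection in `v`, then the reflection in `w`, and a cyclic renaming. -/
noncomputable def shiftRight (n m : ℕ) (t : Triple) : Triple where
  u x := t.w x - (2 + 2 * m + 2 * n) / t.v x
  v x := t.u x + (2 + 2 * m + 2 * n) / t.v x
    - (2 + 2 * m) / (t.w x - (2 + 2 * m + 2 * n) / t.v x)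
  w x := t.v x + (2 + 2 * m) / (t.w x - (2 + 2 * m + 2 * n) / t.v x)

/-- The triple with the parameters `(2 m, -2 - 2 m - 2 n, 2 n)` that arises by translations from
the seed `t`, which has the parameters `(0, -2, 0)`. -/
noncomputable def orbit (t : Triple) (n : ℕ) : ℕ → Triple
  | 0 => Nat.rec t (fun k s => s.shiftLeft k) n
  | m + 1 => (orbit t n m).shiftRight n m

theorem orbit_zero_zero (t : Triple) : t.orbit 0 0 = t := rfl

theorem orbit_succ_zero (t : Triple) (n : ℕ) :
    t.orbit (n + 1) 0 = (t.orbit n 0).shiftLeft n := rfl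

theorem orbit_succ (t : Triple) (n m : ℕ) :
    t.orbit n (m + 1) = (t.orbit n m).shiftRight n m := rfl

/-- The triple solves the symmetric form with the parameters `(2 m, -2 - 2 m - 2 n, 2 n)`. -/
def Solves (n m : ℕ) (t : Triple) : Prop :=
  SymSystem 1 (2 * m) (-2 - 2 * m - 2 * n) (2 * n) t.u t.v t.w

variable {t : Triple} {n m : ℕ}

theorem two_add_ne (k : ℕ) : (2 + 2 * k : ℂ) ≠ 0 := by
  have : ((2 + 2 * k : ℕ) : ℂ) ≠ 0 := Nat.cast_ne_zero.2 (by omega)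
  exact_mod_cast this

theorem two_add_add_ne (n m : ℕ) : (2 + 2 * m + 2 * n : ℂ) ≠ 0 := by
  have : ((2 + 2 * m + 2 * n : ℕ) : ℂ) ≠ 0 := Nat.cast_ne_zero.2 (by omega)
  exact_mod_cast this

/-- The reflection in `v`, with which both translations begin. -/
theorem Solves.reflect_v (h : t.Solves n m) :
    SymSystem 1 (-2 - 2 * n) (2 + 2 * m + 2 * n) (-2 - 2 * m)
      (fun x => t.u x + (2 + 2 * m + 2 * n) / t.v x) t.v
      (fun x => t.w x - (2 + 2 * m + 2 * n) / t.v x) := by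
  refine (h.reflect ?_).cast (by ring) (by ring) (by ring) (fun x => by ring) (fun x => rfl)
    (fun x => by ring)
  have := two_add_add_ne n m
  contrapose! this
  linear_combination -this

theorem Solves.shiftLeft (h : t.Solves n 0) : (t.shiftLeft n).Solves (n + 1) 0 := by
  have h1 := h.reflect_v.rotate.rotate
  have h2 := h1.reflect (by have := two_add_ne n; contrapose! this; linear_combination -this)
  refine h2.rotate.rotate.cast ?_ ?_ ?_ (fun x => ?_) (fun x => ?_) (fun x => ?_)
  · push_cast; ring
  · push_cast; ring
  · push_cast; ring
  all_goals simp only [Triple.shiftLeft]; push_cast; ring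

theorem Solves.shiftRight (h : t.Solves n m) : (t.shiftRight n m).Solves n (m + 1) := by
  have h1 := h.reflect_v.rotate
  have h2 := h1.reflect (by have := two_add_ne m; contrapose! this; linear_combination -this)
  refine h2.rotate.cast ?_ ?_ ?_ (fun x => ?_) (fun x => ?_) (fun x => ?_)
  · push_cast; ring
  · push_cast; ring
  · ring
  all_goals simp only [Triple.shiftRight] <;> ring

theorem Solves.orbit (h : t.Solves 0 0) (n m : ℕ) : (t.orbit n m).Solves n m := by
  induction m with
  | zero =>
    induction n with
    | zero => exact h
    | succ n ih => exact ih.shiftLeft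
  | succ m ih => exact ih.shiftRight

theorem Solves.isSolution (h : t.Solves n m) {α β : ℂ} (hα : α = 1 / 2 + n) (hβ : β = -2 * m) :
    IsSolution (2 * α - β / 2) (β ^ 2) (normalForm t.u) := by
  convert h.isSolution_normalForm using 1
  · rw [hα, hβ]; ring
  · rw [hβ]; ring

theorem Solves.isClassical_v (h : t.Solves n m)
    (hu : IsClassical (1 / 2 + n) (-2 * m) (normalForm t.u)) :
    IsClassical (-(1 / 2 + n)) (-2 - 2 * m - 2 * n) (normalForm t.v) := by
  have h' : SymSystem 1 (-(-2 * m : ℂ)) (-1 + (-2 * m) - 2 * (1 / 2 + n)) (2 * (1 / 2 + n) - 1)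
      t.u t.v t.w :=
    h.cast (by ring) (by ring) (by ring) (fun _ => rfl) (fun _ => rfl) (fun _ => rfl)
  convert h'.isClassical_rotate hu using 1
  ring

theorem not_eq_zero_of_ne_zero {f : ℂ → ℂ} (h : ∀ᶠ x in codiscrete ℂ, f x ≠ 0) :
    ¬ f =ᶠ[codiscrete ℂ] 0 := fun h0 => by
  obtain ⟨x, h1, h2⟩ := exists_of_eventually_codiscrete (h.and h0)
  exact h1 h2

/-- The translation `m ↦ m + 1` is the square of `R_∞^+`. -/
theorem Solves.isClassical_shiftRight (h : t.Solves n m)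
    (hu : IsClassical (1 / 2 + n) (-2 * m) (normalForm t.u)) :
    IsClassical (1 / 2 + n) (-2 * (m + 1 : ℕ)) (normalForm (t.shiftRight n m).u) := by
  have hv0 := h.reflect_v.ne_zero₂ (two_add_add_ne n m)
  have key := IsClassical.infPlus _ _ _ (normalForm (t.shiftRight n m).u) (h.isClassical_v hu)
    (not_eq_zero_of_ne_zero ?_) (normalForm_meromorphicNFOn _) ?_
  · convert key using 1
    · ring
    · push_cast; ring
  · filter_upwards [hv0, normalForm_eq_codiscrete h.mero₂] with x h1 h2
    rwa [h2]
  · filter_upwards [hv0, h.rotate.deriv_normalForm, h.equations,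
      normalForm_eq_codiscrete h.shiftRight.mero₁] with z h0 ⟨e1, e2⟩ ⟨_, _, _, e3⟩ e4
    rw [backlundInfPlus, e2, e1, e4, Triple.shiftRight]
    have : t.w z = -2 * z - t.u z - t.v z := by linear_combination e3
    simp only [this]
    field_simp
    ring

/-- The translation `n ↦ n + 1` is `R_∞^+`, followed by `R_0^-`. -/
theorem Solves.isClassical_shiftLeft (h : t.Solves n 0)
    (hu : IsClassical (1 / 2 + n) (-2 * (0 : ℕ)) (normalForm t.u)) :
    IsClassical (1 / 2 + (n + 1 : ℕ)) (-2 * (0 : ℕ)) (normalForm (t.shiftLeft n).u) := by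
  have hv0 := h.reflect_v.ne_zero₂ (two_add_add_ne n 0)
  have hu0 := h.reflect_v.rotate.rotate.ne_zero₂
    (by have := two_add_ne n; contrapose! this; linear_combination -this)
  have hden : ∀ᶠ z in codiscrete ℂ,
      denomZeroMinus (-2 - 2 * (0 : ℕ) - 2 * n) (normalForm t.v) z =
        -2 * t.v z * (t.u z + (2 + 2 * n) / t.v z) := by
    filter_upwards [hv0, h.rotate.deriv_normalForm, h.equations] with z h0 ⟨e1, e2⟩ ⟨_, _, _, e3⟩
    rw [denomZeroMinus, e2, e1]
    have : t.w z = -2 * z - t.u z - t.v z := by linear_combination e3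
    rw [this]
    field_simp
    push_cast
    ring
  have key := IsClassical.zeroMinus _ _ _ (normalForm (t.shiftLeft n).u) (h.isClassical_v hu)
    (not_eq_zero_of_ne_zero ?_) (normalForm_meromorphicNFOn _) ?_
  · convert key using 1
    · push_cast; ring
    · push_cast; ring
  · filter_upwards [hv0, hu0, hden] with z h0 h1 h2
    rw [h2]
    simp only [CharP.cast_eq_zero, mul_zero, add_zero] at h1
    exact mul_ne_zero (mul_ne_zero (by norm_num) h0) h1
  · filter_upwards [hv0, hu0, hden, normalForm_eq_codiscrete h.mero₂,
      normalForm_eq_codiscrete h.shiftLeft.mero₁] with z h0 h1 h2 e1 e2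
    simp only [CharP.cast_eq_zero, mul_zero, add_zero] at h1
    rw [backlundZeroMinus, h2, e1, e2, Triple.shiftLeft]
    simp only
    generalize t.u z + (2 + 2 * n) / t.v z = s at h1
    field_simp
    ring

theorem Solves.isClassical_orbit (h : t.Solves 0 0)
    (hu : IsClassical (1 / 2) 0 (normalForm t.u)) (n m : ℕ) :
    IsClassical (1 / 2 + n) (-2 * m) (normalForm (t.orbit n m).u) := by
  induction m with
  | zero =>
    induction n with
    | zero => simpa [orbit_zero_zero] using hu
    | succ n ih => exact (h.orbit n 0).isClassical_shiftLeft ih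
  | succ m ih => exact (h.orbit n m).isClassical_shiftRight ih

/-- For `m = 0`, a seed with vanishing first function keeps it under the translations. -/
theorem Solves.orbit_u_eq_zero (h : t.Solves 0 0) (hu : ∀ x, t.u x = 0) (n : ℕ) :
    ∀ᶠ x in codiscrete ℂ, (t.orbit n 0).u x = 0 := by
  induction n with
  | zero => exact Eventually.of_forall hu
  | succ n ih =>
    filter_upwards [ih, (h.orbit n 0).reflect_v.ne_zero₂ (two_add_add_ne n 0)] with x h1 h2
    have := two_add_ne n
    rw [orbit_succ_zero, Triple.shiftLeft]
    simp only [h1, zero_add]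
    generalize (2 + 2 * n : ℂ) = k at this
    field_simp
    ring

end Triple

/-! ### Algebraic order of growth in sectors -/

/-- The filter of `|x| → ∞` in the closed sector `lo ≤ arg x ≤ hi` of the plane. -/
noncomputable def closedSector (lo hi : ℝ) : Filter ℂ :=
  Filter.map (fun p : ℝ × ℝ => polar p.1 p.2) (atTop ×ˢ 𝓟 (Set.Icc lo hi))

/-- The filter of `|x| → ∞` in the closed subsectors of the open sector `lo < arg x < hi`: a
property holds eventually if it holds for large `|x|` in every closed subsector. -/
noncomputable def openSector (lo hi : ℝ) : Filter ℂ :=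
  ⨆ δ : Set.Ioi (0 : ℝ), closedSector (lo + δ) (hi - δ)

/-- `f = O(x ^ n)` uniformly in closed subsectors of `lo < arg x < hi`. The constant may depend on
the subsector, so this is weaker than `f =O[openSector lo hi] (· ^ n)`. -/
def SectorO (lo hi : ℝ) (n : ℤ) (f : ℂ → ℂ) : Prop :=
  ∀ δ : ℝ, 0 < δ → f =O[closedSector (lo + δ) (hi - δ)] fun x => x ^ n

/-- `f = c + O(x ^ (-2))` uniformly in closed subsectors of `lo < arg x < hi`. -/
def SectorLim (lo hi : ℝ) (f : ℂ → ℂ) (c : ℂ) : Prop :=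
  SectorO lo hi (-2) fun x => f x - c

theorem norm_polar {r : ℝ} (hr : 0 ≤ r) (φ : ℝ) : ‖polar r φ‖ = r := by
  rw [polar, norm_mul, Complex.norm_exp_ofReal_mul_I, mul_one, Complex.norm_real,
    Real.norm_of_nonneg hr]

theorem eventually_closedSector {lo hi : ℝ} {P : ℂ → Prop} :
    (∀ᶠ x in closedSector lo hi, P x) ↔
      ∃ R : ℝ, 0 < R ∧ ∀ r φ : ℝ, R ≤ r → lo ≤ φ → φ ≤ hi → P (polar r φ) := by
  rw [closedSector, eventually_map, eventually_prod_principal_iff, eventually_atTop]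
  constructor
  · rintro ⟨R, hR⟩
    exact ⟨max R 1, by positivity, fun r φ hr h1 h2 => hR r (le_of_max_le_left hr) φ ⟨h1, h2⟩⟩
  · rintro ⟨R, -, hR⟩
    exact ⟨R, fun r hr φ hφ => hR r φ hr hφ.1 hφ.2⟩

theorem eventually_openSector {lo hi : ℝ} {P : ℂ → Prop} :
    (∀ᶠ x in openSector lo hi, P x) ↔
      ∀ δ : ℝ, 0 < δ → ∀ᶠ x in closedSector (lo + δ) (hi - δ), P x := by
  simp [openSector]

theorem eventually_norm_ge (lo hi C : ℝ) : ∀ᶠ x in openSector lo hi, C ≤ ‖x‖ := by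
  refine eventually_openSector.2 fun δ _ => eventually_closedSector.2
    ⟨max C 1, by positivity, fun r φ hr _ _ => ?_⟩
  have h1 : (1 : ℝ) ≤ r := (le_max_right _ _).trans hr
  rw [norm_polar (by linarith)]
  exact (le_max_left _ _).trans hr

theorem eventually_ne_zero (lo hi : ℝ) : ∀ᶠ x in openSector lo hi, x ≠ 0 := by
  filter_upwards [eventually_norm_ge lo hi 1] with x hx h0
  rw [h0, norm_zero] at hx
  linarith

namespace SectorO

variable {lo hi : ℝ} {n m : ℤ} {f g : ℂ → ℂ}

theorem congr (hf : SectorO lo hi n f) (h : ∀ᶠ x in openSector lo hi, g x = f x) :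
    SectorO lo hi n g := fun δ hδ =>
  (hf δ hδ).congr' (EventuallyEq.symm (eventually_openSector.1 h δ hδ)) EventuallyEq.rfl

theorem add (hf : SectorO lo hi n f) (hg : SectorO lo hi n g) :
    SectorO lo hi n fun x => f x + g x := fun δ hδ => (hf δ hδ).add (hg δ hδ)

theorem sub (hf : SectorO lo hi n f) (hg : SectorO lo hi n g) :
    SectorO lo hi n fun x => f x - g x := fun δ hδ => (hf δ hδ).sub (hg δ hδ)

theorem neg (hf : SectorO lo hi n f) : SectorO lo hi n fun x => -f x :=
  fun δ hδ => (hf δ hδ).neg_left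

theorem const_mul (hf : SectorO lo hi n f) (c : ℂ) : SectorO lo hi n fun x => c * f x :=
  fun δ hδ => (hf δ hδ).const_mul_left c

theorem mul (hf : SectorO lo hi n f) (hg : SectorO lo hi m g) :
    SectorO lo hi (n + m) fun x => f x * g x := fun δ hδ => by
  refine ((hf δ hδ).mul (hg δ hδ)).congr' EventuallyEq.rfl ?_
  filter_upwards [eventually_openSector.1 (eventually_ne_zero lo hi) δ hδ] with x hx
  rw [zpow_add₀ hx]

theorem mono (hf : SectorO lo hi n f) (h : n ≤ m) : SectorO lo hi m f := fun δ hδ => by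
  refine (hf δ hδ).trans (IsBigO.of_bound 1 ?_)
  filter_upwards [eventually_openSector.1 (eventually_norm_ge lo hi 1) δ hδ] with x hx
  rw [one_mul, norm_zpow, norm_zpow]
  exact zpow_le_zpow_right₀ hx h

theorem zpow (lo hi : ℝ) (n : ℤ) : SectorO lo hi n fun x => x ^ n := fun _ _ => isBigO_refl _ _

theorem const (lo hi : ℝ) (c : ℂ) : SectorO lo hi 0 fun _ => c := fun δ _ => by
  simpa using isBigO_const_const c (one_ne_zero (α := ℂ)) (closedSector (lo + δ) (hi - δ))

theorem zero (lo hi : ℝ) (n : ℤ) : SectorO lo hi n fun _ => 0 := fun _ _ => isBigO_zero _ _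

theorem zpow_mul (hf : SectorO lo hi n f) (k : ℤ) :
    SectorO lo hi (k + n) fun x => x ^ k * f x := (zpow lo hi k).mul hf

theorem subsector (hf : SectorO lo hi n f) {lo' hi' : ℝ} (h1 : lo ≤ lo') (h2 : hi' ≤ hi) :
    SectorO lo' hi' n f := fun δ hδ => by
  refine (hf δ hδ).mono ?_
  refine Filter.map_mono (Filter.prod_mono le_rfl ?_)
  exact Filter.principal_mono.2 (Set.Icc_subset_Icc (by linarith) (by linarith))

/-- The definition in terms of bounds, as in the statements on `PowerAsymp` and `ExpAsymp`. -/
theorem bound_iff : SectorO lo hi n f ↔ ∀ δ : ℝ, 0 < δ → ∃ R K : ℝ, 0 < R ∧ 0 < K ∧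
    ∀ r φ : ℝ, R ≤ r → lo + δ ≤ φ → φ ≤ hi - δ → ‖f (polar r φ)‖ ≤ K * r ^ n := by
  constructor
  · intro h δ hδ
    obtain ⟨K, hK, hb⟩ := (h δ hδ).exists_pos
    obtain ⟨R, hR, H⟩ := eventually_closedSector.1 hb.bound
    refine ⟨R, K, hR, hK, fun r φ hr h1 h2 => ?_⟩
    have := H r φ hr h1 h2
    rwa [norm_zpow, norm_polar (by linarith)] at this
  · intro h δ hδ
    obtain ⟨R, K, hR, -, H⟩ := h δ hδ
    refine IsBigO.of_bound K (eventually_closedSector.2 ⟨R, hR, fun r φ hr h1 h2 => ?_⟩)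
    rw [norm_zpow, norm_polar (by linarith)]
    exact H r φ hr h1 h2

end SectorO

/-- A disc around a point of a sector, of radius proportional to the distance of its centre from
the origin, stays in a slightly larger sector. -/
theorem exists_polar_of_norm_sub_le {δ : ℝ} (hδ : 0 < δ) : ∃ η : ℝ, 0 < η ∧ η ≤ 1 / 2 ∧
    ∀ r φ : ℝ, 0 < r → ∀ z : ℂ, ‖z - polar r φ‖ ≤ η * r →
      ∃ r' φ' : ℝ, r / 2 ≤ r' ∧ r' ≤ 2 * r ∧ |φ' - φ| ≤ δ ∧ z = polar r' φ' := by
  obtain ⟨η, hη, H⟩ := Metric.continuousAt_iff.1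
    (Complex.continuousAt_arg (x := 1) (by simp)) δ hδ
  refine ⟨min (η / 2) (1 / 2), by positivity, min_le_right _ _, fun r φ hr z hz => ?_⟩
  have hp : ‖polar r φ‖ = r := norm_polar hr.le φ
  have hp0 : polar r φ ≠ 0 := by rw [← norm_pos_iff, hp]; exact hr
  have hζ : ‖z / polar r φ - 1‖ ≤ min (η / 2) (1 / 2) := by
    rw [div_sub_one hp0, norm_div, hp, div_le_iff₀ hr]
    exact hz
  have h1 : ‖z / polar r φ - 1‖ ≤ 1 / 2 := hζ.trans (min_le_right _ _)
  have h2 : ‖z / polar r φ - 1‖ < η := (hζ.trans (min_le_left _ _)).trans_lt (by linarith)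
  have h3 := norm_sub_norm_le (z / polar r φ) 1
  have h4 := norm_sub_norm_le 1 (z / polar r φ)
  rw [norm_sub_rev] at h4
  rw [norm_one] at h3 h4
  refine ⟨r * ‖z / polar r φ‖, φ + (z / polar r φ).arg, ?_, ?_, ?_, ?_⟩
  · nlinarith
  · nlinarith
  · have := H (x := z / polar r φ) (by rwa [dist_eq_norm])
    rw [Complex.arg_one, dist_zero_right, Real.norm_eq_abs] at this
    simpa using this.le
  · have h5 := Complex.norm_mul_exp_arg_mul_I (z / polar r φ)
    have : polar (r * ‖z / polar r φ‖) (φ + (z / polar r φ).arg) =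
        polar r φ * (‖z / polar r φ‖ * Complex.exp ((z / polar r φ).arg * Complex.I)) := by
      rw [polar, polar]
      push_cast
      rw [add_mul, Complex.exp_add]
      ring
    rw [this, h5, mul_div_cancel₀ _ hp0]

theorem zpow_le_of_half_le {r s : ℝ} (hr : 0 < r) (h1 : r / 2 ≤ s) (h2 : s ≤ 2 * r) (n : ℤ) :
    s ^ n ≤ 2 ^ |n| * r ^ n := by
  rcases le_total 0 n with hn | hn
  · rw [abs_of_nonneg hn, ← mul_zpow]
    exact zpow_le_zpow_left₀ hn (by linarith) h2
  · rw [abs_of_nonpos hn, zpow_neg, ← inv_zpow, ← mul_zpow]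
    have h3 : 2⁻¹ * r ≤ s := by linarith
    have := zpow_le_zpow_left₀ (n := -n) (by omega) (by positivity) h3
    rw [zpow_neg, zpow_neg] at this
    exact (inv_le_inv₀ (zpow_pos (by positivity) _) (zpow_pos (by linarith) _)).1 this

/-- Cauchy's estimate: differentiation lowers the order of growth in sectors by one. -/
theorem SectorO.deriv {lo hi : ℝ} {n : ℤ} {f : ℂ → ℂ} (hf : SectorO lo hi n f)
    (ha : ∀ᶠ x in openSector lo hi, AnalyticAt ℂ f x) : SectorO lo hi (n - 1) (deriv f) := by
  refine SectorO.bound_iff.2 fun δ hδ => ?_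
  obtain ⟨R, K, hR, hK, H⟩ := SectorO.bound_iff.1 hf (δ / 2) (by positivity)
  obtain ⟨R', hR', H'⟩ := eventually_closedSector.1
    (eventually_openSector.1 ha (δ / 2) (by positivity))
  obtain ⟨η, hη, hη1, hz⟩ := exists_polar_of_norm_sub_le (δ := δ / 2) (by positivity)
  refine ⟨2 * max R R', K * 2 ^ |n| / η, by positivity, by positivity, fun r φ hr h1 h2 => ?_⟩
  have hr0 : 0 < r := lt_of_lt_of_le (by positivity) hr
  have hRr : R ≤ r / 2 := by linarith [le_max_left R R']
  have hRr' : R' ≤ r / 2 := by linarith [le_max_right R R']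
  have hball : ∀ z ∈ Metric.closedBall (polar r φ) (η * r),
      AnalyticAt ℂ f z ∧ ‖f z‖ ≤ K * (2 ^ |n| * r ^ n) := by
    intro z hzz
    obtain ⟨r', φ', h3, h4, h5, rfl⟩ := hz r φ hr0 z (by simpa [dist_eq_norm] using hzz)
    have h6 := abs_le.1 h5
    refine ⟨H' r' φ' (by linarith) (by linarith) (by linarith), ?_⟩
    refine (H r' φ' (by linarith) (by linarith) (by linarith)).trans ?_
    exact mul_le_mul_of_nonneg_left (zpow_le_of_half_le hr0 h3 h4 n) hK.le
  have hρ : 0 < η * r := by positivity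
  have key := Complex.norm_deriv_le_of_forall_mem_sphere_norm_le hρ
    (f := f) (c := polar r φ) (C := K * (2 ^ |n| * r ^ n)) ?_ ?_
  · refine key.trans (le_of_eq ?_)
    rw [zpow_sub_one₀ hr0.ne']
    field_simp
  · refine DifferentiableOn.diffContOnCl fun z hzz => ?_
    rw [closure_ball _ hρ.ne'] at hzz
    exact (hball z hzz).1.differentiableAt.differentiableWithinAt
  · exact fun z hzz => (hball z (Metric.sphere_subset_closedBall hzz)).2

namespace SectorLim

variable {lo hi : ℝ} {f g : ℂ → ℂ} {c d : ℂ}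

theorem congr (hf : SectorLim lo hi f c) (h : ∀ᶠ x in openSector lo hi, g x = f x) :
    SectorLim lo hi g c :=
  SectorO.congr hf (h.mono fun x hx => by rw [hx])

theorem const (lo hi : ℝ) (c : ℂ) : SectorLim lo hi (fun _ => c) c := by
  simpa [SectorLim] using SectorO.zero lo hi (-2)

theorem of_sectorO (hf : SectorO lo hi (-2) f) : SectorLim lo hi f 0 := by
  simpa [SectorLim] using hf

theorem sectorO (hf : SectorLim lo hi f 0) : SectorO lo hi (-2) f := by
  simpa [SectorLim] using hf

theorem bounded (hf : SectorLim lo hi f c) : SectorO lo hi 0 f := by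
  refine ((SectorO.mono hf (by norm_num)).add (SectorO.const lo hi c)).congr ?_
  exact Eventually.of_forall fun x => by ring

theorem add (hf : SectorLim lo hi f c) (hg : SectorLim lo hi g d) :
    SectorLim lo hi (fun x => f x + g x) (c + d) :=
  (SectorO.add hf hg).congr (Eventually.of_forall fun x => by ring)

theorem neg (hf : SectorLim lo hi f c) : SectorLim lo hi (fun x => -f x) (-c) :=
  (SectorO.neg hf).congr (Eventually.of_forall fun x => by ring)

theorem sub (hf : SectorLim lo hi f c) (hg : SectorLim lo hi g d) :
    SectorLim lo hi (fun x => f x - g x) (c - d) :=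
  (SectorO.sub hf hg).congr (Eventually.of_forall fun x => by ring)

theorem mul (hf : SectorLim lo hi f c) (hg : SectorLim lo hi g d) :
    SectorLim lo hi (fun x => f x * g x) (c * d) := by
  have h1 : SectorO lo hi (-2) fun x => (f x - c) * g x := by
    simpa using SectorO.mul hf hg.bounded
  exact (h1.add (SectorO.const_mul hg c)).congr (Eventually.of_forall fun x => by ring)

theorem const_mul (hf : SectorLim lo hi f c) (k : ℂ) :
    SectorLim lo hi (fun x => k * f x) (k * c) := (const lo hi k).mul hf

theorem cast (hf : SectorLim lo hi f c) (h : d = c) : SectorLim lo hi f d := h ▸ hf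

theorem tendsto (hf : SectorLim lo hi f c) {δ : ℝ} (hδ : 0 < δ) :
    Tendsto f (closedSector (lo + δ) (hi - δ)) (𝓝 c) := by
  have h1 : Tendsto (fun x : ℂ => x ^ (-2 : ℤ)) (closedSector (lo + δ) (hi - δ)) (𝓝 0) := by
    have h0 : Tendsto (fun x : ℂ => ‖x‖) (closedSector (lo + δ) (hi - δ)) atTop :=
      tendsto_atTop.2 fun C => eventually_openSector.1 (eventually_norm_ge lo hi C) δ hδ
    rw [tendsto_zero_iff_norm_tendsto_zero]
    refine (tendsto_inv_atTop_zero.comp ((tendsto_pow_atTop (two_ne_zero)).comp h0)).congr ?_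
    intro x
    simp [zpow_neg]
  simpa using ((hf δ hδ).trans_tendsto h1).add_const c

theorem eventually_ne (hf : SectorLim lo hi f c) (hc : c ≠ 0) :
    ∀ᶠ x in openSector lo hi, f x ≠ 0 :=
  eventually_openSector.2 fun _ hδ => (hf.tendsto hδ).eventually_ne hc

theorem inv (hf : SectorLim lo hi f c) (hc : c ≠ 0) :
    SectorLim lo hi (fun x => (f x)⁻¹) c⁻¹ := by
  have h1 : SectorO lo hi 0 fun x => (f x)⁻¹ := fun δ hδ => by
    simpa using ((hf.tendsto hδ).inv₀ hc).isBigO_one ℂ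
  have h2 : SectorO lo hi (-2) fun x => (f x - c) * (f x)⁻¹ := by simpa using SectorO.mul hf h1
  refine (h2.const_mul (-c⁻¹)).congr ?_
  filter_upwards [hf.eventually_ne hc] with x hx
  field_simp
  ring

theorem div (hf : SectorLim lo hi f c) (hg : SectorLim lo hi g d) (hd : d ≠ 0) :
    SectorLim lo hi (fun x => f x / g x) (c / d) := by
  simpa only [div_eq_mul_inv] using hf.mul (hg.inv hd)

theorem subsector (hf : SectorLim lo hi f c) {lo' hi' : ℝ} (h1 : lo ≤ lo') (h2 : hi' ≤ hi) :
    SectorLim lo' hi' f c := SectorO.subsector hf h1 h2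

end SectorLim

/-! ### Algebraic asymptotics of solutions of the symmetric form -/

theorem SymSystem.reverse {ε a b c : ℂ} {p q r : ℂ → ℂ} (h : SymSystem ε a b c p q r) :
    SymSystem (-ε) c b a r q p := h.rotate.swap.rotate.rotate

theorem SymSystem.equations_of_analyticAt {ε a b c : ℂ} {p q r : ℂ → ℂ}
    (h : SymSystem ε a b c p q r) {x : ℂ}
    (hp : AnalyticAt ℂ p x) (hq : AnalyticAt ℂ q x) (hr : AnalyticAt ℂ r x) :
    deriv p x = ε * p x * (q x - r x) + a ∧ deriv r x = ε * r x * (p x - q x) + c ∧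
      q x = -2 * x - p x - r x := by
  have cp := hp.continuousAt
  have cq := hq.continuousAt
  have cr := hr.continuousAt
  have cdp := hp.deriv.continuousAt
  have cdr := hr.deriv.continuousAt
  refine ⟨?_, ?_, ?_⟩
  · refine eq_of_codiscrete_eq (f := deriv p) (g := fun x => ε * p x * (q x - r x) + a) ?_ cdp
      (by fun_prop)
    exact h.equations.mono fun z hz => hz.1.deriv
  · refine eq_of_codiscrete_eq (f := deriv r) (g := fun x => ε * r x * (p x - q x) + c) ?_ cdr
      (by fun_prop)
    exact h.equations.mono fun z hz => hz.2.2.1.deriv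
  · refine eq_of_codiscrete_eq (f := q) (g := fun x => -2 * x - p x - r x) ?_ cq (by fun_prop)
    exact h.equations.mono fun z hz => by linear_combination hz.2.2.2

/-- In the sector `lo < arg x < hi` the outer functions `p`, `r` of the triple are `O(1/x)`; for a
solution of the symmetric form this means that the middle one is `-2 x + O(1/x)`. -/
structure MiddleLarge (lo hi : ℝ) (p q r : ℂ → ℂ) : Prop where
  analytic : ∀ᶠ x in openSector lo hi, AnalyticAt ℂ p x ∧ AnalyticAt ℂ q x ∧ AnalyticAt ℂ r x
  bound₁ : SectorO lo hi (-1) p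
  bound₃ : SectorO lo hi (-1) r

namespace MiddleLarge

variable {lo hi : ℝ} {ε a b c : ℂ} {p q r : ℂ → ℂ}

theorem reverse (L : MiddleLarge lo hi p q r) : MiddleLarge lo hi r q p where
  analytic := L.analytic.mono fun _ h => ⟨h.2.2, h.2.1, h.1⟩
  bound₁ := L.bound₃
  bound₃ := L.bound₁

theorem equations (L : MiddleLarge lo hi p q r) (h : SymSystem ε a b c p q r) :
    ∀ᶠ x in openSector lo hi, x ≠ 0 ∧
      deriv p x = ε * p x * (q x - r x) + a ∧ deriv r x = ε * r x * (p x - q x) + c ∧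
      q x = -2 * x - p x - r x := by
  filter_upwards [L.analytic, eventually_ne_zero lo hi] with x hx h0
  exact ⟨h0, h.equations_of_analyticAt hx.1 hx.2.1 hx.2.2⟩

theorem deriv₁ (L : MiddleLarge lo hi p q r) : SectorO lo hi (-2) (deriv p) :=
  L.bound₁.deriv (L.analytic.mono fun _ h => h.1)

/-- The differential equation and Cauchy's estimate determine the leading term of `p`. -/
theorem lim₁ (L : MiddleLarge lo hi p q r) (h : SymSystem ε a b c p q r) :
    SectorLim lo hi (fun x => x * p x) (ε * a / 2) := by
  have h1 : SectorO lo hi (-2) fun x => p x * (p x + 2 * r x) := by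
    simpa using L.bound₁.mul (L.bound₁.add (L.bound₃.const_mul 2))
  have h2 := (L.deriv₁.add (h1.const_mul ε)).const_mul (-ε / 2)
  refine h2.congr ?_
  filter_upwards [L.equations h] with x ⟨_, e1, _, e3⟩
  rw [e1, e3]
  linear_combination (-(x * p x)) * h.sign

theorem lim₃ (L : MiddleLarge lo hi p q r) (h : SymSystem ε a b c p q r) :
    SectorLim lo hi (fun x => x * r x) (-(ε * c / 2)) :=
  (L.reverse.lim₁ h.reverse).cast (by ring)

theorem lim₂ (L : MiddleLarge lo hi p q r) (h : SymSystem ε a b c p q r) :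
    SectorLim lo hi (fun x => q x / x) (-2) := by
  have h1 := ((L.lim₁ h).bounded.add (L.lim₃ h).bounded).zpow_mul (-2)
  refine SectorO.congr (h1.neg.mono (by norm_num)) ?_
  filter_upwards [L.equations h] with x ⟨h0, _, _, e3⟩
  rw [e3, zpow_neg]
  field_simp
  ring

theorem inv₂ (L : MiddleLarge lo hi p q r) (h : SymSystem ε a b c p q r) :
    SectorO lo hi (-1) fun x => (q x)⁻¹ := by
  have h1 := (((L.lim₂ h).inv (by norm_num)).bounded).zpow_mul (-1)
  refine (h1.mono (by norm_num)).congr ?_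
  filter_upwards [eventually_ne_zero lo hi] with x h0
  rw [inv_div, zpow_neg_one]
  field_simp

theorem ne₂ (L : MiddleLarge lo hi p q r) (h : SymSystem ε a b c p q r) :
    ∀ᶠ x in openSector lo hi, q x ≠ 0 := by
  filter_upwards [(L.lim₂ h).eventually_ne (by norm_num)] with x h1 h2
  simp [h2] at h1

theorem ne₁ (L : MiddleLarge lo hi p q r) (h : SymSystem ε a b c p q r) (ha : a ≠ 0) :
    ∀ᶠ x in openSector lo hi, p x ≠ 0 := by
  have hε : ε ≠ 0 := fun h0 => by simpa [h0] using h.sign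
  filter_upwards [(L.lim₁ h).eventually_ne (by simp [hε, ha])] with x h1 h2
  simp [h2] at h1

theorem ne₃ (L : MiddleLarge lo hi p q r) (h : SymSystem ε a b c p q r) (hc : c ≠ 0) :
    ∀ᶠ x in openSector lo hi, r x ≠ 0 := L.reverse.ne₁ h.reverse hc

/-- The reflection in the large function does not change the type of a solution. -/
theorem reflect₂ (L : MiddleLarge lo hi p q r) (h : SymSystem ε a b c p q r) :
    MiddleLarge lo hi (fun x => p x - ε * b / q x) q (fun x => r x + ε * b / q x) where
  analytic := by
    filter_upwards [L.analytic, L.ne₂ h] with x ⟨h1, h2, h3⟩ h0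
    exact ⟨h1.sub (analyticAt_const.div h2 h0), h2, h3.add (analyticAt_const.div h2 h0)⟩
  bound₁ := (L.bound₁.sub ((L.inv₂ h).const_mul (ε * b))).congr
    (Eventually.of_forall fun x => by rw [div_eq_mul_inv])
  bound₃ := (L.bound₃.add ((L.inv₂ h).const_mul (ε * b))).congr
    (Eventually.of_forall fun x => by rw [div_eq_mul_inv])

/-- After the reflection in the function preceding the large one, the function following the large
one becomes large. -/
theorem reflect₁ (L : MiddleLarge lo hi p q r) (h : SymSystem ε a b c p q r) (ha : a ≠ 0) :
    MiddleLarge lo hi (fun x => q x + ε * a / p x) (fun x => r x - ε * a / p x) p where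
  analytic := by
    filter_upwards [L.analytic, L.ne₁ h ha] with x ⟨h1, h2, h3⟩ h0
    exact ⟨h2.add (analyticAt_const.div h1 h0), h3.sub (analyticAt_const.div h1 h0), h1⟩
  bound₁ := by
    have hε : ε ≠ 0 := fun h0 => by simpa [h0] using h.sign
    have h1 := ((L.lim₁ h).inv (by simp [hε, ha])).bounded.mul ((L.deriv₁).zpow_mul 1)
    -- the two large terms of `q + ε a / p` cancel because the sum is `ε p' / p + r`
    refine ((h1.const_mul ε).add (L.bound₃)).congr ?_
    filter_upwards [L.equations h, L.ne₁ h ha] with x ⟨h0, e1, _, e3⟩ hp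
    rw [e1, mul_inv, zpow_one]
    field_simp
    linear_combination (-(p x * (q x - r x))) * h.sign
  bound₃ := L.bound₁

theorem reflect₃ (L : MiddleLarge lo hi p q r) (h : SymSystem ε a b c p q r) (hc : c ≠ 0) :
    MiddleLarge lo hi r (fun x => p x + ε * c / r x) (fun x => q x - ε * c / r x) := by
  have h1 := (L.reverse.reflect₁ h.reverse hc).reverse
  have e1 : (fun x => p x - -ε * c / r x) = fun x => p x + ε * c / r x := by ext x; ring
  have e2 : (fun x => q x + -ε * c / r x) = fun x => q x - ε * c / r x := by ext x; ring
  rwa [e1, e2] at h1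

end MiddleLarge

/-! ### Exponentially separated pairs of solutions -/

/-- The function `x ^ k exp(-ε x ^ 2)`. -/
noncomputable def expScale (ε : ℂ) (k : ℤ) (x : ℂ) : ℂ := x ^ k * Complex.exp (-ε * x ^ 2)

theorem expScale_ne_zero {ε : ℂ} {k : ℤ} {x : ℂ} (hx : x ≠ 0) : expScale ε k x ≠ 0 :=
  mul_ne_zero (zpow_ne_zero _ hx) (Complex.exp_ne_zero _)

theorem hasDerivAt_expScale {ε : ℂ} {k : ℤ} {x : ℂ} (hx : x ≠ 0) :
    HasDerivAt (expScale ε k) (expScale ε k x * (k / x - 2 * ε * x)) x := by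
  have h1 := hasDerivAt_zpow k x (Or.inl hx)
  have h2 : HasDerivAt (fun x : ℂ => -ε * x ^ 2) (-ε * (2 * x)) x := by
    simpa using (hasDerivAt_pow 2 x).const_mul (-ε)
  refine (h1.fun_mul h2.cexp).congr_deriv ?_
  rw [expScale, zpow_sub_one₀ hx]
  field_simp
  ring

/-- Two solutions of the symmetric form with the same parameters, both with a large middle
function, whose first functions differ by `x ^ k exp(-ε x ^ 2) (μ + O(x ^ (-2)))` and whose last
functions differ by no more than that order. -/
structure ExpPair (lo hi : ℝ) (ε a b c μ : ℂ) (k : ℤ) (p q r P Q R : ℂ → ℂ) : Prop where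
  sys : SymSystem ε a b c p q r
  sys' : SymSystem ε a b c P Q R
  large : MiddleLarge lo hi p q r
  large' : MiddleLarge lo hi P Q R
  diff₁ : SectorLim lo hi (fun x => (p x - P x) / expScale ε k x) μ
  diff₃ : SectorO lo hi 0 (fun x => (r x - R x) / expScale ε k x)

namespace ExpPair

variable {lo hi : ℝ} {ε a b c μ : ℂ} {k : ℤ} {p q r P Q R : ℂ → ℂ}

/-- The differential equation of `r - R`, solved for the term without derivative. -/
theorem diff₃_aux (h : ExpPair lo hi ε a b c μ k p q r P Q R) :
    ∀ᶠ x in openSector lo hi, x ^ 2 * ((r x - R x) / expScale ε k x) =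
      ε / 4 * (x * deriv (fun x => (r x - R x) / expScale ε k x) x
        - ε * ((r x - R x) / expScale ε k x * (x * r x + x * R x + 2 * (x * p x)))
        - 2 * ε * ((x * R x) * ((p x - P x) / expScale ε k x))
        + k * ((r x - R x) / expScale ε k x)) := by
  filter_upwards [h.large.equations h.sys, h.large'.equations h.sys', h.large.analytic,
    h.large'.analytic] with x ⟨h0, _, e2, e3⟩ ⟨_, _, e2', e3'⟩ ⟨_, _, hr⟩ ⟨_, _, hR⟩
  have hE := expScale_ne_zero (ε := ε) (k := k) h0
  have hd := ((hr.differentiableAt.hasDerivAt.fun_sub hR.differentiableAt.hasDerivAt).fun_div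
    (hasDerivAt_expScale (ε := ε) (k := k) h0) hE).deriv
  rw [hd, e2, e2', e3, e3']
  field_simp
  linear_combination (-4 * x ^ 2 * (r x - R x)) * h.sys.sign

/-- The linearized equation determines the leading term of the difference of the last
functions. -/
theorem diff₃_lim (h : ExpPair lo hi ε a b c μ k p q r P Q R) :
    SectorLim lo hi (fun x => x ^ 2 * ((r x - R x) / expScale ε k x)) (ε * c * μ / 4) := by
  have han : ∀ᶠ x in openSector lo hi,
      AnalyticAt ℂ (fun x => (r x - R x) / expScale ε k x) x := by
    filter_upwards [h.large.analytic, h.large'.analytic, eventually_ne_zero lo hi]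
      with x ⟨_, _, hr⟩ ⟨_, _, hR⟩ h0
    refine (hr.sub hR).div ?_ (expScale_ne_zero h0)
    exact ((analyticAt_id.zpow h0).mul (by fun_prop))
  have hb : SectorO lo hi 0 fun x => x * r x + x * R x + 2 * (x * p x) :=
    ((h.large.lim₃ h.sys).bounded.add (h.large'.lim₃ h.sys').bounded).add
      ((h.large.lim₁ h.sys).bounded.const_mul 2)
  have hc := (h.large'.lim₃ h.sys').mul h.diff₁
  -- each use of the linearized equation improves the bound on the difference by `x ^ (-2)`
  have step : ∀ n : ℤ, SectorO lo hi n (fun x => (r x - R x) / expScale ε k x) →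
      SectorO lo hi n fun x => x ^ 2 * ((r x - R x) / expScale ε k x)
        - ε / 4 * (-(2 * ε * ((x * R x) * ((p x - P x) / expScale ε k x)))) := by
    intro n hn
    have h1 : SectorO lo hi n
        fun x => x * deriv (fun x => (r x - R x) / expScale ε k x) x := by
      simpa using (hn.deriv han).zpow_mul 1
    have h2 : SectorO lo hi n fun x => (r x - R x) / expScale ε k x *
        (x * r x + x * R x + 2 * (x * p x)) := by simpa using hn.mul hb
    refine ((((h1.sub (h2.const_mul ε)).add (hn.const_mul k))).const_mul (ε / 4)).congr ?_
    filter_upwards [h.diff₃_aux] with x hx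
    rw [hx]
    ring
  have hlim := ((hc.const_mul (2 * ε)).neg).const_mul (ε / 4)
  have h1 : SectorO lo hi 0 fun x => x ^ 2 * ((r x - R x) / expScale ε k x) :=
    ((step 0 h.diff₃).add hlim.bounded).congr (Eventually.of_forall fun x => by ring)
  have h2 : SectorO lo hi (-2) fun x => (r x - R x) / expScale ε k x := by
    refine (h1.zpow_mul (-2)).congr ?_
    filter_upwards [eventually_ne_zero lo hi] with x h0
    rw [zpow_neg]
    field_simp
  have h3 := (SectorLim.of_sectorO (step (-2) h2)).add hlim
  refine (h3.cast ?_).congr (Eventually.of_forall fun x => by ring)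
  linear_combination (-(ε * c * μ / 4)) * h.sys.sign

theorem diff₃_small (h : ExpPair lo hi ε a b c μ k p q r P Q R) :
    SectorLim lo hi (fun x => (r x - R x) / expScale ε k x) 0 := by
  have h1 := h.diff₃_lim.bounded.zpow_mul (-2)
  refine .of_sectorO ((h1.mono (by norm_num)).congr ?_)
  filter_upwards [eventually_ne_zero lo hi] with x h0
  rw [zpow_neg]
  field_simp

theorem diff₂_lim (h : ExpPair lo hi ε a b c μ k p q r P Q R) :
    SectorLim lo hi (fun x => (q x - Q x) / expScale ε k x) (-μ) := by
  refine ((h.diff₁.add h.diff₃_small).neg.cast (by ring)).congr ?_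
  filter_upwards [h.large.equations h.sys, h.large'.equations h.sys']
    with x ⟨_, _, _, e3⟩ ⟨_, _, _, e3'⟩
  rw [e3, e3']
  ring

/-- The reflection in the large function keeps the amplitude of the pair. -/
theorem reflect₂ (h : ExpPair lo hi ε a b c μ k p q r P Q R) (hb : b ≠ 0) :
    ExpPair lo hi ε (a + b) (-b) (c + b) μ k
      (fun x => p x - ε * b / q x) q (fun x => r x + ε * b / q x)
      (fun x => P x - ε * b / Q x) Q (fun x => R x + ε * b / Q x) := by
  have h1 : SectorO lo hi (-2) fun x =>
      (q x - Q x) / expScale ε k x * ((q x)⁻¹ * (Q x)⁻¹) := by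
    simpa using h.diff₂_lim.bounded.mul ((h.large.inv₂ h.sys).mul (h.large'.inv₂ h.sys'))
  refine ⟨h.sys.reflect hb, h.sys'.reflect hb, h.large.reflect₂ h.sys, h.large'.reflect₂ h.sys',
    ?_, ?_⟩
  · refine ((h.diff₁.add (.of_sectorO (h1.const_mul (ε * b)))).cast (by ring)).congr ?_
    filter_upwards [h.large.ne₂ h.sys, h.large'.ne₂ h.sys', eventually_ne_zero lo hi]
      with x h2 h3 h0
    have hE := expScale_ne_zero (ε := ε) (k := k) h0
    field_simp
    ring
  · refine (h.diff₃.sub ((h1.mono (by norm_num)).const_mul (ε * b))).congr ?_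
    filter_upwards [h.large.ne₂ h.sys, h.large'.ne₂ h.sys', eventually_ne_zero lo hi]
      with x h2 h3 h0
    have hE := expScale_ne_zero (ε := ε) (k := k) h0
    field_simp
    ring

theorem expScale_add_two {x : ℂ} (hx : x ≠ 0) :
    expScale ε (k + 2) x = x ^ 2 * expScale ε k x := by
  rw [expScale, expScale, zpow_add₀ hx]
  norm_cast
  ring

theorem expScale_sub_two {x : ℂ} (hx : x ≠ 0) :
    expScale ε (k - 2) x = expScale ε k x / x ^ 2 := by
  rw [expScale, expScale, zpow_sub₀ hx]
  norm_cast
  ring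

/-- In `q - Q + ε a (1 / p - 1 / P)` the second term dominates, as `p P ~ (ε a / (2 x)) ^ 2`. -/
theorem reflect₁ (h : ExpPair lo hi ε a b c μ k p q r P Q R) (ha : a ≠ 0) :
    ExpPair lo hi ε (b + a) (c + a) (-a) (-4 * ε * μ / a) (k + 2)
      (fun x => q x + ε * a / p x) (fun x => r x - ε * a / p x) p
      (fun x => Q x + ε * a / P x) (fun x => R x - ε * a / P x) P := by
  have hε : ε ≠ 0 := fun h0 => by simpa [h0] using h.sys.sign
  have hne : ε * a / 2 ≠ 0 := by simp [hε, ha]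
  refine ⟨(h.sys.rotate.rotate.reflect ha).rotate.rotate.cast rfl rfl rfl (fun _ => rfl)
      (fun _ => rfl) (fun _ => rfl),
    (h.sys'.rotate.rotate.reflect ha).rotate.rotate.cast rfl rfl rfl (fun _ => rfl)
      (fun _ => rfl) (fun _ => rfl),
    h.large.reflect₁ h.sys ha, h.large'.reflect₁ h.sys' ha, ?_, ?_⟩
  · have h1 : SectorLim lo hi (fun x => x ^ (-2 : ℤ) * ((q x - Q x) / expScale ε k x)) 0 :=
      .of_sectorO (by simpa using h.diff₂_lim.bounded.zpow_mul (-2))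
    have h2 := (h.diff₁.div ((h.large.lim₁ h.sys).mul (h.large'.lim₁ h.sys'))
      (mul_ne_zero hne hne)).const_mul (-(ε * a))
    refine ((h1.add h2).cast ?_).congr ?_
    · field_simp
      ring_nf
      linear_combination (-(4 * μ)) * h.sys.sign
    · filter_upwards [h.large.ne₁ h.sys ha, h.large'.ne₁ h.sys' ha, eventually_ne_zero lo hi]
        with x h2 h3 h0
      have hE := expScale_ne_zero (ε := ε) (k := k) h0
      rw [expScale_add_two h0, zpow_neg]
      field_simp
      ring
  · refine ((h.diff₁.bounded.zpow_mul (-2)).mono (by norm_num)).congr ?_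
    filter_upwards [eventually_ne_zero lo hi] with x h0
    have hE := expScale_ne_zero (ε := ε) (k := k) h0
    rw [expScale_add_two h0, zpow_neg]
    field_simp

/-- The first function of the new pair is `r`, whose difference is smaller than that of `p` by the
factor `x ^ (-2)`. -/
theorem reflect₃ (h : ExpPair lo hi ε a b c μ k p q r P Q R) (hc : c ≠ 0) :
    ExpPair lo hi ε (-c) (a + c) (b + c) (ε * c * μ / 4) (k - 2)
      r (fun x => p x + ε * c / r x) (fun x => q x - ε * c / r x)
      R (fun x => P x + ε * c / R x) (fun x => Q x - ε * c / R x) := by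
  have hε : ε ≠ 0 := fun h0 => by simpa [h0] using h.sys.sign
  have hne : -(ε * c / 2) ≠ 0 := by simp [hε, hc]
  refine ⟨(h.sys.rotate.reflect hc).rotate.cast rfl rfl rfl (fun _ => rfl)
      (fun _ => rfl) (fun _ => rfl),
    (h.sys'.rotate.reflect hc).rotate.cast rfl rfl rfl (fun _ => rfl)
      (fun _ => rfl) (fun _ => rfl),
    h.large.reflect₃ h.sys hc, h.large'.reflect₃ h.sys' hc, ?_, ?_⟩
  · refine h.diff₃_lim.congr ?_
    filter_upwards [eventually_ne_zero lo hi] with x h0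
    have hE := expScale_ne_zero (ε := ε) (k := k) h0
    rw [expScale_sub_two h0]
    field_simp
  · have h2 := (h.diff₃_lim.div ((h.large.lim₃ h.sys).mul (h.large'.lim₃ h.sys'))
      (mul_ne_zero hne hne)).const_mul (ε * c)
    -- the leading terms cancel, so that the difference is of the new, smaller order
    have h3 := (h.diff₂_lim.add h2).cast (d := 0) (by field_simp; ring)
    refine (h3.sectorO.zpow_mul 2).congr ?_
    filter_upwards [h.large.ne₃ h.sys hc, h.large'.ne₃ h.sys' hc, eventually_ne_zero lo hi]
      with x h2 h3 h0
    have hE := expScale_ne_zero (ε := ε) (k := k) h0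
    rw [expScale_sub_two h0]
    field_simp
    ring

theorem cast (h : ExpPair lo hi ε a b c μ k p q r P Q R) {a' b' c' μ' : ℂ} {k' : ℤ}
    {p' q' r' P' Q' R' : ℂ → ℂ} (ha : a' = a) (hb : b' = b) (hc : c' = c) (hμ : μ' = μ)
    (hk : k' = k) (h1 : ∀ x, p' x = p x) (h2 : ∀ x, q' x = q x) (h3 : ∀ x, r' x = r x)
    (h4 : ∀ x, P' x = P x) (h5 : ∀ x, Q' x = Q x) (h6 : ∀ x, R' x = R x) :
    ExpPair lo hi ε a' b' c' μ' k' p' q' r' P' Q' R' := by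
  obtain rfl := funext h1
  obtain rfl := funext h2
  obtain rfl := funext h3
  obtain rfl := funext h4
  obtain rfl := funext h5
  obtain rfl := funext h6
  subst ha hb hc hμ hk
  exact h

end ExpPair

/-! ### Exponentially separated pairs along the translations -/

namespace Triple

/-- `s.v` and `t.v` are large and `s.u - t.u ≈ μ x ^ k exp(-x ^ 2)`. -/
def PairVPos (lo hi : ℝ) (n m : ℕ) (μ : ℂ) (k : ℤ) (s t : Triple) : Prop :=
  ExpPair lo hi 1 (2 * m) (-2 - 2 * m - 2 * n) (2 * n) μ k s.u s.v s.w t.u t.v t.w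

/-- `s.u` and `t.u` are large and `s.v - t.v ≈ μ x ^ k exp(x ^ 2)`. -/
def PairUNeg (lo hi : ℝ) (n m : ℕ) (μ : ℂ) (k : ℤ) (s t : Triple) : Prop :=
  ExpPair lo hi (-1) (-2 - 2 * m - 2 * n) (2 * m) (2 * n) μ k s.v s.u s.w t.v t.u t.w

/-- `s.w` and `t.w` are large and `s.v - t.v ≈ μ x ^ k exp(-x ^ 2)`. -/
def PairWPos (lo hi : ℝ) (n m : ℕ) (μ : ℂ) (k : ℤ) (s t : Triple) : Prop :=
  ExpPair lo hi 1 (-2 - 2 * m - 2 * n) (2 * n) (2 * m) μ k s.v s.w s.u t.v t.w t.u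

/-- `s.v` and `t.v` are large and `s.w - t.w ≈ μ x ^ k exp(x ^ 2)`. -/
def PairVNeg (lo hi : ℝ) (n m : ℕ) (μ : ℂ) (k : ℤ) (s t : Triple) : Prop :=
  ExpPair lo hi (-1) (2 * n) (-2 - 2 * m - 2 * n) (2 * m) μ k s.w s.v s.u t.w t.v t.u

variable {lo hi : ℝ} {n m : ℕ} {μ : ℂ} {k : ℤ} {s t : Triple}

theorem neg_two_sub_ne (n m : ℕ) : (-2 - 2 * m - 2 * n : ℂ) ≠ 0 := by
  have := two_add_add_ne n m
  contrapose! this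
  linear_combination -this

theorem one_add_ne (k : ℕ) : (1 + k : ℂ) ≠ 0 := by
  have := two_add_ne k
  contrapose! this
  linear_combination 2 * this

theorem one_add_add_ne (n m : ℕ) : (1 + m + n : ℂ) ≠ 0 := by
  have := two_add_add_ne n m
  contrapose! this
  linear_combination 2 * this

theorem left_param_ne (n m : ℕ) : (2 * m + (-2 - 2 * m - 2 * n) : ℂ) ≠ 0 := by
  have := two_add_ne n
  contrapose! this
  linear_combination -this

theorem right_param_ne (n m : ℕ) : (2 * n + (-2 - 2 * m - 2 * n) : ℂ) ≠ 0 := by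
  have := two_add_ne m
  contrapose! this
  linear_combination -this

theorem PairVPos.shiftLeft (h : PairVPos lo hi n 0 μ k s t) :
    PairVPos lo hi (n + 1) 0 (2 / (1 + n) * μ) (k + 2) (s.shiftLeft n) (t.shiftLeft n) := by
  have := one_add_ne n
  refine ((h.reflect₂ (neg_two_sub_ne n 0)).reflect₁ (left_param_ne n 0)).cast ?_ ?_ ?_ ?_ rfl
    (fun x => ?_) (fun x => ?_) (fun x => ?_) (fun x => ?_) (fun x => ?_) (fun x => ?_)
  · push_cast; ring
  · push_cast; ring
  · push_cast; ring
  · rw [div_mul_eq_mul_div, div_eq_div_iff this (left_param_ne n 0)]; push_cast; ring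
  all_goals simp only [Triple.shiftLeft]; push_cast; ring

theorem PairVPos.shiftRight (h : PairVPos lo hi n m μ k s t) :
    PairVPos lo hi n (m + 1) (-((1 + m) / 2) * μ) (k - 2) (s.shiftRight n m)
      (t.shiftRight n m) := by
  refine ((h.reflect₂ (neg_two_sub_ne n m)).reflect₃ (right_param_ne n m)).cast ?_ ?_ ?_ ?_ rfl
    (fun x => ?_) (fun x => ?_) (fun x => ?_) (fun x => ?_) (fun x => ?_) (fun x => ?_)
  · push_cast; ring
  · push_cast; ring
  · ring
  · ring
  all_goals simp only [Triple.shiftRight]; ring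

theorem PairUNeg.shiftLeft (h : PairUNeg lo hi n 0 μ k s t) :
    PairUNeg lo hi (n + 1) 0 (2 / (1 + n) * (2 / (1 + n)) * μ) (k + 4)
      (s.shiftLeft n) (t.shiftLeft n) := by
  have := one_add_ne n
  refine ((h.reflect₁ (neg_two_sub_ne n 0)).reflect₁ (left_param_ne n 0)).cast ?_ ?_ ?_ ?_
    (by ring)
    (fun x => ?_) (fun x => ?_) (fun x => ?_) (fun x => ?_) (fun x => ?_) (fun x => ?_)
  · push_cast; ring
  · push_cast; ring
  · push_cast; ring
  · rw [show (2 * (0 : ℕ) + (-2 - 2 * (0 : ℕ) - 2 * n) : ℂ) = -2 * (1 + n) by push_cast; ring,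
      show (-2 - 2 * (0 : ℕ) - 2 * n : ℂ) = -2 * (1 + n) by push_cast; ring]
    field_simp
    ring
  all_goals simp only [Triple.shiftLeft]; push_cast; ring

theorem PairUNeg.shiftRight (h : PairUNeg lo hi n m μ k s t) :
    PairUNeg lo hi n (m + 1) (-(2 / (1 + m + n)) * μ) (k + 2) (s.shiftRight n m)
      (t.shiftRight n m) := by
  have := one_add_add_ne n m
  refine ((h.reflect₁ (neg_two_sub_ne n m)).reflect₂ (right_param_ne n m)).cast ?_ ?_ ?_ ?_ rfl
    (fun x => ?_) (fun x => ?_) (fun x => ?_) (fun x => ?_) (fun x => ?_) (fun x => ?_)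
  · push_cast; ring
  · push_cast; ring
  · ring
  · rw [show (-2 - 2 * m - 2 * n : ℂ) = -2 * (1 + m + n) by ring]
    field_simp
    ring
  all_goals simp only [Triple.shiftRight]; ring

theorem PairWPos.shiftLeft (h : PairWPos lo hi n 0 μ k s t) :
    PairWPos lo hi (n + 1) 0 (2 / (1 + n) * μ) (k + 2) (s.shiftLeft n) (t.shiftLeft n) := by
  have := one_add_ne n
  have h1 : (2 * (0 : ℕ) + (-2 - 2 * (0 : ℕ) - 2 * n) : ℂ) ≠ 0 := left_param_ne n 0
  refine ((h.reflect₁ (neg_two_sub_ne n 0)).reflect₂ h1).cast ?_ ?_ ?_ ?_ rfl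
    (fun x => ?_) (fun x => ?_) (fun x => ?_) (fun x => ?_) (fun x => ?_) (fun x => ?_)
  · push_cast; ring
  · push_cast; ring
  · push_cast; ring
  · rw [show (-2 - 2 * (0 : ℕ) - 2 * n : ℂ) = -2 * (1 + n) by push_cast; ring]
    field_simp
    ring
  all_goals simp only [Triple.shiftLeft]; push_cast; ring

theorem PairWPos.shiftRight (h : PairWPos lo hi n m μ k s t) :
    PairWPos lo hi n (m + 1) (2 / (1 + m) * (2 / (1 + m + n)) * μ) (k + 4) (s.shiftRight n m)
      (t.shiftRight n m) := by
  have := one_add_add_ne n m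
  have := one_add_ne m
  refine ((h.reflect₁ (neg_two_sub_ne n m)).reflect₁ (right_param_ne n m)).cast ?_ ?_ ?_ ?_
    (by ring)
    (fun x => ?_) (fun x => ?_) (fun x => ?_) (fun x => ?_) (fun x => ?_) (fun x => ?_)
  · push_cast; ring
  · ring
  · push_cast; ring
  · rw [show (2 * n + (-2 - 2 * m - 2 * n) : ℂ) = -2 * (1 + m) by ring,
      show (-2 - 2 * m - 2 * n : ℂ) = -2 * (1 + m + n) by ring]
    field_simp
    ring
  all_goals simp only [Triple.shiftRight]; ring

theorem PairVNeg.shiftLeft (h : PairVNeg lo hi n 0 μ k s t) :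
    PairVNeg lo hi (n + 1) 0 ((1 + n) / 2 * μ) (k - 2) (s.shiftLeft n) (t.shiftLeft n) := by
  refine ((h.reflect₂ (neg_two_sub_ne n 0)).reflect₃ (left_param_ne n 0)).cast ?_ ?_ ?_ ?_ rfl
    (fun x => ?_) (fun x => ?_) (fun x => ?_) (fun x => ?_) (fun x => ?_) (fun x => ?_)
  · push_cast; ring
  · push_cast; ring
  · push_cast; ring
  · push_cast; ring
  all_goals simp only [Triple.shiftLeft]; push_cast; ring

theorem PairVNeg.shiftRight (h : PairVNeg lo hi n m μ k s t) :
    PairVNeg lo hi n (m + 1) (-(2 / (1 + m)) * μ) (k + 2) (s.shiftRight n m)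
      (t.shiftRight n m) := by
  have := one_add_ne m
  refine ((h.reflect₂ (neg_two_sub_ne n m)).reflect₁ (right_param_ne n m)).cast ?_ ?_ ?_ ?_ rfl
    (fun x => ?_) (fun x => ?_) (fun x => ?_) (fun x => ?_) (fun x => ?_) (fun x => ?_)
  · ring
  · push_cast; ring
  · push_cast; ring
  · rw [show (2 * n + (-2 - 2 * m - 2 * n) : ℂ) = -2 * (1 + m) by ring]
    field_simp
    ring
  all_goals simp only [Triple.shiftRight]; ring

theorem PairVPos.orbit (h : PairVPos lo hi 0 0 μ k s t) (n m : ℕ) :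
    PairVPos lo hi n m ((-1) ^ m * (2 ^ n / 2 ^ m) * (m.factorial / n.factorial) * μ)
      (k + 2 * n - 2 * m) (s.orbit n m) (t.orbit n m) := by
  induction m with
  | zero =>
    induction n with
    | zero => simpa [orbit_zero_zero] using h
    | succ n ih =>
      rw [orbit_succ_zero, orbit_succ_zero]
      convert ih.shiftLeft using 1
      · have := one_add_ne n
        have := Nat.cast_ne_zero (R := ℂ).2 n.factorial_ne_zero
        rw [Nat.factorial_succ, add_comm n 1]
        push_cast
        field_simp
        ring
      · push_cast; ring
  | succ m ih =>
    rw [orbit_succ, orbit_succ]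
    convert ih.shiftRight using 1
    · have := Nat.cast_ne_zero (R := ℂ).2 n.factorial_ne_zero
      rw [Nat.factorial_succ]
      push_cast
      field_simp
      ring
    · push_cast; ring

theorem PairUNeg.orbit (h : PairUNeg lo hi 0 0 μ k s t) (n m : ℕ) :
    PairUNeg lo hi n m
      ((-1) ^ m * 2 ^ (2 * n + m) / (n.factorial * (n + m).factorial) * μ)
      (k + 4 * n + 2 * m) (s.orbit n m) (t.orbit n m) := by
  induction m with
  | zero =>
    induction n with
    | zero => simpa [orbit_zero_zero] using h
    | succ n ih =>
      rw [orbit_succ_zero, orbit_succ_zero]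
      convert ih.shiftLeft using 1
      · have := one_add_ne n
        have := Nat.cast_ne_zero (R := ℂ).2 n.factorial_ne_zero
        simp only [add_zero]
        rw [Nat.factorial_succ, add_comm n 1]
        push_cast
        field_simp
        ring
      · push_cast; ring
  | succ m ih =>
    rw [orbit_succ, orbit_succ]
    convert ih.shiftRight using 1
    · have := one_add_add_ne n m
      have := Nat.cast_ne_zero (R := ℂ).2 n.factorial_ne_zero
      have := Nat.cast_ne_zero (R := ℂ).2 (n + m).factorial_ne_zero
      rw [← add_assoc n, Nat.factorial_succ,
        show ((n + m + 1) * (n + m).factorial : ℕ) = (1 + m + n : ℂ) * (n + m).factorial by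
          push_cast; ring]
      field_simp
      ring
    · push_cast; ring

theorem PairWPos.orbit (h : PairWPos lo hi 0 0 μ k s t) (n m : ℕ) :
    PairWPos lo hi n m (2 ^ (n + 2 * m) / (m.factorial * (n + m).factorial) * μ)
      (k + 2 * n + 4 * m) (s.orbit n m) (t.orbit n m) := by
  induction m with
  | zero =>
    induction n with
    | zero => simpa [orbit_zero_zero] using h
    | succ n ih =>
      rw [orbit_succ_zero, orbit_succ_zero]
      convert ih.shiftLeft using 1
      · have := one_add_ne n
        have := Nat.cast_ne_zero (R := ℂ).2 n.factorial_ne_zero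
        simp only [add_zero, mul_zero]
        rw [Nat.factorial_succ, add_comm n 1]
        push_cast
        field_simp
        ring
      · push_cast; ring
  | succ m ih =>
    rw [orbit_succ, orbit_succ]
    convert ih.shiftRight using 1
    · have := one_add_add_ne n m
      have := one_add_ne m
      have := Nat.cast_ne_zero (R := ℂ).2 m.factorial_ne_zero
      have := Nat.cast_ne_zero (R := ℂ).2 (n + m).factorial_ne_zero
      rw [← add_assoc n, Nat.factorial_succ (n + m), Nat.factorial_succ m,
        show ((n + m + 1) * (n + m).factorial : ℕ) = (1 + m + n : ℂ) * (n + m).factorial by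
          push_cast; ring,
        show ((m + 1) * m.factorial : ℕ) = (1 + m : ℂ) * m.factorial by push_cast; ring]
      field_simp
      ring
    · push_cast; ring

theorem PairVNeg.orbit (h : PairVNeg lo hi 0 0 μ k s t) (n m : ℕ) :
    PairVNeg lo hi n m ((-1) ^ m * (2 ^ m / 2 ^ n) * (n.factorial / m.factorial) * μ)
      (k + 2 * m - 2 * n) (s.orbit n m) (t.orbit n m) := by
  induction m with
  | zero =>
    induction n with
    | zero => simpa [orbit_zero_zero] using h
    | succ n ih =>
      rw [orbit_succ_zero, orbit_succ_zero]
      convert ih.shiftLeft using 1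
      · rw [Nat.factorial_succ]
        push_cast
        field_simp
        ring
      · push_cast; ring
  | succ m ih =>
    rw [orbit_succ, orbit_succ]
    convert ih.shiftRight using 1
    · have := one_add_ne m
      have := Nat.cast_ne_zero (R := ℂ).2 m.factorial_ne_zero
      rw [Nat.factorial_succ m,
        show ((m + 1) * m.factorial : ℕ) = (1 + m : ℂ) * m.factorial by push_cast; ring]
      field_simp
      ring
    · push_cast; ring

end Triple

/-! ### The complementary error integral -/

open MeasureTheory Set in
/-- The integral of `exp(-t ^ 2)` along the ray from `x` in the direction `ω`. -/
noncomputable def rayIntegral (ω x : ℂ) : ℂ :=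
  ∫ s : ℝ in Ioi 0, ω * Complex.exp (-(x + ω * s) ^ 2)

/-- The complementary error integral `∫ exp(-t ^ 2) dt` from `x` to `+∞`. -/
noncomputable def errIntegral (x : ℂ) : ℂ := rayIntegral 1 x

section

open MeasureTheory Set

variable {ω : ℂ}

theorem norm_exp_sub_one_le_of_re_nonpos {z : ℂ} (hz : z.re ≤ 0) :
    ‖Complex.exp z - 1‖ ≤ ‖z‖ := by
  have h := (convex_halfSpace_re_le 0).norm_image_sub_le_of_norm_hasDerivWithin_le
    (f := Complex.exp) (f' := Complex.exp) (C := 1) (x := 0) (y := z)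
    (fun w _ => (Complex.hasDerivAt_exp w).hasDerivWithinAt)
    (fun w hw => by
      rw [Complex.norm_exp]
      exact Real.exp_le_one_iff.2 hw) (by simp) hz
  simpa using h

theorem integrable_ray (hω : 0 < (ω ^ 2).re) (x : ℂ) :
    Integrable fun s : ℝ => ω * Complex.exp (-(x + ω * s) ^ 2) := by
  have h := (integrable_cexp_quadratic hω (-2 * x * ω) (-x ^ 2)).const_mul ω
  refine h.congr (Eventually.of_forall fun s => ?_)
  simp only
  congr 2
  ring

/-- A linear factor does not affect the integrability of a Gaussian, since `s + 1 ≤ exp s`. -/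
theorem norm_ray_deriv_le {x x₀ : ℂ} (hx : x ∈ Metric.ball x₀ 1) {s : ℝ} (hs : 0 < s) :
    ‖ω * (Complex.exp (-(x + ω * s) ^ 2) * (-(2 * (x + ω * s))))‖ ≤
      2 * ‖ω‖ * (‖x₀‖ + 1 + ‖ω‖) * ‖Complex.exp (-(ω ^ 2) * s ^ 2 +
        (2 * (‖x₀‖ + 1) * ‖ω‖ + 1 : ℝ) * s + ((‖x₀‖ + 1) ^ 2 : ℝ))‖ := by
  have hx1 : ‖x‖ ≤ ‖x₀‖ + 1 := by
    have h1 := norm_le_norm_add_norm_sub' x x₀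
    have h2 : ‖x - x₀‖ < 1 := by simpa [dist_eq_norm] using hx
    linarith
  rw [norm_mul, norm_mul, Complex.norm_exp, Complex.norm_exp]
  have e1 : ‖-(2 * (x + ω * s))‖ ≤ 2 * (‖x₀‖ + 1 + ‖ω‖) * Real.exp s := by
    rw [norm_neg, norm_mul, Complex.norm_two]
    have h1 : ‖x + ω * s‖ ≤ ‖x₀‖ + 1 + ‖ω‖ * s := by
      refine (norm_add_le _ _).trans ?_
      rw [norm_mul, Complex.norm_real, Real.norm_of_nonneg hs.le]
      linarith
    have h2 := Real.add_one_le_exp s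
    have h3 := norm_nonneg x₀
    have h4 := norm_nonneg ω
    nlinarith
  have e2 : (-(x + ω * s) ^ 2).re ≤ (-(ω ^ 2) * s ^ 2 +
      (2 * (‖x₀‖ + 1) * ‖ω‖ : ℝ) * s + ((‖x₀‖ + 1) ^ 2 : ℝ)).re := by
    have h1 : -(x + ω * s) ^ 2 = -(ω ^ 2) * s ^ 2 + (-(2 * x * ω)) * s + (-x ^ 2) := by ring
    rw [h1]
    simp only [Complex.add_re]
    have h2 : (-(2 * x * ω) * (s : ℂ)).re ≤ ((2 * (‖x₀‖ + 1) * ‖ω‖ : ℝ) * (s : ℂ)).re := by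
      refine (Complex.re_le_norm _).trans ?_
      rw [norm_mul, norm_neg, norm_mul, norm_mul, Complex.norm_two, Complex.norm_real,
        Real.norm_of_nonneg hs.le, ← Complex.ofReal_mul, Complex.ofReal_re]
      gcongr
    have h3 : (-x ^ 2).re ≤ (((‖x₀‖ + 1) ^ 2 : ℝ) : ℂ).re := by
      refine (Complex.re_le_norm _).trans ?_
      rw [norm_neg, norm_pow, Complex.ofReal_re]
      gcongr
    linarith
  have e3 : (-(ω ^ 2) * s ^ 2 + (2 * (‖x₀‖ + 1) * ‖ω‖ + 1 : ℝ) * s +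
      ((‖x₀‖ + 1) ^ 2 : ℝ)).re = (-(ω ^ 2) * s ^ 2 +
      (2 * (‖x₀‖ + 1) * ‖ω‖ : ℝ) * s + ((‖x₀‖ + 1) ^ 2 : ℝ)).re + s := by
    rw [← Complex.ofReal_re s, ← Complex.add_re]
    congr 1
    push_cast
    simp only [Complex.ofReal_re]
    ring
  rw [e3, Real.exp_add]
  calc _ ≤ ‖ω‖ * (Real.exp (-(ω ^ 2) * s ^ 2 +
      (2 * (‖x₀‖ + 1) * ‖ω‖ : ℝ) * s + ((‖x₀‖ + 1) ^ 2 : ℝ)).re *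
        (2 * (‖x₀‖ + 1 + ‖ω‖) * Real.exp s)) := by
        gcongr
    _ = _ := by ring

theorem hasDerivAt_rayIntegral (hω : 0 < (ω ^ 2).re) (x : ℂ) :
    HasDerivAt (rayIntegral ω) (-Complex.exp (-x ^ 2)) x := by
  have hb := ((integrable_cexp_quadratic hω (2 * (‖x‖ + 1) * ‖ω‖ + 1 : ℝ)
    ((‖x‖ + 1) ^ 2 : ℝ)).norm.const_mul (2 * ‖ω‖ * (‖x‖ + 1 + ‖ω‖)))
  have hd : ∀ z : ℂ, ∀ s : ℝ, HasDerivAt (fun z => ω * Complex.exp (-(z + ω * s) ^ 2))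
      (ω * (Complex.exp (-(z + ω * s) ^ 2) * (-(2 * (z + ω * s))))) z := by
    intro z s
    have h1 : HasDerivAt (fun z => -(z + ω * s) ^ 2) (-(2 * (z + ω * s))) z := by
      simpa using (((hasDerivAt_id z).add_const (ω * (s : ℂ))).fun_pow 2).fun_neg
    exact h1.cexp.const_mul ω
  have key := hasDerivAt_integral_of_dominated_loc_of_deriv_le
    (μ := volume.restrict (Ioi (0 : ℝ)))
    (F := fun z s => ω * Complex.exp (-(z + ω * (s : ℝ)) ^ 2))
    (F' := fun z s => ω * (Complex.exp (-(z + ω * (s : ℝ)) ^ 2) * (-(2 * (z + ω * s)))))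
    (x₀ := x) (Metric.ball_mem_nhds x one_pos)
    (Eventually.of_forall fun z => (by fun_prop : Continuous _).aestronglyMeasurable)
    (integrable_ray hω x).integrableOn
    ((by fun_prop : Continuous _).aestronglyMeasurable)
    ((ae_restrict_iff' measurableSet_Ioi).2 (Eventually.of_forall fun s hs z hz =>
      norm_ray_deriv_le hz hs))
    hb.integrableOn
    (Eventually.of_forall fun s z _ => hd z s)
  refine key.2.congr_deriv ?_
  -- the integrand is the derivative of `exp(-(x + ω s) ^ 2)` in `s`
  have hs : ∀ s : ℝ, HasDerivAt (fun s : ℝ => Complex.exp (-(x + ω * (s : ℝ)) ^ 2))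
      (ω * (Complex.exp (-(x + ω * (s : ℝ)) ^ 2) * (-(2 * (x + ω * s))))) s := by
    intro s
    have h0 : HasDerivAt (fun s : ℝ => x + ω * (s : ℂ)) ω s := by
      simpa using ((Complex.ofRealCLM.hasDerivAt (x := s)).const_mul ω).const_add x
    have h1 : HasDerivAt (fun s : ℝ => -(x + ω * (s : ℂ)) ^ 2) (-(2 * (x + ω * s) * ω)) s := by
      simpa using (h0.fun_pow 2).fun_neg
    refine h1.cexp.congr_deriv ?_
    ring
  have hint : IntegrableOn (fun s : ℝ => Complex.exp (-(x + ω * (s : ℝ)) ^ 2)) (Ioi 0) := by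
    have hω0 : ω ≠ 0 := by rintro rfl; simp at hω
    refine (((integrable_ray hω x).const_mul ω⁻¹).congr
      (Eventually.of_forall fun s => ?_)).integrableOn
    simp only
    rw [inv_mul_cancel_left₀ hω0]
  have ht := tendsto_zero_of_hasDerivAt_of_integrableOn_Ioi (a := 0) (fun s _ => hs s) key.1 hint
  rw [integral_Ioi_of_hasDerivAt_of_tendsto (hs 0).continuousAt.continuousWithinAt
    (fun s _ => hs s) key.1 ht]
  simp

theorem rayIntegral_zero (h0 : 0 < ω.re) (hω : 0 < (ω ^ 2).re) :
    rayIntegral ω 0 = sqrtPi / 2 := by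
  have hω0 : ω ≠ 0 := by rintro rfl; simp at hω
  have h1 : rayIntegral ω 0 = ω * ∫ s : ℝ in Ioi 0, Complex.exp (-(ω ^ 2) * (s : ℂ) ^ 2) := by
    rw [rayIntegral, ← integral_const_mul]
    congr 1
    ext s
    congr 2
    ring
  have h2 : (Real.pi : ℂ) = sqrtPi ^ 2 := by
    rw [sqrtPi, ← Complex.ofReal_pow, Real.sq_sqrt Real.pi_pos.le]
  have h3 : 0 < (sqrtPi / ω).re := by
    rw [sqrtPi, Complex.div_re]
    simp only [Complex.ofReal_re, Complex.ofReal_im, zero_mul, zero_div, add_zero]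
    have := Complex.normSq_pos.2 hω0
    have := Real.sqrt_pos.2 Real.pi_pos
    positivity
  rw [h1, integral_gaussian_complex_Ioi hω, h2, ← div_pow, one_div, Complex.sq_cpow_two_inv h3]
  field_simp

/-- The direction of integration is immaterial, since both sides have the same derivative. -/
theorem rayIntegral_eq (h0 : 0 < ω.re) (hω : 0 < (ω ^ 2).re) : rayIntegral ω = errIntegral := by
  have h1 : (0 : ℝ) < ((1 : ℂ) ^ 2).re := by simp
  have hd : ∀ x, HasDerivAt (fun x => rayIntegral ω x - errIntegral x) 0 x := fun x => by
    simpa [errIntegral] using (hasDerivAt_rayIntegral hω x).fun_sub (hasDerivAt_rayIntegral h1 x)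
  ext x
  have := is_const_of_deriv_eq_zero (fun x => (hd x).differentiableAt)
    (fun x => (hd x).deriv) x 0
  simp only [errIntegral, rayIntegral_zero h0 hω, rayIntegral_zero (ω := 1) (by simp) h1,
    sub_self] at this
  exact sub_eq_zero.1 this

theorem hasDerivAt_errIntegral (x : ℂ) :
    HasDerivAt errIntegral (-Complex.exp (-x ^ 2)) x := hasDerivAt_rayIntegral (by simp) x

/-- The connection formula: both integrals together are the Gaussian integral over the line. -/
theorem errIntegral_add_neg (x : ℂ) : errIntegral x + errIntegral (-x) = sqrtPi := by
  have hd : ∀ x, HasDerivAt (fun x => errIntegral x + errIntegral (-x)) 0 x := fun x => by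
    have h1 := (hasDerivAt_errIntegral (-x)).scomp x (hasDerivAt_neg x)
    simpa using (hasDerivAt_errIntegral x).fun_add h1
  have := is_const_of_deriv_eq_zero (fun x => (hd x).differentiableAt)
    (fun x => (hd x).deriv) x 0
  simp only [neg_zero] at this
  rw [this, errIntegral, rayIntegral_zero (by simp) (by simp)]
  ring

/-- The ray in the direction `ω` turns the integral into a Laplace integral, of which `1 / (2 x)` is
the leading term. -/
theorem norm_errIntegral_sub_le (h0 : 0 < ω.re) (hω : 0 < (ω ^ 2).re) (h1 : ‖ω‖ = 1) {x : ℂ}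
    (hx : 0 < (x * ω).re) :
    ‖Complex.exp (x ^ 2) * errIntegral x - 1 / (2 * x)‖ ≤ 2 / (2 * (x * ω).re) ^ 3 := by
  have hx0 : x ≠ 0 := by rintro rfl; simp at hx
  have hω0 : ω ≠ 0 := by rintro rfl; simp at hω
  have hneg : (-2 * (x * ω)).re < 0 := by
    rw [show (-2 : ℂ) = ((-2 : ℝ) : ℂ) by norm_num, Complex.re_ofReal_mul]
    linarith
  have hi1 : IntegrableOn (fun s : ℝ => Complex.exp (-2 * (x * ω) * s)) (Ioi 0) :=
    integrableOn_exp_mul_complex_Ioi hneg 0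
  have e1 : Complex.exp (x ^ 2) * errIntegral x =
      ∫ s : ℝ in Ioi 0, Complex.exp (x ^ 2) * (ω * Complex.exp (-(x + ω * s) ^ 2)) := by
    rw [integral_const_mul, ← rayIntegral_eq h0 hω, rayIntegral]
  have e2 : 1 / (2 * x) = ∫ s : ℝ in Ioi 0, ω * Complex.exp (-2 * (x * ω) * s) := by
    rw [integral_const_mul, integral_exp_mul_complex_Ioi hneg]
    simp
    field_simp
  rw [e1, e2, ← integral_sub ((integrable_ray hω x).const_mul _).integrableOn (hi1.const_mul ω)]
  have hG := Real.integral_rpow_mul_exp_neg_mul_Ioi (a := 3) (r := 2 * (x * ω).re)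
    (by norm_num) (by positivity)
  have hi2 : IntegrableOn (fun s : ℝ => s ^ (3 - 1 : ℝ) * Real.exp (-(2 * (x * ω).re * s)))
      (Ioi 0) := by
    have := integral_undef (f := fun s : ℝ => s ^ (3 - 1 : ℝ) *
      Real.exp (-(2 * (x * ω).re * s))) (μ := volume.restrict (Ioi 0))
    by_contra hcon
    rw [this hcon] at hG
    have h3 : 0 < Real.Gamma 3 := Real.Gamma_pos_of_pos (by norm_num)
    have : 0 < (1 / (2 * (x * ω).re)) ^ (3 : ℝ) * Real.Gamma 3 := by positivity
    linarith
  have hfin : ∫ s : ℝ in Ioi 0, s ^ (3 - 1 : ℝ) * Real.exp (-(2 * (x * ω).re * s)) =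
      2 / (2 * (x * ω).re) ^ 3 := by
    rw [hG, show (3 : ℝ) = (2 : ℕ) + 1 by norm_num, Real.Gamma_nat_eq_factorial,
      show ((2 : ℕ) + 1 : ℝ) = (3 : ℕ) by norm_num, Real.rpow_natCast]
    generalize (x * ω).re = y
    simp only [Nat.factorial]
    push_cast
    ring
  rw [← hfin]
  refine norm_integral_le_of_norm_le hi2 ((ae_restrict_iff' measurableSet_Ioi).2
    (Eventually.of_forall fun s hs => ?_))
  have hs0 : (0 : ℝ) < s := hs
  have e3 : Complex.exp (x ^ 2) * (ω * Complex.exp (-(x + ω * s) ^ 2)) -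
      ω * Complex.exp (-2 * (x * ω) * s) =
      ω * Complex.exp (-2 * (x * ω) * s) * (Complex.exp (-(ω ^ 2 * (s : ℂ) ^ 2)) - 1) := by
    have : Complex.exp (x ^ 2) * Complex.exp (-(x + ω * s) ^ 2) =
        Complex.exp (-2 * (x * ω) * s) * Complex.exp (-(ω ^ 2 * (s : ℂ) ^ 2)) := by
      rw [← Complex.exp_add, ← Complex.exp_add]
      congr 1
      ring
    linear_combination ω * this
  rw [e3, norm_mul, norm_mul, h1, one_mul, Complex.norm_exp]
  have e4 : (-2 * (x * ω) * (s : ℂ)).re = -(2 * (x * ω).re * s) := by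
    rw [show (-2 : ℂ) = ((-2 : ℝ) : ℂ) by norm_num, Complex.re_mul_ofReal, Complex.re_ofReal_mul]
    ring
  have e5 : ‖Complex.exp (-(ω ^ 2 * (s : ℂ) ^ 2)) - 1‖ ≤ s ^ 2 := by
    refine (norm_exp_sub_one_le_of_re_nonpos ?_).trans (le_of_eq ?_)
    · rw [Complex.neg_re, ← Complex.ofReal_pow, Complex.re_mul_ofReal]
      have := mul_pos hω (pow_pos hs0 2)
      linarith
    · rw [norm_neg, norm_mul, norm_pow, norm_pow, h1, Complex.norm_real,
        Real.norm_of_nonneg hs0.le]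
      ring
  rw [e4, show (3 - 1 : ℝ) = (2 : ℕ) by norm_num, Real.rpow_natCast, mul_comm (s ^ 2)]
  gcongr

end

/-- `errIntegral x = exp(-x ^ 2) / (2 x) (1 + O(x ^ (-2)))` for `|arg x| < 3 π / 4`; for
`arg x = φ` the direction `exp(-i φ / 3)` of integration is suitable. -/
theorem errIntegral_sectorLim : SectorLim (-(3 * Real.pi / 4)) (3 * Real.pi / 4)
    (fun x => 2 * x * (Complex.exp (x ^ 2) * errIntegral x)) 1 := by
  refine SectorO.bound_iff.2 fun δ hδ => ?_
  have hpi := Real.pi_pos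
  rcases lt_or_ge (3 * Real.pi / 4) δ with hbig | hsmall
  · exact ⟨1, 1, one_pos, one_pos, fun r φ hr h1 h2 => by linarith⟩
  have hκ : 0 < Real.sin (2 * δ / 3) :=
    Real.sin_pos_of_pos_of_lt_pi (by positivity) (by linarith)
  set κ := Real.sin (2 * δ / 3) with hκdef
  refine ⟨1, 1 / (2 * κ ^ 3), one_pos, by positivity, fun r φ hr h1 h2 => ?_⟩
  have hr0 : 0 < r := by linarith
  set ω : ℂ := Complex.exp ((-(φ / 3) : ℝ) * Complex.I) with hωdef
  have hω1 : ‖ω‖ = 1 := Complex.norm_exp_ofReal_mul_I _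
  have hωre : 0 < ω.re := by
    rw [hωdef, Complex.exp_ofReal_mul_I_re]
    exact Real.cos_pos_of_mem_Ioo ⟨by linarith, by linarith⟩
  have hω2 : 0 < (ω ^ 2).re := by
    have : ω ^ 2 = Complex.exp ((-(2 * φ / 3) : ℝ) * Complex.I) := by
      rw [hωdef, ← Complex.exp_nat_mul]
      congr 1
      push_cast
      ring
    rw [this, Complex.exp_ofReal_mul_I_re]
    exact Real.cos_pos_of_mem_Ioo ⟨by linarith, by linarith⟩
  have hxω : polar r φ * ω = (r : ℂ) * Complex.exp ((2 * φ / 3 : ℝ) * Complex.I) := by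
    rw [polar, hωdef, mul_assoc, ← Complex.exp_add]
    congr 2
    push_cast
    ring
  have hcos : κ ≤ Real.cos (2 * φ / 3) := by
    rw [hκdef, ← Real.cos_pi_div_two_sub, ← Real.cos_abs (2 * φ / 3)]
    refine Real.cos_le_cos_of_nonneg_of_le_pi (abs_nonneg _) (by linarith) ?_
    rw [abs_le]
    constructor <;> linarith
  have hre : r * κ ≤ (polar r φ * ω).re := by
    rw [hxω, Complex.re_ofReal_mul, Complex.exp_ofReal_mul_I_re]
    exact mul_le_mul_of_nonneg_left hcos hr0.le
  have hrκ : 0 < r * κ := by positivity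
  have key := norm_errIntegral_sub_le hωre hω2 hω1 (hrκ.trans_le hre)
  have hx0 : polar r φ ≠ 0 := by
    rw [← norm_pos_iff, norm_polar hr0.le]
    exact hr0
  have e1 : 2 * polar r φ * (Complex.exp (polar r φ ^ 2) * errIntegral (polar r φ)) - 1 =
      2 * polar r φ * (Complex.exp (polar r φ ^ 2) * errIntegral (polar r φ) -
        1 / (2 * polar r φ)) := by
    field_simp
  rw [e1, norm_mul, norm_mul, Complex.norm_two, norm_polar hr0.le]
  calc _ ≤ 2 * r * (2 / (2 * (r * κ)) ^ 3) := by
        refine mul_le_mul_of_nonneg_left (key.trans ?_) (by positivity)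
        gcongr
    _ = _ := by
        rw [zpow_neg]
        field_simp

/-! ### Asymptotics of the error integral in rotated sectors -/

theorem exp_mul_polar (ψ r φ : ℝ) :
    Complex.exp (ψ * Complex.I) * polar r φ = polar r (φ + ψ) := by
  rw [polar, polar, mul_left_comm, ← Complex.exp_add]
  congr 2
  push_cast
  ring

theorem SectorO.rotate {lo hi : ℝ} {n : ℤ} {f : ℂ → ℂ} (hf : SectorO lo hi n f) (ψ : ℝ) :
    SectorO (lo - ψ) (hi - ψ) n fun x => f (Complex.exp (ψ * Complex.I) * x) := by
  refine SectorO.bound_iff.2 fun δ hδ => ?_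
  obtain ⟨R, K, hR, hK, H⟩ := SectorO.bound_iff.1 hf δ hδ
  refine ⟨R, K, hR, hK, fun r φ hr h1 h2 => ?_⟩
  rw [exp_mul_polar]
  exact H r (φ + ψ) hr (by linarith) (by linarith)

theorem SectorLim.rotate {lo hi : ℝ} {c : ℂ} {f : ℂ → ℂ} (hf : SectorLim lo hi f c) (ψ : ℝ) :
    SectorLim (lo - ψ) (hi - ψ) (fun x => f (Complex.exp (ψ * Complex.I) * x)) c :=
  SectorO.rotate hf ψ

/-- `exp(-x ^ 2)` is smaller than any power for `|arg x| < π / 4`; the fourth power suffices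
here. -/
theorem exp_neg_sq_sectorO : SectorO (-(Real.pi / 4)) (Real.pi / 4) (-4)
    fun x => Complex.exp (-x ^ 2) := by
  refine SectorO.bound_iff.2 fun δ hδ => ?_
  have hpi := Real.pi_pos
  rcases lt_or_ge (Real.pi / 4) δ with hbig | hsmall
  · exact ⟨1, 1, one_pos, one_pos, fun r φ hr h1 h2 => by linarith⟩
  have hκ : 0 < Real.sin (2 * δ) := Real.sin_pos_of_pos_of_lt_pi (by positivity) (by linarith)
  refine ⟨1, 2 / Real.sin (2 * δ) ^ 2, one_pos, by positivity, fun r φ hr h1 h2 => ?_⟩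
  have hr0 : 0 < r := by linarith
  have hcos : Real.sin (2 * δ) ≤ Real.cos (2 * φ) := by
    rw [← Real.cos_pi_div_two_sub, ← Real.cos_abs (2 * φ)]
    refine Real.cos_le_cos_of_nonneg_of_le_pi (abs_nonneg _) (by linarith) ?_
    rw [abs_le]
    constructor <;> linarith
  have e1 : (-polar r φ ^ 2).re = -(r ^ 2 * Real.cos (2 * φ)) := by
    have : polar r φ ^ 2 = ((r ^ 2 : ℝ) : ℂ) * Complex.exp ((2 * φ : ℝ) * Complex.I) := by
      rw [polar, mul_pow, ← Complex.exp_nat_mul]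
      push_cast
      congr 2
      ring
    rw [Complex.neg_re, this, Complex.re_ofReal_mul, Complex.exp_ofReal_mul_I_re]
  rw [Complex.norm_exp, e1, Real.exp_neg]
  set y := r ^ 2 * Real.sin (2 * δ) with hy
  have hy0 : 0 < y := by positivity
  have h3 : y ^ 2 / 2 ≤ Real.exp (r ^ 2 * Real.cos (2 * φ)) := by
    have h4 := Real.quadratic_le_exp_of_nonneg hy0.le
    have h5 : Real.exp y ≤ Real.exp (r ^ 2 * Real.cos (2 * φ)) :=
      Real.exp_le_exp.2 (mul_le_mul_of_nonneg_left hcos (by positivity))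
    linarith
  refine (inv_anti₀ (by positivity) h3).trans (le_of_eq ?_)
  rw [hy, zpow_neg]
  field_simp

/-! ### Seed solutions -/

/-- The denominator `A + B errIntegral (κ x)` of a seed solution. -/
noncomputable def seedDenom (κ A B x : ℂ) : ℂ := A + B * errIntegral (κ * x)

/-- The solution `ε D' / D`, where `D = seedDenom κ A B`, of the Riccati equation
`p' = -ε p (2 x + p)` for `ε = κ ^ 2`. -/
noncomputable def seedFun (ε κ A B x : ℂ) : ℂ :=
  -(ε * B * κ * Complex.exp (-ε * x ^ 2)) / seedDenom κ A B x

section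

variable {ε κ A B A' B' : ℂ}

/-- By the connection formula of the error integral, a seed may be written with `-κ` in place of
`κ`, which gives access to the opposite directions. -/
theorem seedFun_neg (ε κ A B : ℂ) :
    seedFun ε (-κ) (A + B * sqrtPi) (-B) = seedFun ε κ A B := by
  ext x
  have h1 : seedDenom (-κ) (A + B * sqrtPi) (-B) x = seedDenom κ A B x := by
    rw [seedDenom, seedDenom, ← errIntegral_add_neg (κ * x), neg_mul κ x]
    ring
  rw [seedFun, seedFun, h1]
  ring

theorem hasDerivAt_seedDenom (hκ : κ ^ 2 = ε) (x : ℂ) :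
    HasDerivAt (seedDenom κ A B) (-(B * κ * Complex.exp (-ε * x ^ 2))) x := by
  have h0 : HasDerivAt (fun x : ℂ => κ * x) κ x := by
    simpa using (hasDerivAt_id x).const_mul κ
  have h1 := (((hasDerivAt_errIntegral (κ * x)).comp x h0).const_mul B).const_add A
  refine h1.congr_deriv ?_
  rw [mul_pow, hκ, neg_mul]
  ring_nf

theorem analyticAt_seedDenom (hκ : κ ^ 2 = ε) (x : ℂ) : AnalyticAt ℂ (seedDenom κ A B) x :=
  Complex.analyticAt_iff_eventually_differentiableAt.2
    (Eventually.of_forall fun z => (hasDerivAt_seedDenom hκ z).differentiableAt)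

theorem analyticAt_seedFun (hκ : κ ^ 2 = ε) {x : ℂ} (h : seedDenom κ A B x ≠ 0) :
    AnalyticAt ℂ (seedFun ε κ A B) x := by
  refine AnalyticAt.div ?_ (analyticAt_seedDenom hκ x) h
  fun_prop

theorem meromorphic_seedFun (hκ : κ ^ 2 = ε) : Meromorphic (seedFun ε κ A B) := fun x => by
  refine MeromorphicAt.div (AnalyticAt.meromorphicAt ?_) (analyticAt_seedDenom hκ x).meromorphicAt
  fun_prop

theorem seedDenom_ne_zero (hκ : κ ^ 2 = ε) (hε : ε ^ 2 = 1) (hAB : A ≠ 0 ∨ B ≠ 0) :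
    ∀ᶠ x in codiscrete ℂ, seedDenom κ A B x ≠ 0 := by
  refine (eventually_eq_zero_or_ne_zero
    fun x => (analyticAt_seedDenom hκ x).meromorphicAt).resolve_left fun h => ?_
  obtain ⟨x, hx⟩ := exists_of_eventually_codiscrete (eventually_codiscrete_eventually_nhds h)
  have hB : B = 0 := by
    have h1 : HasDerivAt (seedDenom κ A B) 0 x :=
      (hasDerivAt_const x (0 : ℂ)).congr_of_eventuallyEq hx
    have h2 := (hasDerivAt_seedDenom hκ x).unique h1
    have hκ0 : κ ≠ 0 := by rintro rfl; simp [← hκ] at hε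
    simpa [hκ0, Complex.exp_ne_zero] using h2
  have h3 := hx.self_of_nhds
  rw [seedDenom, hB, zero_mul, add_zero] at h3
  exact hAB.elim (fun h => h h3) (fun h => h hB)

theorem symSystem_seed (hκ : κ ^ 2 = ε) (hε : ε ^ 2 = 1) (hAB : A ≠ 0 ∨ B ≠ 0) :
    SymSystem ε 0 (-2) 0 (seedFun ε κ A B) (fun x => -2 * x - seedFun ε κ A B x)
      (fun _ => 0) where
  sign := hε
  mero₁ := meromorphic_seedFun hκ
  mero₂ := ((Meromorphic.const (-2)).mul fun x => MeromorphicAt.id x).sub (meromorphic_seedFun hκ)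
  mero₃ := Meromorphic.const 0
  equations := by
    filter_upwards [seedDenom_ne_zero hκ hε hAB] with x hx
    have h1 : HasDerivAt (fun x => -(ε * B * κ * Complex.exp (-ε * x ^ 2)))
        (-(ε * B * κ * (Complex.exp (-ε * x ^ 2) * (-ε * (2 * x))))) x := by
      have : HasDerivAt (fun x : ℂ => -ε * x ^ 2) (-ε * (2 * x)) x := by
        simpa using (hasDerivAt_pow 2 x).const_mul (-ε)
      exact (this.cexp.const_mul (ε * B * κ)).fun_neg
    have h2 : HasDerivAt (seedFun ε κ A B)
        (-ε * seedFun ε κ A B x * (2 * x + seedFun ε κ A B x)) x := by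
      refine (h1.fun_div (hasDerivAt_seedDenom hκ x) hx).congr_deriv ?_
      rw [seedFun]
      generalize Complex.exp (-ε * x ^ 2) = e
      field_simp
      linear_combination (B ^ 2 * κ ^ 2 * ε * e ^ 2) * hε
    have h3 : HasDerivAt (fun x : ℂ => -2 * x) (-2) x := by
      simpa using (hasDerivAt_id x).const_mul (-2 : ℂ)
    refine ⟨h2.congr_deriv (by ring), (h3.fun_sub h2).congr_deriv (by ring),
      (hasDerivAt_const x (0 : ℂ)).congr_deriv (by ring), by ring⟩

variable {ψ : ℝ}

/-- Where `exp(-ε x ^ 2)` is small, a seed with `A ≠ 0` is small as well. -/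
theorem seedDenom_lim_small (hκ : κ = Complex.exp (ψ * Complex.I)) (A B : ℂ) :
    SectorLim (-(Real.pi / 4) - ψ) (Real.pi / 4 - ψ) (seedDenom κ A B) A := by
  have hpi := Real.pi_pos
  have h1 := (errIntegral_sectorLim.subsector (lo' := -(Real.pi / 4)) (hi' := Real.pi / 4)
    (by linarith) (by linarith)).bounded
  have h2 : SectorO (-(Real.pi / 4)) (Real.pi / 4) (-2) errIntegral := by
    have h3 := ((h1.mul exp_neg_sq_sectorO).zpow_mul (-1)).const_mul (1 / 2)
    refine (h3.mono (by norm_num)).congr ?_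
    filter_upwards [eventually_ne_zero _ _] with x hx
    rw [Complex.exp_neg, zpow_neg_one]
    have := Complex.exp_ne_zero (x ^ 2)
    field_simp
  have h3 := ((h2.rotate ψ).const_mul B)
  refine SectorO.congr h3 (Eventually.of_forall fun x => ?_)
  rw [seedDenom, hκ]
  ring

theorem exp_small (hκ : κ = Complex.exp (ψ * Complex.I)) (hε : κ ^ 2 = ε) :
    SectorO (-(Real.pi / 4) - ψ) (Real.pi / 4 - ψ) (-4) fun x => Complex.exp (-ε * x ^ 2) := by
  refine (exp_neg_sq_sectorO.rotate ψ).congr (Eventually.of_forall fun x => ?_)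
  rw [← hκ, mul_pow, hε, neg_mul]

theorem seedFun_div_expScale (hκ : κ = Complex.exp (ψ * Complex.I)) (hA : A ≠ 0) :
    SectorLim (-(Real.pi / 4) - ψ) (Real.pi / 4 - ψ)
      (fun x => seedFun ε κ A B x / expScale ε 0 x) (-(ε * κ * (B / A))) := by
  refine (((SectorLim.const _ _ (-(ε * B * κ))).div (seedDenom_lim_small hκ A B) hA).cast
    (by ring)).congr (Eventually.of_forall fun x => ?_)
  rw [seedFun, expScale, zpow_zero, one_mul]
  have := Complex.exp_ne_zero (-ε * x ^ 2)
  field_simp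

theorem middleLarge_seed_small (hκ : κ = Complex.exp (ψ * Complex.I)) (hε : κ ^ 2 = ε)
    (hA : A ≠ 0) :
    MiddleLarge (-(Real.pi / 4) - ψ) (Real.pi / 4 - ψ) (seedFun ε κ A B)
      (fun x => -2 * x - seedFun ε κ A B x) (fun _ => 0) where
  analytic := by
    filter_upwards [(seedDenom_lim_small hκ A B).eventually_ne hA] with x hx
    have := analyticAt_seedFun hε hx
    exact ⟨this, by fun_prop, analyticAt_const⟩
  bound₁ := by
    have h1 := (seedFun_div_expScale (ε := ε) (B := B) hκ hA).bounded.mul (exp_small hκ hε)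
    refine (h1.mono (by norm_num)).congr (Eventually.of_forall fun x => ?_)
    rw [expScale, zpow_zero, one_mul, div_mul_cancel₀ _ (Complex.exp_ne_zero _)]
  bound₃ := SectorO.zero _ _ _

/-- Two seeds in the sector where `exp(-ε x ^ 2)` is small. -/
theorem expPair_seed_small (hκ : κ = Complex.exp (ψ * Complex.I)) (hε : κ ^ 2 = ε)
    (hε2 : ε ^ 2 = 1) (hA : A ≠ 0) (hA' : A' ≠ 0) :
    ExpPair (-(Real.pi / 4) - ψ) (Real.pi / 4 - ψ) ε 0 (-2) 0 (-(ε * κ * (B / A - B' / A'))) 0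
      (seedFun ε κ A B) (fun x => -2 * x - seedFun ε κ A B x) (fun _ => 0)
      (seedFun ε κ A' B') (fun x => -2 * x - seedFun ε κ A' B' x) (fun _ => 0) where
  sys := symSystem_seed hε hε2 (Or.inl hA)
  sys' := symSystem_seed hε hε2 (Or.inl hA')
  large := middleLarge_seed_small hκ hε hA
  large' := middleLarge_seed_small hκ hε hA'
  diff₁ := (((seedFun_div_expScale (B := B) hκ hA).sub
    (seedFun_div_expScale (B := B') hκ hA')).cast (by ring)).congr
    (Eventually.of_forall fun x => by rw [sub_div])
  diff₃ := by simpa using SectorO.zero _ _ _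

/-- The denominator, normalized where `exp(-ε x ^ 2)` is its dominant term. -/
noncomputable def scaledDenom (ε κ A B x : ℂ) : ℂ :=
  2 * κ * x * Complex.exp (ε * x ^ 2) * seedDenom κ A B x

/-- For `A = 0` the range of the asymptotics is that of the error integral. -/
theorem scaledDenom_lim_of_zero (hκ : κ = Complex.exp (ψ * Complex.I)) (hε : κ ^ 2 = ε) (B : ℂ) :
    SectorLim (-(3 * Real.pi / 4) - ψ) (3 * Real.pi / 4 - ψ) (scaledDenom ε κ 0 B) B := by
  refine (((errIntegral_sectorLim.rotate ψ).const_mul B).cast (by ring)).congr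
    (Eventually.of_forall fun x => ?_)
  rw [scaledDenom, seedDenom, ← hκ, mul_pow, hε]
  ring

theorem scaledDenom_lim {lo hi : ℝ} (hκ : κ = Complex.exp (ψ * Complex.I)) (hε : κ ^ 2 = ε)
    (h1 : -(3 * Real.pi / 4) - ψ ≤ lo) (h2 : hi ≤ 3 * Real.pi / 4 - ψ)
    (hd : SectorO lo hi (-4) fun x => Complex.exp (ε * x ^ 2)) (A B : ℂ) :
    SectorLim lo hi (scaledDenom ε κ A B) B := by
  have h3 := (scaledDenom_lim_of_zero hκ hε B).subsector h1 h2
  have h4 := ((hd.zpow_mul 1).const_mul (2 * κ * A)).mono (m := -2) (by norm_num)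
  refine ((h3.add (.of_sectorO h4)).cast (by ring)).congr (Eventually.of_forall fun x => ?_)
  rw [scaledDenom, scaledDenom, seedDenom, seedDenom, zpow_one]
  ring

theorem exp_large_upper (hκ : κ = Complex.exp (ψ * Complex.I)) (hε : κ ^ 2 = ε) :
    SectorO (Real.pi / 4 - ψ) (3 * Real.pi / 4 - ψ) (-4) fun x => Complex.exp (ε * x ^ 2) := by
  have h1 : Complex.exp ((ψ - Real.pi / 2 : ℝ) * Complex.I) = κ * (-Complex.I) := by
    push_cast
    rw [sub_mul, sub_eq_add_neg, Complex.exp_add, ← hκ, ← neg_mul, ← neg_div,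
      Complex.exp_neg_pi_div_two_mul_I]
  have h2 := exp_small (ε := -ε) h1.symm (by rw [mul_pow, hε]; simp)
  have e1 : -(Real.pi / 4) - (ψ - Real.pi / 2) = Real.pi / 4 - ψ := by ring
  have e2 : Real.pi / 4 - (ψ - Real.pi / 2) = 3 * Real.pi / 4 - ψ := by ring
  rwa [e1, e2, neg_neg] at h2

theorem exp_large_lower (hκ : κ = Complex.exp (ψ * Complex.I)) (hε : κ ^ 2 = ε) :
    SectorO (-(3 * Real.pi / 4) - ψ) (-(Real.pi / 4) - ψ) (-4)
      fun x => Complex.exp (ε * x ^ 2) := by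
  have h1 : Complex.exp ((ψ + Real.pi / 2 : ℝ) * Complex.I) = κ * Complex.I := by
    push_cast
    rw [add_mul, Complex.exp_add, ← hκ, Complex.exp_pi_div_two_mul_I]
  have h2 := exp_small (ε := -ε) h1.symm (by rw [mul_pow, hε]; simp)
  have e1 : -(Real.pi / 4) - (ψ + Real.pi / 2) = -(3 * Real.pi / 4) - ψ := by ring
  have e2 : Real.pi / 4 - (ψ + Real.pi / 2) = -(Real.pi / 4) - ψ := by ring
  rwa [e1, e2, neg_neg] at h2

theorem middleLarge_seed_large {lo hi : ℝ} (hε : κ ^ 2 = ε) (hε2 : ε ^ 2 = 1) (hB : B ≠ 0)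
    (hG : SectorLim lo hi (scaledDenom ε κ A B) B) :
    MiddleLarge lo hi (fun x => -2 * x - seedFun ε κ A B x) (seedFun ε κ A B)
      (fun _ => 0) where
  analytic := by
    filter_upwards [hG.eventually_ne hB] with x hx
    have := analyticAt_seedFun (A := A) (B := B) hε (x := x) fun h => hx (by simp [scaledDenom, h])
    exact ⟨by fun_prop, this, analyticAt_const⟩
  bound₁ := by
    have h1 := ((SectorLim.const lo hi 1).sub
      (((SectorLim.const lo hi B).div hG hB))).cast (d := 0) (by field_simp; ring)
    refine (h1.sectorO.zpow_mul 1).const_mul (-2) |>.mono (by norm_num) |>.congr ?_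
    filter_upwards [hG.eventually_ne hB, eventually_ne_zero lo hi] with x hx h0
    have hκ0 : κ ≠ 0 := by rintro rfl; simp [← hε] at hε2
    have hD : seedDenom κ A B x ≠ 0 := fun h => hx (by simp [scaledDenom, h])
    rw [seedFun, scaledDenom, neg_mul ε, Complex.exp_neg, zpow_one]
    have := Complex.exp_ne_zero (ε * x ^ 2)
    field_simp
    linear_combination (B * ε) * hε + B * hε2
  bound₃ := SectorO.zero _ _ _

/-- Two seeds in a sector where `exp(ε x ^ 2)` is small, or is absent from the denominators; now
`seedFun` is the large function, and the sign of the exponential is reversed. -/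
theorem expPair_seed_large {lo hi : ℝ} (hε : κ ^ 2 = ε) (hε2 : ε ^ 2 = 1) (hB : B ≠ 0)
    (hB' : B' ≠ 0) (hG : SectorLim lo hi (scaledDenom ε κ A B) B)
    (hG' : SectorLim lo hi (scaledDenom ε κ A' B') B') :
    ExpPair lo hi (-ε) (-2) 0 0 (4 * κ * (A' / B' - A / B)) 2
      (fun x => -2 * x - seedFun ε κ A B x) (seedFun ε κ A B) (fun _ => 0)
      (fun x => -2 * x - seedFun ε κ A' B' x) (seedFun ε κ A' B') (fun _ => 0) where
  sys := (symSystem_seed hε hε2 (Or.inr hB)).reverse.rotate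
  sys' := (symSystem_seed hε hε2 (Or.inr hB')).reverse.rotate
  large := middleLarge_seed_large hε hε2 hB hG
  large' := middleLarge_seed_large hε hε2 hB' hG'
  diff₁ := by
    refine (((SectorLim.const lo hi (4 * κ * (B * A' - B' * A))).div (hG.mul hG')
      (mul_ne_zero hB hB')).cast (by field_simp)).congr ?_
    filter_upwards [hG.eventually_ne hB, hG'.eventually_ne hB', eventually_ne_zero lo hi]
      with x hx hx' h0
    have hκ0 : κ ≠ 0 := by rintro rfl; simp [← hε] at hε2
    have hD : seedDenom κ A B x ≠ 0 := fun h => hx (by simp [scaledDenom, h])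
    have hD' : seedDenom κ A' B' x ≠ 0 := fun h => hx' (by simp [scaledDenom, h])
    have e1 : B * A' - B' * A = B * seedDenom κ A' B' x - B' * seedDenom κ A B x := by
      rw [seedDenom, seedDenom]
      ring
    rw [e1, seedFun, seedFun, scaledDenom, scaledDenom, expScale, neg_neg, neg_mul ε,
      Complex.exp_neg]
    have := Complex.exp_ne_zero (ε * x ^ 2)
    norm_cast
    field_simp
    linear_combination (4 * ε * (B * seedDenom κ A' B' x - B' * seedDenom κ A B x)) * hε +
      4 * (B * seedDenom κ A' B' x - B' * seedDenom κ A B x) * hε2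
  diff₃ := by simpa using SectorO.zero _ _ _

end

/-! ### From the symmetric form to the asymptotics of single solutions -/

theorem powerAsymp_of_lim {y lead : ℂ → ℂ} {lo hi : ℝ} (hlead : ∀ x, x ≠ 0 → lead x ≠ 0)
    (h : SectorLim lo hi (fun x => y x / lead x) 1) : PowerAsymp y lead lo hi := by
  intro δ hδ
  obtain ⟨R, K, hR, -, H⟩ := SectorO.bound_iff.1 h δ hδ
  refine ⟨R, K, hR, fun r φ hr h1 h2 => ⟨_, (H r φ hr h1 h2).trans (le_of_eq ?_), ?_⟩⟩
  · rw [zpow_neg, div_eq_mul_inv]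
    norm_cast
  · have hr0 : 0 < r := by linarith
    have hx : polar r φ ≠ 0 := by
      rw [← norm_pos_iff, norm_polar hr0.le]
      exact hr0
    have := hlead _ hx
    field_simp
    ring

theorem powerAsymp_zero {lead : ℂ → ℂ} (h : ∀ x, lead x = 0) (lo hi : ℝ) :
    PowerAsymp (fun _ => 0) lead lo hi := fun _ _ =>
  ⟨1, 0, one_pos, fun r φ _ _ _ => ⟨0, by simp, by simp [h]⟩⟩

theorem PainleveIV.PowerAsymp.subsector {y lead : ℂ → ℂ} {lo hi lo' hi' : ℝ}
    (h : PowerAsymp y lead lo hi) (h1 : lo ≤ lo') (h2 : hi' ≤ hi) : PowerAsymp y lead lo' hi' := by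
  intro δ hδ
  obtain ⟨R, K, hR, H⟩ := h δ hδ
  exact ⟨R, K, hR, fun r φ hr h3 h4 => H r φ hr (by linarith) (by linarith)⟩

theorem polar_add_two_pi (r φ : ℝ) (k : ℤ) : polar r (φ + 2 * Real.pi * k) = polar r φ := by
  rw [polar, polar]
  congr 1
  rw [Complex.exp_eq_exp_iff_exists_int]
  exact ⟨k, by push_cast; ring⟩

theorem PainleveIV.PowerAsymp.shift {y lead : ℂ → ℂ} {lo hi : ℝ} (h : PowerAsymp y lead lo hi)
    (k : ℤ) : PowerAsymp y lead (lo + 2 * Real.pi * k) (hi + 2 * Real.pi * k) := by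
  intro δ hδ
  obtain ⟨R, K, hR, H⟩ := h δ hδ
  refine ⟨R, K, hR, fun r φ hr h3 h4 => ?_⟩
  have := H r (φ - 2 * Real.pi * k) hr (by linarith) (by linarith)
  rwa [← polar_add_two_pi r (φ - 2 * Real.pi * k) k, sub_add_cancel] at this

theorem stepTheta_neg (t : ℝ) : stepTheta (-t) = 1 - stepTheta t := by
  rcases lt_trichotomy t 0 with h | h | h
  · simp [stepTheta, h, h.ne, h.le]
  · subst h
    norm_num [stepTheta]
  · simp [stepTheta, h, h.ne', not_lt.2 h.le]

/-- A solution that differs by multiples of the exponential from the backgrounds on both sides of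
a Stokes ray has the mean of the two multiples on the ray. -/
theorem expAsymp_of_lims {y lead amp : ℂ → ℂ} {B : ℤ → ℂ → ℂ} {j : ℤ} {μ : ℝ → ℂ} {μl μr : ℂ}
    {lo hi : ℝ} (hlo : lo = Real.pi / 2 * j - Real.pi / 4)
    (hhi : hi = Real.pi / 2 * j + Real.pi / 4)
    (hBl : PowerAsymp (B j) lead lo hi) (hBr : PowerAsymp (B (j + 1)) lead lo hi)
    (hl : SectorLim lo hi (fun x => (y x - B j x) / amp x) μl) (hl0 : μl = 0 → y = B j)
    (hr : SectorLim lo hi (fun x => (y x - B (j + 1) x) / amp x) μr)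
    (hr0 : μr = 0 → y = B (j + 1)) (hamp : ∀ x, x ≠ 0 → amp x ≠ 0)
    (hμ : ∀ φ : ℝ, μ φ = (1 - stepTheta (φ - Real.pi / 2 * j)) * μl +
      stepTheta (φ - Real.pi / 2 * j) * μr) : ExpAsymp y lead B j amp μ := by
  subst hlo hhi
  intro δ hδ
  obtain ⟨R₁, K₁, hR₁, H₁⟩ := hBl δ hδ
  obtain ⟨R₂, K₂, hR₂, H₂⟩ := hBr δ hδ
  obtain ⟨R₃, K₃, hR₃, hK₃, H₃⟩ := SectorO.bound_iff.1 hl δ hδ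
  obtain ⟨R₄, K₄, hR₄, hK₄, H₄⟩ := SectorO.bound_iff.1 hr δ hδ
  refine ⟨R₁ + R₂ + R₃ + R₄, |K₁| + |K₂| + K₃ * (1 + ‖μl‖⁻¹) + K₄ * (1 + ‖μr‖⁻¹), by positivity,
    fun r φ hr h1 h2 => ?_⟩
  have hr' : 0 < r := by linarith
  have hx : polar r φ ≠ 0 := by
    rw [← norm_pos_iff, norm_polar hr'.le]
    exact hr'
  have ha := hamp _ hx
  obtain ⟨e₁, he₁, hy₁⟩ := H₁ r φ (by linarith) h1 h2
  obtain ⟨e₂, he₂, hy₂⟩ := H₂ r φ (by linarith) h1 h2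
  have he₃ := H₃ r φ (by linarith) h1 h2
  have he₄ := H₄ r φ (by linarith) h1 h2
  generalize polar r φ = x at *
  have hrr : r ^ (-2 : ℤ) = 1 / r ^ 2 := by rw [zpow_neg, one_div]; norm_cast
  rw [hrr, mul_one_div] at he₃ he₄
  set s := (1 : ℝ) / r ^ 2 with hs
  have hs0 : 0 < s := by positivity
  have hKs : ∀ K : ℝ, K / r ^ 2 = K * s := fun K => by rw [hs]; ring
  rw [hKs] at he₁ he₂ he₃ he₄ ⊢
  have b1 : ‖e₁‖ ≤ |K₁| * s := he₁.trans (mul_le_mul_of_nonneg_right (le_abs_self _) hs0.le)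
  have b2 : ‖e₂‖ ≤ |K₂| * s := he₂.trans (mul_le_mul_of_nonneg_right (le_abs_self _) hs0.le)
  have p1 : 0 ≤ |K₁| * s := by positivity
  have p2 : 0 ≤ |K₂| * s := by positivity
  have p3 : 0 ≤ K₃ * s := by positivity
  have p4 : 0 ≤ K₄ * s := by positivity
  have p5 : 0 ≤ K₃ * s * ‖μl‖⁻¹ := by positivity
  have p6 : 0 ≤ K₄ * s * ‖μr‖⁻¹ := by positivity
  rw [hμ]
  set d₃ := (y x - B j x) / amp x - μl with hd₃
  set d₄ := (y x - B (j + 1) x) / amp x - μr with hd₄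
  have y₃ : y x = B j x + amp x * (μl + d₃) := by
    rw [hd₃]
    field_simp
    ring
  have y₄ : y x = B (j + 1) x + amp x * (μr + d₄) := by
    rw [hd₄]
    field_simp
    ring
  rcases lt_trichotomy φ (Real.pi / 2 * j) with hφ | hφ | hφ
  · have hΘ : stepTheta (φ - Real.pi / 2 * j) = 0 := by simp [stepTheta, hφ]
    rw [hΘ]
    refine ⟨e₁, d₃ / μl, by nlinarith, ?_, by rw [hy₁]; ring, fun _ => ?_,
      fun h => absurd h hφ.ne⟩
    · rw [norm_div, div_eq_mul_inv]
      nlinarith [mul_le_mul_of_nonneg_right he₃ (inv_nonneg.2 (norm_nonneg μl))]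
    · by_cases h0 : μl = 0
      · rw [hl0 h0, hy₁, h0]
        ring
      · rw [y₃, hy₁]
        field_simp
        ring
  · have hΘ : stepTheta (φ - Real.pi / 2 * j) = 1 / 2 := by simp [stepTheta, hφ]
    rw [hΘ]
    refine ⟨(e₁ + e₂) / 2, (d₃ + d₄) / 2, ?_, ?_, by rw [hy₁, hy₂]; ring,
      fun h => absurd hφ h, fun _ => ?_⟩
    · rw [norm_div, Complex.norm_two]
      linarith [norm_add_le e₁ e₂]
    · rw [norm_div, Complex.norm_two]
      linarith [norm_add_le d₃ d₄]
    · rw [hy₁] at y₃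
      rw [hy₂] at y₄
      linear_combination (y₃ + y₄) / 2
  · have hΘ : stepTheta (φ - Real.pi / 2 * j) = 1 := by
      simp [stepTheta, hφ.le, (sub_pos.2 hφ).ne']
    rw [hΘ]
    refine ⟨e₂, d₄ / μr, by nlinarith, ?_, by rw [hy₂]; ring, fun _ => ?_,
      fun h => absurd h hφ.ne'⟩
    · rw [norm_div, div_eq_mul_inv]
      nlinarith [mul_le_mul_of_nonneg_right he₄ (inv_nonneg.2 (norm_nonneg μr))]
    · by_cases h0 : μr = 0
      · rw [hr0 h0, hy₂, h0]
        ring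
      · rw [y₄, hy₂]
        field_simp
        ring

/-- The solution of the fourth Painlevé equation given by a triple, in normal form. -/
noncomputable def Triple.solution (t : Triple) : ℂ → ℂ := normalForm t.u

namespace Triple

variable {lo hi : ℝ} {n m : ℕ} {μ : ℂ} {k : ℤ} {s t : Triple}

theorem PairVPos.solution_eq (h : PairVPos lo hi n m μ k s t) :
    ∀ᶠ x in openSector lo hi, s.solution x = s.u x ∧ t.solution x = t.u x := by
  filter_upwards [h.large.analytic, h.large'.analytic] with x h1 h2
  exact ⟨normalForm_eq_of_analyticAt h.sys.mero₁ h1.1,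
    normalForm_eq_of_analyticAt h.sys'.mero₁ h2.1⟩

theorem PairUNeg.solution_eq (h : PairUNeg lo hi n m μ k s t) :
    ∀ᶠ x in openSector lo hi, s.solution x = s.u x ∧ t.solution x = t.u x := by
  filter_upwards [h.large.analytic, h.large'.analytic] with x h1 h2
  exact ⟨normalForm_eq_of_analyticAt h.sys.mero₂ h1.2.1,
    normalForm_eq_of_analyticAt h.sys'.mero₂ h2.2.1⟩

theorem PairWPos.solution_eq (h : PairWPos lo hi n m μ k s t) :
    ∀ᶠ x in openSector lo hi, s.solution x = s.u x ∧ t.solution x = t.u x := by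
  filter_upwards [h.large.analytic, h.large'.analytic] with x h1 h2
  exact ⟨normalForm_eq_of_analyticAt h.sys.mero₃ h1.2.2,
    normalForm_eq_of_analyticAt h.sys'.mero₃ h2.2.2⟩

theorem PairVNeg.solution_eq (h : PairVNeg lo hi n m μ k s t) :
    ∀ᶠ x in openSector lo hi, s.solution x = s.u x ∧ t.solution x = t.u x := by
  filter_upwards [h.large.analytic, h.large'.analytic] with x h1 h2
  exact ⟨normalForm_eq_of_analyticAt h.sys.mero₃ h1.2.2,
    normalForm_eq_of_analyticAt h.sys'.mero₃ h2.2.2⟩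

theorem PairVPos.lim (h : PairVPos lo hi n m μ k s t) :
    SectorLim lo hi (fun x => x ^ (1 : ℤ) * s.solution x) m := by
  refine ((h.large.lim₁ h.sys).cast (by ring)).congr ?_
  filter_upwards [h.solution_eq] with x hx
  rw [hx.1, zpow_one]

theorem PairUNeg.lim (h : PairUNeg lo hi n m μ k s t) :
    SectorLim lo hi (fun x => x ^ (-1 : ℤ) * s.solution x) (-2) := by
  refine (h.large.lim₂ h.sys).congr ?_
  filter_upwards [h.solution_eq] with x hx
  rw [hx.1, zpow_neg_one]
  ring

theorem PairWPos.lim (h : PairWPos lo hi n m μ k s t) :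
    SectorLim lo hi (fun x => x ^ (1 : ℤ) * s.solution x) (-m) := by
  refine ((h.large.lim₃ h.sys).cast (by ring)).congr ?_
  filter_upwards [h.solution_eq] with x hx
  rw [hx.1, zpow_one]

theorem PairVNeg.lim (h : PairVNeg lo hi n m μ k s t) :
    SectorLim lo hi (fun x => x ^ (1 : ℤ) * s.solution x) m := by
  refine ((h.large.lim₃ h.sys).cast (by ring)).congr ?_
  filter_upwards [h.solution_eq] with x hx
  rw [hx.1, zpow_one]

theorem expScale_one (k : ℤ) (x : ℂ) : expScale 1 k x = ampMinus k x := by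
  rw [expScale, ampMinus, neg_one_mul]

theorem expScale_neg_one (k : ℤ) (x : ℂ) : expScale (-1) k x = ampPlus k x := by
  rw [expScale, ampPlus, neg_neg, one_mul]

theorem ampMinus_ne_zero (k : ℤ) (x : ℂ) (hx : x ≠ 0) : ampMinus k x ≠ 0 := by
  rw [← expScale_one]
  exact expScale_ne_zero hx

theorem ampPlus_ne_zero (k : ℤ) (x : ℂ) (hx : x ≠ 0) : ampPlus k x ≠ 0 := by
  rw [← expScale_neg_one]
  exact expScale_ne_zero hx

theorem PairVPos.diff (h : PairVPos lo hi n m μ k s t) :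
    SectorLim lo hi (fun x => (s.solution x - t.solution x) / ampMinus k x) μ := by
  refine h.diff₁.congr ?_
  filter_upwards [h.solution_eq] with x hx
  rw [hx.1, hx.2, expScale_one]

theorem PairUNeg.diff (h : PairUNeg lo hi n m μ k s t) :
    SectorLim lo hi (fun x => (s.solution x - t.solution x) / ampPlus k x) (-μ) := by
  refine h.diff₂_lim.congr ?_
  filter_upwards [h.solution_eq] with x hx
  rw [hx.1, hx.2, expScale_neg_one]

theorem PairWPos.diff (h : PairWPos lo hi n m μ k s t) :
    SectorLim lo hi (fun x => (s.solution x - t.solution x) / ampMinus (k - 2) x)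
      (m * μ / 2) := by
  refine (h.diff₃_lim.cast (by ring)).congr ?_
  filter_upwards [h.solution_eq, eventually_ne_zero lo hi] with x hx h0
  have hE := expScale_ne_zero (ε := 1) (k := k) h0
  rw [hx.1, hx.2, ← expScale_one, ExpPair.expScale_sub_two h0]
  field_simp

theorem PairVNeg.diff (h : PairVNeg lo hi n m μ k s t) :
    SectorLim lo hi (fun x => (s.solution x - t.solution x) / ampPlus (k - 2) x)
      (-(m * μ / 2)) := by
  refine (h.diff₃_lim.cast (by ring)).congr ?_
  filter_upwards [h.solution_eq, eventually_ne_zero lo hi] with x hx h0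
  have hE := expScale_ne_zero (ε := -1) (k := k) h0
  rw [hx.1, hx.2, ← expScale_neg_one, ExpPair.expScale_sub_two h0]
  field_simp

theorem powerAsymp_leadMinus {y : ℂ → ℂ} {β : ℂ} (hβ : β = -2 * m)
    (h : SectorLim lo hi (fun x => x ^ (1 : ℤ) * y x) m) (h0 : m = 0 → y = fun _ => 0) :
    PowerAsymp y (leadMinus β) lo hi := by
  rcases eq_or_ne m 0 with hm | hm
  · rw [h0 hm]
    refine powerAsymp_zero (fun x => ?_) lo hi
    simp [leadMinus, hβ, hm]
  · have hm' : (m : ℂ) ≠ 0 := Nat.cast_ne_zero.2 hm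
    refine powerAsymp_of_lim (fun x hx => ?_) (((h.const_mul (m : ℂ)⁻¹).cast ?_).congr ?_)
    · rw [leadMinus, hβ]
      simp [hx, hm]
    · rw [inv_mul_cancel₀ hm']
    · filter_upwards [eventually_ne_zero lo hi] with x hx
      rw [leadMinus, hβ, zpow_one]
      field_simp

theorem powerAsymp_leadPlus {y : ℂ → ℂ} {β : ℂ} (hβ : β = -2 * m)
    (h : SectorLim lo hi (fun x => x ^ (1 : ℤ) * y x) (-m)) (h0 : m = 0 → y = fun _ => 0) :
    PowerAsymp y (leadPlus β) lo hi := by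
  rcases eq_or_ne m 0 with hm | hm
  · rw [h0 hm]
    refine powerAsymp_zero (fun x => ?_) lo hi
    simp [leadPlus, hβ, hm]
  · have hm' : (m : ℂ) ≠ 0 := Nat.cast_ne_zero.2 hm
    refine powerAsymp_of_lim (fun x hx => ?_) (((h.const_mul (-(m : ℂ)⁻¹)).cast ?_).congr ?_)
    · rw [leadPlus, hβ]
      simp [hx, hm]
    · field_simp
    · filter_upwards [eventually_ne_zero lo hi] with x hx
      rw [leadPlus, hβ, zpow_one]
      field_simp

theorem powerAsymp_leadLin {y : ℂ → ℂ} (h : SectorLim lo hi (fun x => x ^ (-1 : ℤ) * y x) (-2)) :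
    PowerAsymp y leadLin lo hi := by
  refine powerAsymp_of_lim (fun x hx => ?_) (((h.const_mul (-(1 / 2))).cast (by norm_num)).congr ?_)
  · simp [leadLin, hx]
  · filter_upwards [eventually_ne_zero lo hi] with x hx
    rw [leadLin, zpow_neg_one]
    field_simp

end Triple

/-! ### Rational functions -/

namespace PainleveIV.IsRational

variable {f g : ℂ → ℂ}

theorem const_mul_id (c : ℂ) : IsRational fun x => c * x :=
  ⟨.C c * .X, 1, one_ne_zero, fun x _ => by simp⟩

theorem zero : IsRational fun _ => 0 := ⟨0, 1, one_ne_zero, fun x _ => by simp⟩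

theorem add (hf : IsRational f) (hg : IsRational g) : IsRational fun x => f x + g x := by
  obtain ⟨P, Q, hQ, h⟩ := hf
  obtain ⟨P', Q', hQ', h'⟩ := hg
  refine ⟨P * Q' + P' * Q, Q * Q', mul_ne_zero hQ hQ', fun x hx => ?_⟩
  rw [Polynomial.eval_mul] at hx
  have h1 := left_ne_zero_of_mul hx
  have h2 := right_ne_zero_of_mul hx
  simp only [h x h1, h' x h2, Polynomial.eval_add, Polynomial.eval_mul]
  field_simp

theorem const_div (c : ℂ) (hf : IsRational f) : IsRational fun x => c / f x := by
  obtain ⟨P, Q, hQ, h⟩ := hf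
  rcases eq_or_ne P 0 with rfl | hP
  · exact ⟨0, Q, hQ, fun x hx => by simp [h x hx]⟩
  · refine ⟨.C c * Q * Q, P * Q, mul_ne_zero hP hQ, fun x hx => ?_⟩
    rw [Polynomial.eval_mul] at hx
    have h1 := left_ne_zero_of_mul hx
    have h2 := right_ne_zero_of_mul hx
    simp only [h x h2, Polynomial.eval_mul, Polynomial.eval_C]
    field_simp

theorem sub_const_div (hf : IsRational f) (c : ℂ) (hg : IsRational g) :
    IsRational fun x => f x - c / g x := by
  simpa only [neg_div, ← sub_eq_add_neg] using hf.add (hg.const_div (-c))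

theorem normalForm (hf : IsRational f) (hm : Meromorphic f) : IsRational (normalForm f) := by
  obtain ⟨P, Q, hQ, h⟩ := hf
  refine ⟨P, Q, hQ, fun x hx => ?_⟩
  rw [← h x hx]
  refine normalForm_eq_of_analyticAt hm ?_
  have h1 : AnalyticAt ℂ (fun z => P.eval z / Q.eval z) x := by
    refine AnalyticAt.div ?_ ?_ hx
    · exact (Polynomial.differentiable P).analyticAt x
    · exact (Polynomial.differentiable Q).analyticAt x
  refine h1.congr ?_
  filter_upwards [Q.continuous.continuousAt.eventually_ne hx] with z hz
  rw [h z hz]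

end PainleveIV.IsRational

/-- All three functions of the triple are rational. -/
def Triple.AllRational (t : Triple) : Prop := IsRational t.u ∧ IsRational t.v ∧ IsRational t.w

theorem Triple.AllRational.orbit {t : Triple} (h : t.AllRational) (n m : ℕ) :
    (t.orbit n m).AllRational := by
  induction m with
  | zero =>
    induction n with
    | zero => exact h
    | succ n ih =>
      obtain ⟨hu, hv, hw⟩ := ih
      have h1 := hu.add (hv.const_div (2 + 2 * n))
      exact ⟨hv.sub_const_div _ h1, (hw.sub_const_div _ hv).add (h1.const_div _), h1⟩
  | succ m ih =>
    obtain ⟨hu, hv, hw⟩ := ih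
    have h1 := hw.sub_const_div (2 + 2 * m + 2 * n) hv
    exact ⟨h1, (hu.add (hv.const_div _)).sub_const_div _ h1, hv.add (h1.const_div _)⟩

theorem meromorphicAt_polynomial_inv (P : Polynomial ℂ) :
    MeromorphicAt (fun z : ℂ => P.eval z⁻¹) 0 := by
  induction P using Polynomial.induction_on' with
  | add p q hp hq => simpa only [Polynomial.eval_add] using hp.fun_add hq
  | monomial n a =>
    simp only [Polynomial.eval_monomial]
    fun_prop

theorem closedSector_neBot {lo hi : ℝ} (h : lo ≤ hi) : (closedSector lo hi).NeBot := by
  have : (𝓟 (Set.Icc lo hi)).NeBot := principal_neBot_iff.2 (Set.nonempty_Icc.2 h)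
  exact Filter.map_neBot

theorem tendsto_norm_openSector (lo hi : ℝ) :
    Tendsto (fun x : ℂ => ‖x‖) (openSector lo hi) atTop :=
  tendsto_atTop.2 fun C => eventually_norm_ge lo hi C

theorem closedSector_le_openSector {lo hi δ : ℝ} (hδ : 0 < δ) :
    closedSector (lo + δ) (hi - δ) ≤ openSector lo hi :=
  le_iSup (fun δ : Set.Ioi (0 : ℝ) => closedSector (lo + δ) (hi - δ)) ⟨δ, hδ⟩

theorem SectorLim.unique {lo hi : ℝ} {f : ℂ → ℂ} {c d : ℂ} (hc : SectorLim lo hi f c)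
    (hd : SectorLim lo hi f d) (h : lo < hi) : c = d := by
  have hδ : 0 < (hi - lo) / 2 := by linarith
  have := closedSector_neBot (lo := lo + (hi - lo) / 2) (hi := hi - (hi - lo) / 2) (by linarith)
  exact tendsto_nhds_unique (hc.tendsto hδ) (hd.tendsto hδ)

theorem SectorLim.zpow_neg_one_mul {lo hi : ℝ} {f : ℂ → ℂ} {c : ℂ}
    (h : SectorLim lo hi (fun x => x ^ (1 : ℤ) * f x) c) :
    SectorLim lo hi (fun x => x ^ (-1 : ℤ) * f x) 0 := by
  refine (SectorLim.of_sectorO ((h.bounded.zpow_mul (-2)).mono (by norm_num))).congr ?_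
  filter_upwards [eventually_ne_zero lo hi] with x hx
  rw [← mul_assoc, ← zpow_add₀ hx]
  norm_num

/-- A rational function has the same asymptotics in all sectors, being meromorphic at infinity. -/
theorem PainleveIV.IsRational.sectorLim_unique {f : ℂ → ℂ} (hf : IsRational f) {k : ℤ}
    {lo hi lo' hi' : ℝ} {c d : ℂ} (hc : SectorLim lo hi (fun x => x ^ k * f x) c)
    (hd : SectorLim lo' hi' (fun x => x ^ k * f x) d) (h : lo < hi) (h' : lo' < hi') : c = d := by
  obtain ⟨P, Q, hQ, hPQ⟩ := hf
  set g : ℂ → ℂ := fun z => z⁻¹ ^ k * (P.eval z⁻¹ / Q.eval z⁻¹) with hg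
  have hmero : MeromorphicAt g 0 := by
    have h1 := meromorphicAt_polynomial_inv P
    have h2 := meromorphicAt_polynomial_inv Q
    fun_prop
  -- along a sector, `g (x⁻¹)` has the limit in question
  have key : ∀ {lo hi : ℝ} {c : ℂ}, SectorLim lo hi (fun x => x ^ k * f x) c → lo < hi →
      ∃ l : Filter ℂ, l.NeBot ∧ l ≤ 𝓝[≠] 0 ∧ Tendsto g l (𝓝 c) := by
    intro lo hi c hc h
    have hδ : 0 < (hi - lo) / 2 := by linarith
    have hne := closedSector_neBot (lo := lo + (hi - lo) / 2) (hi := hi - (hi - lo) / 2)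
      (by linarith)
    set l := closedSector (lo + (hi - lo) / 2) (hi - (hi - lo) / 2)
    have hl : l ≤ Bornology.cobounded ℂ := by
      rw [← tendsto_id', ← tendsto_norm_atTop_iff_cobounded]
      exact (tendsto_norm_openSector lo hi).mono_left (closedSector_le_openSector hδ)
    refine ⟨map (fun x => x⁻¹) l, hne.map _, tendsto_inv₀_cobounded'.mono_left hl, ?_⟩
    rw [tendsto_map'_iff]
    refine (hc.tendsto hδ).congr' ?_
    have hroots : ∀ᶠ x in Bornology.cobounded ℂ, Q.eval x ≠ 0 := by
      have : Bornology.IsBounded {x | Q.IsRoot x} :=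
        (Polynomial.finite_setOfPred_isRoot hQ).isBounded
      filter_upwards [Bornology.isBounded_def.1 this] with x hx
      exact hx
    filter_upwards [hl hroots] with x hx
    rw [Function.comp_apply, hg]
    simp only [inv_inv]
    rw [hPQ x hx]
  obtain ⟨l, hl, hl0, hlim⟩ := key hc h
  obtain ⟨l', hl', hl0', hlim'⟩ := key hd h'
  rcases lt_or_ge (meromorphicOrderAt g 0) 0 with ho | ho
  · have h1 := (tendsto_cobounded_of_meromorphicOrderAt_neg ho).mono_left hl0
    exact absurd hlim.norm (not_tendsto_nhds_of_tendsto_atTop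
      (tendsto_norm_atTop_iff_cobounded.2 h1) _)
  · obtain ⟨e, he⟩ := tendsto_nhds_of_meromorphicOrderAt_nonneg hmero ho
    rw [tendsto_nhds_unique hlim (he.mono_left hl0), tendsto_nhds_unique hlim' (he.mono_left hl0')]

/-! ### The seeds of the two families -/

/-- The seed of the first family: a solution of the symmetric form with `w = 0`. -/
noncomputable def seedOne (κ A B : ℂ) : Triple :=
  ⟨seedFun 1 κ A B, fun x => -2 * x - seedFun 1 κ A B x, fun _ => 0⟩

/-- The seed of the second family: a solution of the symmetric form with `u = 0`. -/
noncomputable def seedTwo (κ A B : ℂ) : Triple :=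
  ⟨fun _ => 0, fun x => -2 * x - seedFun (-1) κ A B x, seedFun (-1) κ A B⟩

namespace Triple

variable {lo hi ψ : ℝ} {κ A B A' B' : ℂ}

theorem seedOne_neg (κ A B : ℂ) : seedOne (-κ) (A + B * sqrtPi) (-B) = seedOne κ A B := by
  simp only [seedOne, seedFun_neg]

theorem seedTwo_neg (κ A B : ℂ) : seedTwo (-κ) (A + B * sqrtPi) (-B) = seedTwo κ A B := by
  simp only [seedTwo, seedFun_neg]

theorem seedFun_B_zero (ε κ A : ℂ) : seedFun ε κ A 0 = fun _ => 0 := by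
  ext x
  simp [seedFun]

theorem seedOne_eq_seedTwo (κ κ' A A' : ℂ) : seedOne κ A 0 = seedTwo κ' A' 0 := by
  simp only [seedOne, seedTwo, seedFun_B_zero]

theorem seedOne_B_zero (κ A A' : ℂ) : seedOne κ A 0 = seedOne κ A' 0 := by
  rw [seedOne_eq_seedTwo κ κ A A, seedOne_eq_seedTwo κ κ A' A]

theorem seedFun_congr (ε κ : ℂ) (hB : B ≠ 0) (hB' : B' ≠ 0) (h : A / B = A' / B') :
    seedFun ε κ A B = seedFun ε κ A' B' := by
  ext x
  have e1 : seedDenom κ A B x = B * (A / B + errIntegral (κ * x)) := by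
    rw [seedDenom]
    field_simp
  have e2 : seedDenom κ A' B' x = B' * (A / B + errIntegral (κ * x)) := by
    rw [h, seedDenom]
    field_simp
  rw [seedFun, seedFun, e1, e2]
  generalize A / B + errIntegral (κ * x) = d
  rcases eq_or_ne d 0 with rfl | hd
  · simp
  · field_simp

theorem seedOne_congr (κ : ℂ) (hB : B ≠ 0) (hB' : B' ≠ 0) (h : A / B = A' / B') :
    seedOne κ A B = seedOne κ A' B' := by
  simp only [seedOne, seedFun_congr _ _ hB hB' h]

theorem seedTwo_congr (κ : ℂ) (hB : B ≠ 0) (hB' : B' ≠ 0) (h : A / B = A' / B') :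
    seedTwo κ A B = seedTwo κ A' B' := by
  simp only [seedTwo, seedFun_congr _ _ hB hB' h]

theorem solves_seedOne (hκ : κ ^ 2 = 1) (hAB : A ≠ 0 ∨ B ≠ 0) : (seedOne κ A B).Solves 0 0 :=
  (symSystem_seed hκ (one_pow 2) hAB).cast (by simp) (by simp) (by simp) (fun _ => rfl)
    (fun _ => rfl) (fun _ => rfl)

theorem solves_seedTwo (hκ : κ ^ 2 = -1) (hAB : A ≠ 0 ∨ B ≠ 0) : (seedTwo κ A B).Solves 0 0 := by
  have h := (symSystem_seed hκ (by norm_num) hAB).reverse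
  rw [neg_neg] at h
  exact h.cast (by simp) (by simp) (by simp) (fun _ => rfl) (fun _ => rfl) (fun _ => rfl)

theorem isClassical_seedOne (hκ : κ ^ 2 = 1) (hAB : A ≠ 0 ∨ B ≠ 0) :
    IsClassical (1 / 2) 0 (seedOne κ A B).solution := by
  refine IsClassical.riccati _ _ (-1) 0 _ (by norm_num) (by norm_num) (by norm_num)
    (normalForm_meromorphicNFOn _) fun x hx => ?_
  have h := (solves_seedOne hκ hAB).rotate.rotate
  rw [solution] at hx ⊢
  simpa using h.deriv_eq_riccati (Eventually.of_forall fun _ => rfl) hx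

theorem isClassical_seedTwo (κ A B : ℂ) : IsClassical (1 / 2) 0 (seedTwo κ A B).solution := by
  have h : (seedTwo κ A B).solution = fun _ => 0 :=
    normalForm_eq_zero (Meromorphic.const 0) (Eventually.of_forall fun _ => rfl)
  rw [h]
  exact IsClassical.trivial _

theorem pairVPos_seedOne (hκ : κ = Complex.exp (ψ * Complex.I)) (hε : κ ^ 2 = 1)
    (hA : A ≠ 0) (hA' : A' ≠ 0) :
    PairVPos (-(Real.pi / 4) - ψ) (Real.pi / 4 - ψ) 0 0 (-(κ * (B / A - B' / A'))) 0
      (seedOne κ A B) (seedOne κ A' B') :=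
  (expPair_seed_small hκ hε (one_pow 2) hA hA').cast (by simp) (by simp) (by simp) (by ring) rfl
    (fun _ => rfl) (fun _ => rfl) (fun _ => rfl) (fun _ => rfl) (fun _ => rfl) (fun _ => rfl)

theorem pairVNeg_seedTwo (hκ : κ = Complex.exp (ψ * Complex.I)) (hε : κ ^ 2 = -1)
    (hA : A ≠ 0) (hA' : A' ≠ 0) :
    PairVNeg (-(Real.pi / 4) - ψ) (Real.pi / 4 - ψ) 0 0 (κ * (B / A - B' / A')) 0
      (seedTwo κ A B) (seedTwo κ A' B') :=
  (expPair_seed_small hκ hε (by norm_num) hA hA').cast (by simp) (by simp) (by simp) (by ring) rfl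
    (fun _ => rfl) (fun _ => rfl) (fun _ => rfl) (fun _ => rfl) (fun _ => rfl) (fun _ => rfl)

theorem pairUNeg_seedOne (hε : κ ^ 2 = 1) (hB : B ≠ 0) (hB' : B' ≠ 0)
    (hG : SectorLim lo hi (scaledDenom 1 κ A B) B)
    (hG' : SectorLim lo hi (scaledDenom 1 κ A' B') B') :
    PairUNeg lo hi 0 0 (4 * κ * (A' / B' - A / B)) 2 (seedOne κ A B) (seedOne κ A' B') :=
  (expPair_seed_large hε (one_pow 2) hB hB' hG hG').cast (by simp) (by simp) (by simp) rfl rfl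
    (fun _ => rfl) (fun _ => rfl) (fun _ => rfl) (fun _ => rfl) (fun _ => rfl) (fun _ => rfl)

theorem pairWPos_seedTwo (hε : κ ^ 2 = -1) (hB : B ≠ 0) (hB' : B' ≠ 0)
    (hG : SectorLim lo hi (scaledDenom (-1) κ A B) B)
    (hG' : SectorLim lo hi (scaledDenom (-1) κ A' B') B') :
    PairWPos lo hi 0 0 (4 * κ * (A' / B' - A / B)) 2 (seedTwo κ A B) (seedTwo κ A' B') := by
  have h := expPair_seed_large hε (by norm_num) hB hB' hG hG'
  rw [neg_neg] at h
  exact h.cast (by simp) (by simp) (by simp) rfl rfl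
    (fun _ => rfl) (fun _ => rfl) (fun _ => rfl) (fun _ => rfl) (fun _ => rfl) (fun _ => rfl)

/-- The seed `(0, -2 x, 0)`, which the two families share, has its asymptotics in all
directions. -/
theorem pairVPos_seedOne_B_zero (lo hi : ℝ) (hε : κ ^ 2 = 1) :
    PairVPos lo hi 0 0 0 0 (seedOne κ 1 0) (seedOne κ 1 0) := by
  have h1 := solves_seedOne (B := 0) hε (Or.inl one_ne_zero)
  have h2 : MiddleLarge lo hi (seedOne κ 1 0).u (seedOne κ 1 0).v (seedOne κ 1 0).w := by
    simp only [seedOne, seedFun_B_zero, sub_zero]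
    exact ⟨Eventually.of_forall fun x => ⟨by fun_prop, by fun_prop, by fun_prop⟩,
      SectorO.zero _ _ _, SectorO.zero _ _ _⟩
  refine ⟨h1, h1, h2, h2, ?_, ?_⟩
  · simpa using SectorLim.const lo hi 0
  · simpa using SectorO.zero lo hi 0

/-! ### Members of the two families -/

/-- The member of the first family with the seed `seedOne 1 A B`. It depends on `A / B` only. -/
noncomputable def memberOne (n m : ℕ) (A B : ℂ) : ℂ → ℂ := ((seedOne 1 A B).orbit n m).solution

/-- The member of the second family with the seed `seedTwo (-I) A B`. It depends on `A / B`
only. -/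
noncomputable def memberTwo (n m : ℕ) (A B : ℂ) : ℂ → ℂ :=
  ((seedTwo (-Complex.I) A B).orbit n m).solution

theorem sqrtPi_ne_zero : sqrtPi ≠ 0 := by
  rw [sqrtPi, Complex.ofReal_ne_zero]
  exact (Real.sqrt_pos.2 Real.pi_pos).ne'

theorem neg_I_sq : (-Complex.I) ^ 2 = -1 := by rw [neg_sq, Complex.I_sq]

theorem one_eq_exp_zero : (1 : ℂ) = Complex.exp ((0 : ℝ) * Complex.I) := by simp

theorem one_eq_exp_neg_two_pi : (1 : ℂ) = Complex.exp ((-(2 * Real.pi) : ℝ) * Complex.I) := by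
  push_cast
  rw [neg_mul, Complex.exp_neg, Complex.exp_two_pi_mul_I, inv_one]

theorem neg_one_eq_exp_neg_pi : (-1 : ℂ) = Complex.exp ((-Real.pi : ℝ) * Complex.I) := by
  push_cast
  rw [neg_mul, Complex.exp_neg, Complex.exp_pi_mul_I]
  norm_num

theorem neg_I_eq_exp : -Complex.I = Complex.exp ((-(Real.pi / 2) : ℝ) * Complex.I) := by
  push_cast
  rw [neg_mul, Complex.exp_neg, Complex.exp_pi_div_two_mul_I, Complex.inv_I]

theorem I_eq_exp : Complex.I = Complex.exp ((-(3 * Real.pi / 2) : ℝ) * Complex.I) := by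
  have h : ((-(3 * Real.pi / 2) : ℝ) : ℂ) * Complex.I =
      (-(Real.pi / 2) : ℝ) * Complex.I + (-Real.pi : ℝ) * Complex.I := by
    push_cast
    ring
  rw [h, Complex.exp_add, ← neg_I_eq_exp, ← neg_one_eq_exp_neg_pi]
  ring

variable {n m : ℕ}

theorem memberOne_B_zero (n m : ℕ) (A A' : ℂ) : memberOne n m A 0 = memberOne n m A' 0 := by
  rw [memberOne, seedOne_B_zero 1 A A', memberOne]

theorem memberTwo_B_zero (n m : ℕ) (A A' : ℂ) : memberTwo n m A 0 = memberOne n m A' 0 := by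
  rw [memberOne, seedOne_eq_seedTwo 1 (-Complex.I) A' A, memberTwo]

theorem memberOne_congr (n m : ℕ) (hB : B ≠ 0) (hB' : B' ≠ 0) (h : A / B = A' / B') :
    memberOne n m A B = memberOne n m A' B' := by
  rw [memberOne, seedOne_congr 1 hB hB' h, memberOne]

theorem memberTwo_congr (n m : ℕ) (hB : B ≠ 0) (hB' : B' ≠ 0) (h : A / B = A' / B') :
    memberTwo n m A B = memberTwo n m A' B' := by
  rw [memberTwo, seedTwo_congr _ hB hB' h, memberTwo]

theorem memberTwo_zero_eq_zero (n : ℕ) (hAB : A ≠ 0 ∨ B ≠ 0) :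
    memberTwo n 0 A B = fun _ => 0 := by
  have h := solves_seedTwo neg_I_sq hAB
  exact normalForm_eq_zero (h.orbit n 0).mero₁ (h.orbit_u_eq_zero (fun _ => rfl) n)

theorem isSolution_memberOne (hAB : A ≠ 0 ∨ B ≠ 0) {α β : ℂ} (hα : α = 1 / 2 + n)
    (hβ : β = -2 * m) : IsSolution (2 * α - β / 2) (β ^ 2) (memberOne n m A B) :=
  ((solves_seedOne (one_pow 2) hAB).orbit n m).isSolution hα hβ

theorem isSolution_memberTwo (hAB : A ≠ 0 ∨ B ≠ 0) {α β : ℂ} (hα : α = 1 / 2 + n)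
    (hβ : β = -2 * m) : IsSolution (2 * α - β / 2) (β ^ 2) (memberTwo n m A B) :=
  ((solves_seedTwo neg_I_sq hAB).orbit n m).isSolution hα hβ

theorem isClassical_memberOne (hAB : A ≠ 0 ∨ B ≠ 0) :
    IsClassical (1 / 2 + n) (-2 * m) (memberOne n m A B) :=
  (solves_seedOne (one_pow 2) hAB).isClassical_orbit (isClassical_seedOne (one_pow 2) hAB) n m

theorem isClassical_memberTwo (hAB : A ≠ 0 ∨ B ≠ 0) :
    IsClassical (1 / 2 + n) (-2 * m) (memberTwo n m A B) :=
  (solves_seedTwo neg_I_sq hAB).isClassical_orbit (isClassical_seedTwo _ A B) n m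

theorem isRational_memberOne_B_zero (n m : ℕ) : IsRational (memberOne n m 1 0) := by
  have h : (seedOne 1 1 0).AllRational := by
    simp only [AllRational, seedOne, seedFun_B_zero, sub_zero]
    exact ⟨.zero, .const_mul_id (-2), .zero⟩
  exact (h.orbit n m).1.normalForm
    ((solves_seedOne (one_pow 2) (Or.inl one_ne_zero)).orbit n m).mero₁

end Triple

/-! ### Members of the families and the backgrounds -/

namespace Triple

variable {lo hi : ℝ} {A B A' B' : ℂ} {n m : ℕ}

theorem const₁_eq (n m : ℕ) :
    const₁ n m = 2 * ((-1) ^ m * (2 ^ n / 2 ^ m) * (m.factorial / n.factorial)) := by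
  rw [const₁, zpow_add₀ two_ne_zero, zpow_sub₀ two_ne_zero, zpow_natCast, zpow_natCast, zpow_one]
  ring

theorem const₁_ne_zero (n m : ℕ) : const₁ n m ≠ 0 := by
  simp [const₁_eq, Nat.factorial_ne_zero]

theorem const₂_ne_zero (n m : ℕ) : const₂ n m ≠ 0 := by
  simp [const₂, Nat.factorial_ne_zero]

theorem const₃_ne_zero (n : ℕ) (hm : m ≠ 0) : const₃ n m ≠ 0 := by
  simp [const₃, invFactPred, Nat.factorial_ne_zero, hm]

theorem const₄_eq (n m : ℕ) : const₄ n m =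
    m / 2 * ((-1) ^ m * (2 ^ m / 2 ^ n) * (n.factorial / m.factorial)) := by
  rw [const₄, invFactPred, zpow_sub₀ two_ne_zero, zpow_sub₀ two_ne_zero, zpow_natCast,
    zpow_natCast, zpow_one]
  ring

theorem const₄_ne_zero (n : ℕ) (hm : m ≠ 0) : const₄ n m ≠ 0 := by
  simp [const₄_eq, Nat.factorial_ne_zero, hm]

theorem pairVPos_right (n m : ℕ) (hA : A ≠ 0) :
    PairVPos (-(Real.pi / 4)) (Real.pi / 4) n m (-(B / A / 2) * const₁ n m) (2 * n - 2 * m)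
      ((seedOne 1 A B).orbit n m) ((seedOne 1 1 0).orbit n m) := by
  have h := (pairVPos_seedOne (B := B) (B' := 0) one_eq_exp_zero (one_pow 2) hA
    one_ne_zero).orbit n m
  convert h using 1
  · ring
  · ring
  · rw [const₁_eq]; ring
  · ring

theorem pairVPos_left (n m : ℕ) (hA : A + B * sqrtPi ≠ 0) :
    PairVPos (3 * Real.pi / 4) (5 * Real.pi / 4) n m
      (-(B / (A + B * sqrtPi) / 2) * const₁ n m) (2 * n - 2 * m)
      ((seedOne 1 A B).orbit n m) ((seedOne 1 1 0).orbit n m) := by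
  have h := (pairVPos_seedOne (B := -B) (A' := 1 + 0 * sqrtPi) (B' := -0) neg_one_eq_exp_neg_pi
    (by norm_num) hA (by simp)).orbit n m
  rw [seedOne_neg 1, seedOne_neg 1] at h
  convert h using 1
  · ring
  · ring
  · rw [const₁_eq]; ring
  · ring

theorem pairVNeg_upper (n m : ℕ) (hA : A ≠ 0) :
    PairVNeg (Real.pi / 4) (3 * Real.pi / 4) n m
      ((-1) ^ m * (2 ^ m / 2 ^ n) * (n.factorial / m.factorial) * (-Complex.I * (B / A)))
      (2 * m - 2 * n)
      ((seedTwo (-Complex.I) A B).orbit n m) ((seedTwo (-Complex.I) 1 0).orbit n m) := by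
  have h := (pairVNeg_seedTwo (B := B) (B' := 0) neg_I_eq_exp neg_I_sq hA
    one_ne_zero).orbit n m
  convert h using 1
  · ring
  · ring
  · ring
  · ring

theorem pairVNeg_lower (n m : ℕ) (hA : A + B * sqrtPi ≠ 0) :
    PairVNeg (5 * Real.pi / 4) (7 * Real.pi / 4) n m
      ((-1) ^ m * (2 ^ m / 2 ^ n) * (n.factorial / m.factorial) *
        (-Complex.I * (B / (A + B * sqrtPi)))) (2 * m - 2 * n)
      ((seedTwo (-Complex.I) A B).orbit n m) ((seedTwo (-Complex.I) 1 0).orbit n m) := by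
  have h := (pairVNeg_seedTwo (B := -B) (A' := 1 + 0 * sqrtPi) (B' := -0) I_eq_exp
    Complex.I_sq hA (by simp)).orbit n m
  have e (A B : ℂ) := seedTwo_neg (-Complex.I) A B
  simp only [neg_neg] at e
  rw [e, e] at h
  convert h using 1
  · ring
  · ring
  · ring
  · ring

theorem scaledDenom_upper (A B : ℂ) :
    SectorLim (Real.pi / 4) (3 * Real.pi / 4) (scaledDenom 1 1 A B) B := by
  have hpi := Real.pi_pos
  have h := exp_large_upper one_eq_exp_zero (one_pow 2)
  rw [sub_zero, sub_zero] at h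
  exact scaledDenom_lim one_eq_exp_zero (one_pow 2) (by linarith) (by linarith) h A B

theorem scaledDenom_lower (A B : ℂ) :
    SectorLim (5 * Real.pi / 4) (7 * Real.pi / 4) (scaledDenom 1 1 A B) B := by
  have hpi := Real.pi_pos
  have h := exp_large_lower one_eq_exp_neg_two_pi (one_pow 2)
  exact scaledDenom_lim one_eq_exp_neg_two_pi (one_pow 2) (by linarith) (by linarith)
    (h.subsector (by linarith) (by linarith)) A B

theorem scaledDenom_right (A B : ℂ) :
    SectorLim (-(Real.pi / 4)) (Real.pi / 4) (scaledDenom (-1) (-Complex.I) A B) B := by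
  have hpi := Real.pi_pos
  have h := exp_large_lower neg_I_eq_exp neg_I_sq
  exact scaledDenom_lim neg_I_eq_exp neg_I_sq (by linarith) (by linarith)
    (h.subsector (by linarith) (by linarith)) A B

theorem scaledDenom_left (A B : ℂ) :
    SectorLim (3 * Real.pi / 4) (5 * Real.pi / 4) (scaledDenom (-1) (-Complex.I) A B) B := by
  have hpi := Real.pi_pos
  have h := exp_large_upper neg_I_eq_exp neg_I_sq
  exact scaledDenom_lim neg_I_eq_exp neg_I_sq (by linarith) (by linarith)
    (h.subsector (by linarith) (by linarith)) A B

theorem pairUNeg_member (n m : ℕ) (hB : B ≠ 0) (hB' : B' ≠ 0)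
    (hG : SectorLim lo hi (scaledDenom 1 1 A B) B)
    (hG' : SectorLim lo hi (scaledDenom 1 1 A' B') B') :
    PairUNeg lo hi n m (-(2 * (A / B - A' / B') * const₂ n m)) (4 * n + 2 * m + 2)
      ((seedOne 1 A B).orbit n m) ((seedOne 1 A' B').orbit n m) := by
  have h := (pairUNeg_seedOne (one_pow 2) hB hB' hG hG').orbit n m
  convert h using 1
  · rw [const₂]; ring
  · ring

/-- The difference of two members of the first family where both are `-2 x + O(1 / x)`. -/
theorem diff_memberOne (n m : ℕ) (hB : B ≠ 0) (hB' : B' ≠ 0)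
    (hG : SectorLim lo hi (scaledDenom 1 1 A B) B)
    (hG' : SectorLim lo hi (scaledDenom 1 1 A' B') B') :
    SectorLim lo hi (fun x => (memberOne n m A B x - memberOne n m A' B' x) /
      ampPlus (4 * n + 2 * m + 2) x) (2 * (A / B - A' / B') * const₂ n m) :=
  (pairUNeg_member n m hB hB' hG hG').diff.cast (by ring)

theorem pairWPos_member (n m : ℕ) (hB : B ≠ 0) (hB' : B' ≠ 0)
    (hG : SectorLim lo hi (scaledDenom (-1) (-Complex.I) A B) B)
    (hG' : SectorLim lo hi (scaledDenom (-1) (-Complex.I) A' B') B') :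
    PairWPos lo hi n m (2 ^ (n + 2 * m) / (m.factorial * (n + m).factorial) *
      (4 * Complex.I * (A / B - A' / B'))) (2 * n + 4 * m + 2)
      ((seedTwo (-Complex.I) A B).orbit n m) ((seedTwo (-Complex.I) A' B').orbit n m) := by
  have h := (pairWPos_seedTwo neg_I_sq hB hB' hG hG').orbit n m
  convert h using 1
  · ring
  · ring

/-- The difference of two members of the second family where both behave like `β / (2 x)`. -/
theorem diff_memberTwo (n m : ℕ) (hB : B ≠ 0) (hB' : B' ≠ 0)
    (hG : SectorLim lo hi (scaledDenom (-1) (-Complex.I) A B) B)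
    (hG' : SectorLim lo hi (scaledDenom (-1) (-Complex.I) A' B') B') :
    SectorLim lo hi (fun x => (memberTwo n m A B x - memberTwo n m A' B' x) /
      ampMinus (2 * n + 4 * m) x) (Complex.I * (A / B - A' / B') * const₃ n m) := by
  have h := (pairWPos_member n m hB hB' hG hG').diff
  rw [add_sub_cancel_right] at h
  refine h.cast ?_
  rw [const₃, invFactPred]
  have := Nat.cast_ne_zero (R := ℂ).2 m.factorial_ne_zero
  have := Nat.cast_ne_zero (R := ℂ).2 (n + m).factorial_ne_zero
  field_simp
  ring

theorem diff_memberTwo_upper (n m : ℕ) (hA : A ≠ 0) :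
    SectorLim (Real.pi / 4) (3 * Real.pi / 4)
      (fun x => (memberTwo n m A B x - memberOne n m 1 0 x) / ampPlus (2 * m - 2 * n - 2) x)
      (Complex.I * (B / A) * const₄ n m) := by
  rw [← memberTwo_B_zero n m 1]
  refine (pairVNeg_upper n m hA).diff.cast ?_
  rw [const₄_eq]
  ring

theorem diff_memberTwo_lower (n m : ℕ) (hA : A + B * sqrtPi ≠ 0) :
    SectorLim (5 * Real.pi / 4) (7 * Real.pi / 4)
      (fun x => (memberTwo n m A B x - memberOne n m 1 0 x) / ampPlus (2 * m - 2 * n - 2) x)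
      (Complex.I * (B / (A + B * sqrtPi)) * const₄ n m) := by
  rw [← memberTwo_B_zero n m 1]
  refine (pairVNeg_lower n m hA).diff.cast ?_
  rw [const₄_eq]
  ring

/-! ### Backgrounds -/

theorem memberOne_lim (n m : ℕ) (hB : B ≠ 0) (hG : SectorLim lo hi (scaledDenom 1 1 A B) B) :
    SectorLim lo hi (fun x => x ^ (-1 : ℤ) * memberOne n m A B x) (-2) :=
  (pairUNeg_member n m hB hB hG hG).lim

theorem memberTwo_lim (n m : ℕ) (hB : B ≠ 0)
    (hG : SectorLim lo hi (scaledDenom (-1) (-Complex.I) A B) B) :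
    SectorLim lo hi (fun x => x ^ (1 : ℤ) * memberTwo n m A B x) (-m) :=
  (pairWPos_member n m hB hB hG hG).lim

theorem memberOne_one_zero_lim (n m : ℕ) (lo hi : ℝ) :
    SectorLim lo hi (fun x => x ^ (1 : ℤ) * memberOne n m 1 0 x) m :=
  ((pairVPos_seedOne_B_zero lo hi (one_pow 2)).orbit n m).lim

variable {α β : ℂ}

theorem powerAsymp_memberOne_one_zero (n : ℕ) (hβ : β = -2 * m) (lo hi : ℝ) :
    PowerAsymp (memberOne n m 1 0) (leadMinus β) lo hi := by
  refine powerAsymp_leadMinus hβ (memberOne_one_zero_lim n m lo hi) ?_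
  rintro rfl
  rw [← memberTwo_B_zero n 0 1, memberTwo_zero_eq_zero n (Or.inl one_ne_zero)]

theorem powerAsymp_memberOne_zero_one (n m : ℕ) :
    PowerAsymp (memberOne n m 0 1) leadLin (-(3 * Real.pi / 4)) (3 * Real.pi / 4) := by
  have h := scaledDenom_lim_of_zero one_eq_exp_zero (one_pow 2) 1
  rw [sub_zero, sub_zero] at h
  exact powerAsymp_leadLin (memberOne_lim n m one_ne_zero h)

theorem powerAsymp_memberOne_sqrtPi (n m : ℕ) :
    PowerAsymp (memberOne n m sqrtPi (-1)) leadLin (Real.pi / 4) (7 * Real.pi / 4) := by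
  have h := scaledDenom_lim_of_zero neg_one_eq_exp_neg_pi (by norm_num : (-1 : ℂ) ^ 2 = 1) 1
  have h1 := (pairUNeg_seedOne (by norm_num) one_ne_zero one_ne_zero h h).orbit n m
  have e : seedOne (-1) 0 1 = seedOne 1 sqrtPi (-1) := by
    rw [← seedOne_neg 1]
    congr 1 <;> ring
  rw [e] at h1
  exact powerAsymp_leadLin (h1.lim.subsector (by linarith) (by linarith))

theorem powerAsymp_memberTwo_zero_one (n : ℕ) (hβ : β = -2 * m) :
    PowerAsymp (memberTwo n m 0 1) (leadPlus β) (-(Real.pi / 4)) (5 * Real.pi / 4) := by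
  have h := scaledDenom_lim_of_zero neg_I_eq_exp neg_I_sq 1
  refine powerAsymp_leadPlus hβ (memberTwo_lim n m one_ne_zero
    (h.subsector (by linarith) (by linarith))) ?_
  rintro rfl
  exact memberTwo_zero_eq_zero n (Or.inr one_ne_zero)

theorem powerAsymp_memberTwo_sqrtPi (n : ℕ) (hβ : β = -2 * m) :
    PowerAsymp (memberTwo n m sqrtPi (-1)) (leadPlus β) (3 * Real.pi / 4) (9 * Real.pi / 4) := by
  have h := scaledDenom_lim_of_zero I_eq_exp Complex.I_sq 1
  have h1 := (pairWPos_seedTwo Complex.I_sq one_ne_zero one_ne_zero h h).orbit n m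
  have e : seedTwo Complex.I 0 1 = seedTwo (-Complex.I) sqrtPi (-1) := by
    rw [← seedTwo_neg (-Complex.I), neg_neg]
    congr 1 <;> ring
  rw [e] at h1
  refine powerAsymp_leadPlus hβ (h1.lim.subsector (by linarith) (by linarith)) ?_
  rintro rfl
  exact memberTwo_zero_eq_zero n (Or.inl sqrtPi_ne_zero)

/-- The background with the leading term `-2 x` in the `j`-th quadrant. -/
noncomputable def backgroundLin (n m : ℕ) (j : ℤ) : ℂ → ℂ :=
  if j % 4 ≤ 1 then memberOne n m 0 1 else memberOne n m sqrtPi (-1)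

/-- The background with the leading term `β / (2 x)` in the `j`-th quadrant. -/
noncomputable def backgroundPlus (n m : ℕ) (j : ℤ) : ℂ → ℂ :=
  if j % 4 = 1 ∨ j % 4 = 2 then memberTwo n m 0 1 else memberTwo n m sqrtPi (-1)

theorem isBackground_lin (hα : α = 1 / 2 + n) (hβ : β = -2 * m) (j : ℤ) :
    IsBackground (2 * α - β / 2) (β ^ 2) leadLin j (backgroundLin n m j) := by
  have hpi := Real.pi_pos
  have hj : (j : ℝ) = (j % 4 : ℤ) + 4 * (j / 4 : ℤ) := by
    exact_mod_cast (Int.emod_add_mul_ediv j 4).symm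
  rw [backgroundLin]
  split_ifs with h
  · refine ⟨isSolution_memberOne (Or.inr one_ne_zero) hα hβ,
      ((powerAsymp_memberOne_zero_one n m).shift (j / 4)).subsector ?_ ?_⟩
    all_goals
      rw [hj]
      obtain h | h : j % 4 = 0 ∨ j % 4 = 1 := by omega
      all_goals rw [h]; push_cast; linarith
  · refine ⟨isSolution_memberOne (Or.inl sqrtPi_ne_zero) hα hβ,
      ((powerAsymp_memberOne_sqrtPi n m).shift (j / 4)).subsector ?_ ?_⟩
    all_goals
      rw [hj]
      obtain h | h : j % 4 = 2 ∨ j % 4 = 3 := by omega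
      all_goals rw [h]; push_cast; linarith

theorem isBackground_minus (hα : α = 1 / 2 + n) (hβ : β = -2 * m) (j : ℤ) :
    IsBackground (2 * α - β / 2) (β ^ 2) (leadMinus β) j (memberOne n m 1 0) :=
  ⟨isSolution_memberOne (Or.inl one_ne_zero) hα hβ, powerAsymp_memberOne_one_zero n hβ _ _⟩

theorem isBackground_plus (hα : α = 1 / 2 + n) (hβ : β = -2 * m) (j : ℤ) :
    IsBackground (2 * α - β / 2) (β ^ 2) (leadPlus β) j (backgroundPlus n m j) := by
  have hpi := Real.pi_pos
  have hj : (j : ℝ) = (j % 4 : ℤ) + 4 * (j / 4 : ℤ) := by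
    exact_mod_cast (Int.emod_add_mul_ediv j 4).symm
  rw [backgroundPlus]
  split_ifs with h
  · refine ⟨isSolution_memberTwo (Or.inr one_ne_zero) hα hβ,
      ((powerAsymp_memberTwo_zero_one n hβ).shift (j / 4)).subsector ?_ ?_⟩
    all_goals
      rw [hj]
      rcases h with h | h
      all_goals rw [h]; push_cast; linarith
  · refine ⟨isSolution_memberTwo (Or.inl sqrtPi_ne_zero) hα hβ, ?_⟩
    obtain h | h : j % 4 = 0 ∨ j % 4 = 3 := by omega
    -- the quadrant `j = 4 k` is the fourth one of the previous turn
    · refine ((powerAsymp_memberTwo_sqrtPi n hβ).shift (j / 4 - 1)).subsector ?_ ?_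
      all_goals rw [hj, h]; push_cast; linarith
    · refine ((powerAsymp_memberTwo_sqrtPi n hβ).shift (j / 4)).subsector ?_ ?_
      all_goals rw [hj, h]; push_cast; linarith

end Triple

/-! ### The exponential terms -/

namespace Triple

variable {A B α β : ℂ} {n m : ℕ} {μ : ℝ → ℂ}

theorem expAsymp_memberOne_right (hβ : β = -2 * m) (hA : A ≠ 0)
    (hμ : ∀ φ, μ φ = -(B / A / 2) * const₁ n m) :
    ExpAsymp (memberOne n m A B) (leadMinus β) (fun _ => memberOne n m 1 0) 0
      (ampMinus (2 * n - 2 * m)) μ := by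
  have hb := powerAsymp_memberOne_one_zero n hβ (-(Real.pi / 4)) (Real.pi / 4)
  have hl := (pairVPos_right (B := B) n m hA).diff
  have h0 : -(B / A / 2) * const₁ n m = 0 → memberOne n m A B = memberOne n m 1 0 := fun h => by
    obtain rfl : B = 0 := by simpa [hA, const₁_ne_zero] using h
    exact memberOne_B_zero n m A 1
  refine expAsymp_of_lims (by simp) (by simp) hb hb hl h0 hl h0 (ampMinus_ne_zero _) fun φ => ?_
  rw [hμ]
  ring

theorem expAsymp_memberOne_left (hβ : β = -2 * m) (hA : A + B * sqrtPi ≠ 0)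
    (hμ : ∀ φ, μ φ = -(B / (A + B * sqrtPi) / 2) * const₁ n m) :
    ExpAsymp (memberOne n m A B) (leadMinus β) (fun _ => memberOne n m 1 0) 2
      (ampMinus (2 * n - 2 * m)) μ := by
  have hb := powerAsymp_memberOne_one_zero n hβ (3 * Real.pi / 4) (5 * Real.pi / 4)
  have hl := (pairVPos_left n m hA).diff
  have h0 : -(B / (A + B * sqrtPi) / 2) * const₁ n m = 0 →
      memberOne n m A B = memberOne n m 1 0 := fun h => by
    obtain rfl : B = 0 := by simpa [hA, const₁_ne_zero] using h
    exact memberOne_B_zero n m A 1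
  refine expAsymp_of_lims (by push_cast; ring) (by push_cast; ring) hb hb hl h0 hl h0
    (ampMinus_ne_zero _) fun φ => ?_
  rw [hμ]
  ring

/-- If the multiple of the exponential vanishes, the member is the background itself. -/
theorem memberOne_eq_of_diff_eq_zero {A' B' : ℂ} (hB : B ≠ 0) (hB' : B' ≠ 0)
    (h : 2 * (A / B - A' / B') * const₂ n m = 0) : memberOne n m A B = memberOne n m A' B' := by
  refine memberOne_congr n m hB hB' ?_
  simpa [const₂_ne_zero, sub_eq_zero] using h

/-- If the multiple of the exponential vanishes, the member is the background itself. -/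
theorem memberTwo_eq_of_diff_eq_zero {A' B' : ℂ} (hB : B ≠ 0) (hB' : B' ≠ 0)
    (h : Complex.I * (A / B - A' / B') * const₃ n m = 0) :
    memberTwo n m A B = memberTwo n m A' B' := by
  rcases eq_or_ne m 0 with rfl | hm
  · rw [memberTwo_zero_eq_zero n (Or.inr hB), memberTwo_zero_eq_zero n (Or.inr hB')]
  · refine memberTwo_congr n m hB hB' ?_
    simpa [const₃_ne_zero n hm, sub_eq_zero] using h

theorem expAsymp_memberOne_upper (hB : B ≠ 0)
    (hμ : ∀ φ, μ φ = (2 * (A / B) + 2 * sqrtPi * stepTheta (φ - Real.pi / 2)) * const₂ n m) :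
    ExpAsymp (memberOne n m A B) leadLin (backgroundLin n m) 1
      (ampPlus (4 * n + 2 * m + 2)) μ := by
  have hpi := Real.pi_pos
  refine expAsymp_of_lims (lo := Real.pi / 4) (hi := 3 * Real.pi / 4)
    (by push_cast; ring) (by push_cast; ring)
    ((powerAsymp_memberOne_zero_one n m).subsector (by linarith) (by linarith))
    ((powerAsymp_memberOne_sqrtPi n m).subsector (by linarith) (by linarith))
    (diff_memberOne n m hB one_ne_zero (scaledDenom_upper A B) (scaledDenom_upper 0 1))
    (memberOne_eq_of_diff_eq_zero hB one_ne_zero)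
    (diff_memberOne n m hB (neg_ne_zero.2 one_ne_zero) (scaledDenom_upper A B)
      (scaledDenom_upper sqrtPi (-1)))
    (memberOne_eq_of_diff_eq_zero hB (neg_ne_zero.2 one_ne_zero)) (ampPlus_ne_zero _) fun φ => ?_
  rw [hμ, Int.cast_one, mul_one]
  ring

theorem expAsymp_memberOne_lower (hB : B ≠ 0)
    (hμ : ∀ φ, μ φ = (2 * (A / B) + 2 * sqrtPi * stepTheta (3 * Real.pi / 2 - φ)) * const₂ n m) :
    ExpAsymp (memberOne n m A B) leadLin (backgroundLin n m) 3
      (ampPlus (4 * n + 2 * m + 2)) μ := by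
  have hpi := Real.pi_pos
  refine expAsymp_of_lims (lo := 5 * Real.pi / 4) (hi := 7 * Real.pi / 4)
    (by push_cast; ring) (by push_cast; ring)
    ((powerAsymp_memberOne_sqrtPi n m).subsector (by linarith) (by linarith))
    (((powerAsymp_memberOne_zero_one n m).shift 1).subsector
      (by push_cast; linarith) (by push_cast; linarith))
    (diff_memberOne n m hB (neg_ne_zero.2 one_ne_zero) (scaledDenom_lower A B)
      (scaledDenom_lower sqrtPi (-1)))
    (memberOne_eq_of_diff_eq_zero hB (neg_ne_zero.2 one_ne_zero))
    (diff_memberOne n m hB one_ne_zero (scaledDenom_lower A B) (scaledDenom_lower 0 1))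
    (memberOne_eq_of_diff_eq_zero hB one_ne_zero) (ampPlus_ne_zero _) fun φ => ?_
  rw [hμ, show 3 * Real.pi / 2 - φ = -(φ - Real.pi / 2 * (3 : ℤ)) by push_cast; ring, stepTheta_neg]
  ring

theorem expAsymp_memberTwo_right (hβ : β = -2 * m) (hB : B ≠ 0)
    (hμ : ∀ φ, μ φ = Complex.I * (A / B + sqrtPi * (1 - stepTheta φ)) * const₃ n m) :
    ExpAsymp (memberTwo n m A B) (leadPlus β) (backgroundPlus n m) 0
      (ampMinus (2 * n + 4 * m)) μ := by
  have hpi := Real.pi_pos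
  refine expAsymp_of_lims (lo := -(Real.pi / 4)) (hi := Real.pi / 4) (by simp) (by simp)
    (((powerAsymp_memberTwo_sqrtPi n hβ).shift (-1)).subsector
      (by push_cast; linarith) (by push_cast; linarith))
    ((powerAsymp_memberTwo_zero_one n hβ).subsector (by linarith) (by linarith))
    (diff_memberTwo n m hB (neg_ne_zero.2 one_ne_zero) (scaledDenom_right A B)
      (scaledDenom_right sqrtPi (-1)))
    (memberTwo_eq_of_diff_eq_zero hB (neg_ne_zero.2 one_ne_zero))
    (diff_memberTwo n m hB one_ne_zero (scaledDenom_right A B) (scaledDenom_right 0 1))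
    (memberTwo_eq_of_diff_eq_zero hB one_ne_zero) (ampMinus_ne_zero _) fun φ => ?_
  rw [hμ, Int.cast_zero, mul_zero, sub_zero]
  ring

theorem expAsymp_memberTwo_left (hβ : β = -2 * m) (hB : B ≠ 0)
    (hμ : ∀ φ, μ φ = Complex.I * (A / B + sqrtPi * (1 - stepTheta (Real.pi - φ))) * const₃ n m) :
    ExpAsymp (memberTwo n m A B) (leadPlus β) (backgroundPlus n m) 2
      (ampMinus (2 * n + 4 * m)) μ := by
  have hpi := Real.pi_pos
  refine expAsymp_of_lims (lo := 3 * Real.pi / 4) (hi := 5 * Real.pi / 4)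
    (by push_cast; ring) (by push_cast; ring)
    ((powerAsymp_memberTwo_zero_one n hβ).subsector (by linarith) (by linarith))
    ((powerAsymp_memberTwo_sqrtPi n hβ).subsector (by linarith) (by linarith))
    (diff_memberTwo n m hB one_ne_zero (scaledDenom_left A B) (scaledDenom_left 0 1))
    (memberTwo_eq_of_diff_eq_zero hB one_ne_zero)
    (diff_memberTwo n m hB (neg_ne_zero.2 one_ne_zero) (scaledDenom_left A B)
      (scaledDenom_left sqrtPi (-1)))
    (memberTwo_eq_of_diff_eq_zero hB (neg_ne_zero.2 one_ne_zero)) (ampMinus_ne_zero _) fun φ => ?_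
  rw [hμ, show Real.pi - φ = -(φ - Real.pi / 2 * (2 : ℤ)) by push_cast; ring, stepTheta_neg]
  ring

/-- If the multiple of the exponential vanishes, the member is the background itself. -/
theorem memberTwo_eq_of_amplitude_eq_zero {D : ℂ} (hD : D ≠ 0) (hAB : A ≠ 0 ∨ B ≠ 0)
    (h : Complex.I * (B / D) * const₄ n m = 0) : memberTwo n m A B = memberOne n m 1 0 := by
  rcases eq_or_ne m 0 with rfl | hm
  · rw [← memberTwo_B_zero n 0 1, memberTwo_zero_eq_zero n hAB,
      memberTwo_zero_eq_zero n (Or.inl one_ne_zero)]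
  · obtain rfl : B = 0 := by simpa [const₄_ne_zero n hm, hD] using h
    exact memberTwo_B_zero n m A 1

theorem expAsymp_memberTwo_upper (hβ : β = -2 * m) (hA : A ≠ 0)
    (hμ : ∀ φ, μ φ = Complex.I * (B / A) * const₄ n m) :
    ExpAsymp (memberTwo n m A B) (leadMinus β) (fun _ => memberOne n m 1 0) 1
      (ampPlus (2 * m - 2 * n - 2)) μ := by
  have hb := powerAsymp_memberOne_one_zero n hβ (Real.pi / 4) (3 * Real.pi / 4)
  have hl := diff_memberTwo_upper (B := B) n m hA
  have h0 := memberTwo_eq_of_amplitude_eq_zero (B := B) (n := n) (m := m) hA (Or.inl hA)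
  refine expAsymp_of_lims (by push_cast; ring) (by push_cast; ring) hb hb hl h0 hl h0
    (ampPlus_ne_zero _) fun φ => ?_
  rw [hμ]
  ring

theorem expAsymp_memberTwo_lower (hβ : β = -2 * m) (hA : A + B * sqrtPi ≠ 0)
    (hμ : ∀ φ, μ φ = Complex.I * (B / (A + B * sqrtPi)) * const₄ n m) :
    ExpAsymp (memberTwo n m A B) (leadMinus β) (fun _ => memberOne n m 1 0) 3
      (ampPlus (2 * m - 2 * n - 2)) μ := by
  have hb := powerAsymp_memberOne_one_zero n hβ (5 * Real.pi / 4) (7 * Real.pi / 4)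
  have hl := diff_memberTwo_lower n m hA
  have hAB : A ≠ 0 ∨ B ≠ 0 := by
    by_contra! h
    simp [h.1, h.2] at hA
  have h0 := memberTwo_eq_of_amplitude_eq_zero (n := n) (m := m) hA hAB
  refine expAsymp_of_lims (by push_cast; ring) (by push_cast; ring) hb hb hl h0 hl h0
    (ampPlus_ne_zero _) fun φ => ?_
  rw [hμ]
  ring

/-! ### The two families -/

/-- The first family; the parameter is `c = B / (2 A)`. -/
noncomputable def familyOne (n m : ℕ) (c : OnePoint ℂ) : ℂ → ℂ :=
  c.elim (memberOne n m 0 1) fun c => memberOne n m 1 (2 * c)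

/-- The second family; the parameter is `c = -i (A / B + √π)`. -/
noncomputable def familyTwo (n m : ℕ) (c : OnePoint ℂ) : ℂ → ℂ :=
  c.elim (memberTwo n m 1 0) fun c => memberTwo n m (c + Complex.I * sqrtPi) (-Complex.I)

theorem familyOne_infty (n m : ℕ) : familyOne n m OnePoint.infty = memberOne n m 0 1 := rfl

theorem familyOne_coe (n m : ℕ) (c : ℂ) : familyOne n m c = memberOne n m 1 (2 * c) := rfl

theorem familyTwo_infty (n m : ℕ) : familyTwo n m OnePoint.infty = memberTwo n m 1 0 := rfl

theorem familyTwo_coe (n m : ℕ) (c : ℂ) :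
    familyTwo n m c = memberTwo n m (c + Complex.I * sqrtPi) (-Complex.I) := rfl

theorem familyOne_zero (n m : ℕ) : familyOne n m (0 : ℂ) = memberOne n m 1 0 := by
  rw [familyOne_coe, mul_zero]

theorem exists_familyOne_eq (n m : ℕ) (c : OnePoint ℂ) :
    ∃ A B, (A ≠ 0 ∨ B ≠ 0) ∧ familyOne n m c = memberOne n m A B := by
  induction c using OnePoint.rec with
  | infty => exact ⟨0, 1, by simp, familyOne_infty n m⟩
  | coe c => exact ⟨1, _, by simp, familyOne_coe n m c⟩

theorem exists_familyTwo_eq (n m : ℕ) (c : OnePoint ℂ) :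
    ∃ A B, (A ≠ 0 ∨ B ≠ 0) ∧ familyTwo n m c = memberTwo n m A B := by
  induction c using OnePoint.rec with
  | infty => exact ⟨1, 0, by simp, familyTwo_infty n m⟩
  | coe c => exact ⟨_, -Complex.I, by simp, familyTwo_coe n m c⟩

theorem firstFamily (hβ : β = -2 * m) :
    FirstFamily β n m (backgroundLin n m) (fun _ => memberOne n m 1 0) (familyOne n m) := by
  have hpi := Real.pi_pos
  have hs := sqrtPi_ne_zero
  constructor
  · intro c
    exact expAsymp_memberOne_right hβ one_ne_zero fun φ => by ring
  · exact (powerAsymp_memberOne_zero_one n m).subsector (by linarith) (by linarith)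
  · intro c hc
    exact expAsymp_memberOne_upper (mul_ne_zero two_ne_zero hc) fun φ => by field_simp
  · exact expAsymp_memberOne_upper one_ne_zero fun φ => by ring
  · rw [familyOne_zero]
    exact powerAsymp_memberOne_one_zero n hβ _ _
  · intro c hc
    have h : 1 + 2 * c * sqrtPi ≠ 0 := by rwa [mul_right_comm]
    refine expAsymp_memberOne_left hβ h fun φ => ?_
    rw [mul_right_comm 2 c]
    ring
  · refine expAsymp_memberOne_left hβ (by simpa using hs) fun φ => ?_
    rw [zero_add, one_mul]
    ring
  · intro c hc
    have hc0 : 2 * c ≠ 0 := by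
      rintro h
      rw [mul_right_comm, h] at hc
      simp at hc
    rw [familyOne_coe, memberOne_congr n m (B' := -1) (A' := sqrtPi) hc0 (by norm_num)]
    · exact (powerAsymp_memberOne_sqrtPi n m).subsector (by linarith) (by linarith)
    · rw [div_eq_div_iff hc0 (by norm_num)]
      linear_combination -hc
  · intro c hc
    exact expAsymp_memberOne_lower (mul_ne_zero two_ne_zero hc) fun φ => by field_simp
  · exact expAsymp_memberOne_lower one_ne_zero fun φ => by ring
  · rw [familyOne_zero]
    exact powerAsymp_memberOne_one_zero n hβ _ _

theorem div_neg_I (c : ℂ) : c / -Complex.I = Complex.I * c := by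
  rw [div_neg, Complex.div_I]
  ring

theorem secondFamily (hβ : β = -2 * m) :
    SecondFamily β n m (fun _ => memberOne n m 1 0) (backgroundPlus n m) (familyTwo n m) := by
  have hpi := Real.pi_pos
  have hI : -Complex.I ≠ 0 := neg_ne_zero.2 Complex.I_ne_zero
  have hI2 := Complex.I_sq
  have hinf (lo hi : ℝ) : PowerAsymp (familyTwo n m OnePoint.infty) (leadMinus β) lo hi := by
    rw [familyTwo_infty, memberTwo_B_zero n m 1 1]
    exact powerAsymp_memberOne_one_zero n hβ _ _
  have hA (c : ℂ) : c + Complex.I * sqrtPi + -Complex.I * sqrtPi = c := by ring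
  constructor
  · intro c
    refine expAsymp_memberTwo_right hβ hI fun φ => ?_
    rw [div_neg_I]
    linear_combination (-c - Complex.I * sqrtPi) * const₃ n m * hI2
  · exact hinf _ _
  · intro c hc
    refine expAsymp_memberTwo_upper hβ hc fun φ => ?_
    linear_combination (1 / (c + Complex.I * sqrtPi)) * const₄ n m * hI2
  · exact expAsymp_memberTwo_upper hβ one_ne_zero fun φ => by ring
  · intro c hc
    rw [familyTwo_coe, hc, memberTwo_congr n m (A' := 0) (B' := 1) hI one_ne_zero (by simp)]
    exact (powerAsymp_memberTwo_zero_one n hβ).subsector (by linarith) (by linarith)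
  · intro c
    refine expAsymp_memberTwo_left hβ hI fun φ => ?_
    rw [div_neg_I]
    linear_combination (-c - Complex.I * sqrtPi) * const₃ n m * hI2
  · exact hinf _ _
  · intro c hc
    refine expAsymp_memberTwo_lower hβ (by rwa [hA]) fun φ => ?_
    rw [hA]
    linear_combination (1 / c) * const₄ n m * hI2
  · exact expAsymp_memberTwo_lower hβ (by simp) fun φ => by ring
  · rw [familyTwo_coe, zero_add, memberTwo_congr n m (A' := sqrtPi) (B' := -1) hI (by norm_num)]
    · exact (powerAsymp_memberTwo_sqrtPi n hβ).subsector (by linarith) (by linarith)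
    · rw [div_neg_I]
      linear_combination sqrtPi * hI2

/-! ### Comparison of the members -/

/-- A function that is asymptotic to `-2 x` in a sector is not `O(1 / x)` there. -/
theorem not_lim_of_lim {lo hi : ℝ} {y : ℂ → ℂ} {c : ℂ} (h : lo < hi)
    (h1 : SectorLim lo hi (fun x => x ^ (-1 : ℤ) * y x) (-2))
    (h2 : SectorLim lo hi (fun x => x ^ (1 : ℤ) * y x) c) : False := by
  have := h1.unique h2.zpow_neg_one_mul h
  norm_num at this

theorem right_lt : -(Real.pi / 4) < Real.pi / 4 := by linarith [Real.pi_pos]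

theorem upper_lt : Real.pi / 4 < 3 * Real.pi / 4 := by linarith [Real.pi_pos]

theorem memberOne_lim_right (n m : ℕ) (hA : A ≠ 0) :
    SectorLim (-(Real.pi / 4)) (Real.pi / 4) (fun x => x ^ (1 : ℤ) * memberOne n m A B x) m :=
  (pairVPos_right n m hA).lim

theorem memberOne_lim_upper (n m : ℕ) (hB : B ≠ 0) :
    SectorLim (Real.pi / 4) (3 * Real.pi / 4) (fun x => x ^ (-1 : ℤ) * memberOne n m A B x)
      (-2) :=
  memberOne_lim n m hB (scaledDenom_upper A B)

theorem memberTwo_lim_right (n m : ℕ) (hB : B ≠ 0) :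
    SectorLim (-(Real.pi / 4)) (Real.pi / 4) (fun x => x ^ (1 : ℤ) * memberTwo n m A B x) (-m) :=
  memberTwo_lim n m hB (scaledDenom_right A B)

theorem memberTwo_lim_upper (n m : ℕ) (hAB : A ≠ 0 ∨ B ≠ 0) :
    ∃ c, SectorLim (Real.pi / 4) (3 * Real.pi / 4)
      (fun x => x ^ (1 : ℤ) * memberTwo n m A B x) c := by
  have hpi := Real.pi_pos
  rcases eq_or_ne A 0 with rfl | hA
  · have hB : B ≠ 0 := hAB.resolve_left fun h => h rfl
    have h := scaledDenom_lim_of_zero neg_I_eq_exp neg_I_sq B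
    exact ⟨_, (memberTwo_lim n m hB h).subsector (by linarith) (by linarith)⟩
  · exact ⟨_, (pairVNeg_upper n m hA).lim⟩

theorem familyOne_injective (n m : ℕ) : Function.Injective (familyOne n m) := by
  have key (c : ℂ) : memberOne n m 0 1 ≠ memberOne n m 1 (2 * c) := fun h => by
    have h1 := scaledDenom_lim_of_zero one_eq_exp_zero (one_pow 2) 1
    rw [sub_zero, sub_zero] at h1
    have h2 := (memberOne_lim n m one_ne_zero h1).subsector (lo' := -(Real.pi / 4))
      (hi' := Real.pi / 4) (by linarith [Real.pi_pos]) (by linarith [Real.pi_pos])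
    rw [h] at h2
    exact not_lim_of_lim right_lt h2 (memberOne_lim_right n m one_ne_zero)
  intro c d h
  induction c using OnePoint.rec with
  | infty =>
    induction d using OnePoint.rec with
    | infty => rfl
    | coe d => exact absurd h (key d)
  | coe c =>
    induction d using OnePoint.rec with
    | infty => exact absurd h.symm (key c)
    | coe d =>
      have h1 := (pairVPos_right (B := 2 * c) n m one_ne_zero).diff
      have h2 := (pairVPos_right (B := 2 * d) n m one_ne_zero).diff
      rw [familyOne_coe, familyOne_coe, memberOne, memberOne] at h
      rw [h] at h1
      have h3 := mul_right_cancel₀ (const₁_ne_zero n m) (h1.unique h2 right_lt)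
      have : c = d := by linear_combination -h3
      rw [this]

theorem familyTwo_injective (n : ℕ) (hm : m ≠ 0) : Function.Injective (familyTwo n m) := by
  have hI : -Complex.I ≠ 0 := neg_ne_zero.2 Complex.I_ne_zero
  have key (c : ℂ) : memberTwo n m 1 0 ≠ memberTwo n m (c + Complex.I * sqrtPi) (-Complex.I) :=
    fun h => by
      have h1 := memberOne_one_zero_lim n m (-(Real.pi / 4)) (Real.pi / 4)
      rw [← memberTwo_B_zero n m 1, h] at h1
      have h2 := h1.unique (memberTwo_lim_right n m hI) right_lt
      exact hm (Nat.cast_eq_zero.1 (self_eq_neg.1 h2))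
  intro c d h
  induction c using OnePoint.rec with
  | infty =>
    induction d using OnePoint.rec with
    | infty => rfl
    | coe d => exact absurd h (key d)
  | coe c =>
    induction d using OnePoint.rec with
    | infty => exact absurd h.symm (key c)
    | coe d =>
      have hd (c : ℂ) := diff_memberTwo n m hI one_ne_zero
        (scaledDenom_right (c + Complex.I * sqrtPi) (-Complex.I)) (scaledDenom_right 0 1)
      have h1 := hd c
      rw [familyTwo_coe, familyTwo_coe] at h
      rw [h] at h1
      have h3 := mul_left_cancel₀ Complex.I_ne_zero
        (mul_right_cancel₀ (const₃_ne_zero n hm) (h1.unique (hd d) right_lt))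
      rw [div_neg_I, div_neg_I] at h3
      have : c = d := mul_left_cancel₀ Complex.I_ne_zero (by linear_combination h3)
      rw [this]

theorem eq_of_familyOne_eq_familyTwo {c c' : OnePoint ℂ}
    (h : familyOne n m c = familyTwo n m c') :
    c = (0 : ℂ) ∧ (m ≠ 0 → c' = OnePoint.infty) := by
  obtain ⟨A, B, hAB, hf⟩ := exists_familyTwo_eq n m c'
  obtain ⟨e, he⟩ := memberTwo_lim_upper n m hAB
  rw [← hf, ← h] at he
  have hc : c = (0 : ℂ) := by
    by_contra hc
    induction c using OnePoint.rec with
    | infty => exact not_lim_of_lim upper_lt (memberOne_lim_upper n m one_ne_zero) he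
    | coe c =>
      have hc' : 2 * c ≠ 0 := mul_ne_zero two_ne_zero fun h => hc (by rw [h])
      exact not_lim_of_lim upper_lt (memberOne_lim_upper n m hc') he
  refine ⟨hc, fun hm => ?_⟩
  subst hc
  refine familyTwo_injective n hm ?_
  rw [← h, familyOne_zero, familyTwo_infty, memberTwo_B_zero n m 1 1]

theorem isRational_familyOne_iff (n m : ℕ) (c : OnePoint ℂ) :
    IsRational (familyOne n m c) ↔ c = (0 : ℂ) := by
  constructor
  · intro hr
    by_contra hc
    have key : ∀ {lo hi : ℝ} {A B : ℂ}, familyOne n m c = memberOne n m A B → B ≠ 0 → lo < hi →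
        SectorLim lo hi (fun x => x ^ (1 : ℤ) * memberOne n m A B x) m → False := by
      intro lo hi A B h hB hlt hlim
      rw [h] at hr
      have := hr.sectorLim_unique (memberOne_lim_upper n m hB) hlim.zpow_neg_one_mul upper_lt hlt
      norm_num at this
    induction c using OnePoint.rec with
    | infty =>
      have h : (0 : ℂ) + 1 * sqrtPi ≠ 0 := by simpa using sqrtPi_ne_zero
      exact key (familyOne_infty n m) one_ne_zero (by linarith [Real.pi_pos])
        (pairVPos_left n m h).lim
    | coe c =>
      have hc' : 2 * c ≠ 0 := mul_ne_zero two_ne_zero fun h => hc (by rw [h])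
      exact key (familyOne_coe n m c) hc' right_lt (memberOne_lim_right n m one_ne_zero)
  · rintro rfl
    rw [familyOne_zero]
    exact isRational_memberOne_B_zero n m

theorem isRational_familyTwo_iff (n : ℕ) (hm : m ≠ 0) (c : OnePoint ℂ) :
    IsRational (familyTwo n m c) ↔ c = OnePoint.infty := by
  have hI : -Complex.I ≠ 0 := neg_ne_zero.2 Complex.I_ne_zero
  constructor
  · intro hr
    induction c using OnePoint.rec with
    | infty => rfl
    | coe c =>
      rw [familyTwo_coe] at hr
      have key : ∀ {lo hi : ℝ}, lo < hi → ¬ SectorLim lo hi (fun x => x ^ (1 : ℤ) *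
          memberTwo n m (c + Complex.I * sqrtPi) (-Complex.I) x) m := fun hlt hlim => by
        have := hr.sectorLim_unique hlim (memberTwo_lim_right n m hI) hlt right_lt
        exact hm (Nat.cast_eq_zero.1 (self_eq_neg.1 this))
      rcases eq_or_ne (c + Complex.I * sqrtPi) 0 with h | h
      · have h' : c + Complex.I * sqrtPi + -Complex.I * sqrtPi ≠ 0 := by
          rw [h, zero_add]
          exact mul_ne_zero hI sqrtPi_ne_zero
        exact absurd (pairVNeg_lower n m h').lim (key (by linarith [Real.pi_pos]))
      · exact absurd (pairVNeg_upper n m h).lim (key upper_lt)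
  · rintro rfl
    rw [familyTwo_infty, memberTwo_B_zero n m 1 1]
    exact isRational_memberOne_B_zero n m

end Triple

theorem theorem4 (n m : ℕ) (α β : ℂ) (hα : α = 1 / 2 + n) (hβ : β = -2 * m) :
    -- the backgrounds with leading terms `-2 x`, `-β / (2 x)`, `β / (2 x)` in all quadrants
    ∃ BL BM BP : ℤ → ℂ → ℂ,
      (∀ j : ℤ,
        PainleveIV.IsBackground (2 * α - β / 2) (β ^ 2) PainleveIV.leadLin j (BL j) ∧
        PainleveIV.IsBackground (2 * α - β / 2) (β ^ 2) (PainleveIV.leadMinus β) j (BM j) ∧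
        PainleveIV.IsBackground (2 * α - β / 2) (β ^ 2) (PainleveIV.leadPlus β) j (BP j)) ∧
    -- the two families
    ∃ Y₁ Y₂ : OnePoint ℂ → ℂ → ℂ,
      (∀ c, PainleveIV.IsSolution (2 * α - β / 2) (β ^ 2) (Y₁ c) ∧
        PainleveIV.IsClassical α β (Y₁ c)) ∧
      (∀ c, PainleveIV.IsSolution (2 * α - β / 2) (β ^ 2) (Y₂ c) ∧
        PainleveIV.IsClassical α β (Y₂ c)) ∧
      PainleveIV.FirstFamily β n m BL BM Y₁ ∧
      PainleveIV.SecondFamily β n m BM BP Y₂ ∧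
      -- they are one-parameter families, and `m = 0` gives the trivial second family
      Function.Injective Y₁ ∧
      (m ≠ 0 → Function.Injective Y₂) ∧
      (m = 0 → ∀ c, Y₂ c = fun _ => 0) ∧
      -- they are distinct: they have only one solution in common
      (∀ c c', Y₁ c = Y₂ c' → c = ((0 : ℂ) : OnePoint ℂ) ∧ (m ≠ 0 → c' = OnePoint.infty)) ∧
      Y₁ ((0 : ℂ) : OnePoint ℂ) = Y₂ OnePoint.infty ∧
      -- the rational solutions
      (∀ c, PainleveIV.IsRational (Y₁ c) ↔ c = ((0 : ℂ) : OnePoint ℂ)) ∧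
      (m ≠ 0 → ∀ c, PainleveIV.IsRational (Y₂ c) ↔ c = OnePoint.infty) := by
  have hc : IsClassical α β = IsClassical (1 / 2 + n) (-2 * m) := by rw [hα, hβ]
  refine ⟨Triple.backgroundLin n m, fun _ => Triple.memberOne n m 1 0, Triple.backgroundPlus n m,
    fun j => ⟨Triple.isBackground_lin hα hβ j, Triple.isBackground_minus hα hβ j,
      Triple.isBackground_plus hα hβ j⟩,
    Triple.familyOne n m, Triple.familyTwo n m, fun c => ?_, fun c => ?_,
    Triple.firstFamily hβ, Triple.secondFamily hβ, Triple.familyOne_injective n m,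
    Triple.familyTwo_injective n, fun hm c => ?_, fun c c' h =>
      Triple.eq_of_familyOne_eq_familyTwo h, ?_, Triple.isRational_familyOne_iff n m,
    Triple.isRational_familyTwo_iff n⟩
  · obtain ⟨A, B, hAB, h⟩ := Triple.exists_familyOne_eq n m c
    rw [h, hc]
    exact ⟨Triple.isSolution_memberOne hAB hα hβ, Triple.isClassical_memberOne hAB⟩
  · obtain ⟨A, B, hAB, h⟩ := Triple.exists_familyTwo_eq n m c
    rw [h, hc]
    exact ⟨Triple.isSolution_memberTwo hAB hα hβ, Triple.isClassical_memberTwo hAB⟩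
  · obtain ⟨A, B, hAB, h⟩ := Triple.exists_familyTwo_eq n m c
    subst hm
    rw [h, Triple.memberTwo_zero_eq_zero n hAB]
  · rw [Triple.familyOne_zero, Triple.familyTwo_infty, Triple.memberTwo_B_zero n m 1 1]
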